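/- **Setting.** Let $K$ be a field of characteristic $0$ with an involution $*$, and let $q\in K$ be nonzero, not a root of unity, with $q^*=q^{-1}$ (e.g. $K=\mathbb C(q)$, or $K=\mathbb C$ and $|q|=1$). Let $g$ be $A_1^{(1)}$ or $C(2)^{(2)}$, put $\theta=\theta(\alpha)=0$ for $A_1^{(1)}$ and $\theta=1$ for $C(2)^{(2)}$; for $\beta=x\alpha+y\delta$ put $\vartheta(\beta)\equiv x\theta \pmod 2$, and $(\alpha,\alpha)=2$, $(\alpha,\delta)=(\delta,\delta)=0$. For elements $e_\beta,e_{\beta'}$ of weights $\beta,\beta'$ let $$[e_\beta,e_{\beta'}]=e_\beta e_{\beta'}-(-1)^{\vartheta(\beta)\vartheta(\beta')}e_{\beta'}e_\beta,\qquad [e_\beta,e_{\beta'}]_q=e_\beta e_{\beta'}-(-1)^{\vartheta(\beta)\vartheta(\beta')}q^{(\beta,\beta')}e_{\beta'}e_\beta .$$ $U_q(g)$ is the unital associative $K$-algebra generated by $k_\gamma^{\pm1}$ ($\gamma=\mathrm d,\alpha,\delta-\alpha$), $e_{\pm\alpha}$, $e_{\pm(\delta-\alpha)}$ with the relations: $k_\gamma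 k_\gamma^{-1}=k_\gamma^{-1}k_\gamma=1$; the $k_\gamma^{\pm1}$ commute; $k_\gamma e_{\pm\beta}k_\gamma^{-1}=q^{\pm(\gamma,\beta)}e_{\pm\beta}$ for $\beta=\alpha,\delta-\alpha$, where $(\mathrm d,\alpha)=0$, $(\mathrm d,\delta)=1$; $[e_\alpha,e_{-\delta+\alpha}]=[e_{-\alpha},e_{\delta-\alpha}]=0$; $[e_\beta,e_{-\beta}]=(k_\beta-k_\beta^{-1})/(q-q^{-1})$ for $\beta=\alpha,\delta-\alpha$; $[e_{\pm\alpha},[e_{\pm\alpha},[e_{\pm\alpha},e_{\pm(\delta-\alpha)}]_q]_q]_q=0$ and $[[[e_{\pm\alpha},e_{\pm(\delta-\alpha)}]_q,e_{\pm(\delta-\alpha)}]_q,e_{\pm(\delta-\alpha)}]_q=0$. Put $k_\delta=k_\alpha k_{\delta-\alpha}$ and $k_{n\delta\pm\alpha}=k_\delta^nk_\alpha^{\pm1}$. Let $*$ also denote the antilinear antiautomorphism of $U_q(g)$ ($(xy)^*=y^*x^*$) with $k_\gamma^*=k_\gamma^{-1}$, $e_{\pm\beta}^*=e_{\mp\beta}$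 ($\beta=\alpha,\delta-\alpha$). With $a=(q^{(\alpha,\alpha)}-q^{-(\alpha,\alpha)})/(q-q^{-1})$ define, for $n\ge1$, $$e_\delta=[e_\alpha,e_{\delta-\alpha}]_q,\quad e_{n\delta+\alpha}=\tfrac1a[e_{(n-1)\delta+\alpha},e_\delta],\quad e_{(n+1)\delta-\alpha}=\tfrac1a[e_\delta,e_{n\delta-\alpha}],\quad e'_{n\delta}=[e_\alpha,e_{n\delta-\alpha}]_q,$$ $$e_{-\delta}=[e_{-\delta+\alpha},e_{-\alpha}]_{q^{-1}},\quad e_{-n\delta-\alpha}=\tfrac1a[e_{-\delta},e_{-(n-1)\delta-\alpha}],\quad e_{-(n+1)\delta+\alpha}=\tfrac1a[e_{-n\delta+\alpha},e_{-\delta}].$$ New imaginary root vectors $e_{n\delta}$ ($n\ge1$) are introduced through the formal series $$\mathcal E'(u)=(-1)^{\theta}(q-q^{-1})\sum_{n\ge1}e'_{n\delta}u^{-n},\qquad \mathcal E(u)=(-1)^{\theta}(q-q^{-1})\sum_{n\ge1}e_{n\delta}u^{-n},\qquad \mathcal E(u)=\ln(1+\mathcal E'(u)),$$ and $e_{-n\delta}=(e_{n\delta})^*$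 for $n\geq 1$. **Proposition.** One has $\mathcal E'(u)=-1+\exp\mathcal E(u)$, and, with $a(m)=\dfrac{q^{m(\alpha,\alpha)}-q^{-m(\alpha,\alpha)}}{m(q-q^{-1})}$, for all integers $n,m$ in the indicated ranges, $$[e_{n\delta+\alpha},e_{m\delta}]=(-1)^{(m-1)\theta}a(m)\,e_{(n+m)\delta+\alpha}\qquad(n\ge0,\ m>0),$$ $$[e_{m\delta},e_{n\delta-\alpha}]=(-1)^{(m-1)\theta}a(m)\,e_{(n+m)\delta-\alpha}\qquad(n,m>0),$$ $$[e_{-n\delta+\alpha},e_{m\delta}]=-(-1)^{(n+m)\theta}a(m)\,k_{n\delta-\alpha}\,e_{(m-n)\delta+\alpha}\qquad(m\ge n>0),$$ $$[e_{-n\delta+\alpha},e_{m\delta}]=(-1)^{\theta}a(m)\,k_\delta^m\,e_{(-n+m)\delta+\alpha}\qquad(n>m>0),$$ $$[e_{m\delta},e_{-n\delta-\alpha}]=-(-1)^{(n+m)\theta}a(m)\,e_{(m-n)\delta-\alpha}\,k_{n\delta+\alpha}^{-1}\qquad(m>n\ge0),$$ $$[e_{m\delta},e_{-n\delta-\alpha}]=(-1)^{\theta}a(m)\,e_{(-n+m)\delta-\alpha}\,k_\delta^{-m}\qquad(n\ge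 m>0),$$ $$[e_{n\delta},e_{-m\delta}]=\delta_{nm}\,a(m)\,\frac{k_\delta^m-k_\delta^{-m}}{q-q^{-1}}\qquad(n,m>0).$$ -/

import Mathlib

namespace QuantumAffine

/-! ### Roots, parity, brackets -/

/-- The two affine (super)algebras under consideration: `A₁⁽¹⁾` and `C(2)⁽²⁾`. -/
inductive AffineType
  | A11
  | C22

/-- The parity `θ(α)` of the simple root `α` (it is also the parity of `δ - α`): both simple roots
are even for `A₁⁽¹⁾` and odd for `C(2)⁽²⁾`. -/
def AffineType.theta : AffineType → ℕ
  | .A11 => 0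
  | .C22 => 1

/-- The root lattice `ℤα ⊕ ℤδ`; the pair `(x, y)` stands for `xα + yδ`. -/
abbrev RootLattice := ℤ × ℤ

/-- The simple root `α`. -/
def rootAlpha : RootLattice := (1, 0)

/-- The imaginary root `δ`. -/
def rootDelta : RootLattice := (0, 1)

/-- The symmetric form with `(α, α) = 2`, `(α, δ) = (δ, δ) = 0`; thus
`(δ - α, δ - α) = 2` and `(α, δ - α) = -2`, the symmetric Cartan matrix of both types. -/
def form (β β' : RootLattice) : ℤ := 2 * β.1 * β'.1

/-- The parity `ϑ(β) ∈ {0, 1}`, for `β = xα + yδ` congruent to `x θ(α)` modulo 2. -/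
def parity (ty : AffineType) (β : RootLattice) : ℕ := (ty.theta * β.1.natAbs) % 2

/-- The supercommutator `[x, y] = x y - (-1)^{ϑ(β)ϑ(β')} y x` of elements of weights `β`, `β'`. -/
def superBracket {A : Type*} [Ring A] (ty : AffineType) (β β' : RootLattice) (x y : A) : A :=
  x * y - (-1) ^ (parity ty β * parity ty β') * (y * x)

/-- The q-supercommutator `[x, y]_q = x y - (-1)^{ϑ(β)ϑ(β')} q^{(β, β')} y x` of elements of
weights `β`, `β'`. -/
def qBracket {K A : Type*} [Field K] [Ring A] [Algebra K A] (ty : AffineType) (q : K)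
    (β β' : RootLattice) (x y : A) : A :=
  x * y - ((-1) ^ (parity ty β * parity ty β') * q ^ form β β') • (y * x)

/-- `[x, [x, [x, y]_q]_q]_q` for elements `x`, `y` of weights `β`, `β'`. -/
def serreLeft {K A : Type*} [Field K] [Ring A] [Algebra K A] (ty : AffineType) (q : K)
    (β β' : RootLattice) (x y : A) : A :=
  qBracket ty q β (β + (β + β')) x (qBracket ty q β (β + β') x (qBracket ty q β β' x y))

/-- `[[[x, y]_q, y]_q, y]_q` for elements `x`, `y` of weights `β`, `β'`. -/
def serreRight {K A : Type*} [Field K] [Ring A] [Algebra K A] (ty : AffineType) (q : K)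
    (β β' : RootLattice) (x y : A) : A :=
  qBracket ty q (β + β' + β') β' (qBracket ty q (β + β') β' (qBracket ty q β β' x y) y) y

/-! ### The quantum affine (super)algebra -/

/-- A generic deformation parameter: a nonzero `q` in a field with an involution `*`, not a root of
unity, with `q^* = q⁻¹` (for example the variable of `ℂ(q)`, or a complex number on the unit
circle). -/
structure DeformationParameter (K : Type*) [Field K] [StarRing K] where
  q : K
  ne_zero : q ≠ 0
  star_eq : star q = q⁻¹
  pow_ne_one : ∀ n : ℕ, 0 < n → q ^ n ≠ 1

/-- The labels `α`, `δ - α` of the simple roots. -/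
inductive Node
  | alpha
  | deltaSubAlpha

/-- The simple root with a given label. -/
def Node.root : Node → RootLattice
  | .alpha => rootAlpha
  | .deltaSubAlpha => rootDelta - rootAlpha

/-- The labels `γ = d, α, δ - α` of the Cartan generators. -/
inductive CartanLabel
  | d
  | simple (i : Node)

/-- The number `(γ, β)`, where `(d, α) = 0` and `(d, δ) = 1`. -/
def CartanLabel.pairing : CartanLabel → RootLattice → ℤ
  | .d, β => β.2
  | .simple i, β => form i.root β

/-- The Chevalley generators `k_γ`, `k_γ⁻¹`, `e_β`, `e_{-β}` (`β` a simple root). -/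
inductive Generator
  | k (γ : CartanLabel)
  | kInv (γ : CartanLabel)
  | e (i : Node)
  | f (i : Node)

section Presentation

variable {K : Type*} [Field K]

local notation "ι" => FreeAlgebra.ι K

/-- The defining relations. The generators `e_{δ-α}`, `e_{-(δ-α)}` are `e Node.deltaSubAlpha`,
`f Node.deltaSubAlpha`. (Commutation of the `k_γ` implies that of all `k_γ^{±1}`.) -/
inductive Rel (ty : AffineType) (q : K) :
    FreeAlgebra K Generator → FreeAlgebra K Generator → Prop
  | k_kInv (γ : CartanLabel) : Rel ty q (ι (.k γ) * ι (.kInv γ)) 1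
  | kInv_k (γ : CartanLabel) : Rel ty q (ι (.kInv γ) * ι (.k γ)) 1
  | k_comm (γ γ' : CartanLabel) : Rel ty q (ι (.k γ) * ι (.k γ')) (ι (.k γ') * ι (.k γ))
  | k_e (γ : CartanLabel) (i : Node) :
      Rel ty q (ι (.k γ) * ι (.e i) * ι (.kInv γ)) (q ^ γ.pairing i.root • ι (.e i))
  | k_f (γ : CartanLabel) (i : Node) :
      Rel ty q (ι (.k γ) * ι (.f i) * ι (.kInv γ)) (q ^ (-γ.pairing i.root) • ι (.f i))
  | e_f_ne (i j : Node) (hij : i ≠ j) :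
      Rel ty q (superBracket ty i.root (-j.root) (ι (.e i)) (ι (.f j))) 0
  | e_f (i : Node) :
      Rel ty q (superBracket ty i.root (-i.root) (ι (.e i)) (ι (.f i)))
        ((q - q⁻¹)⁻¹ • (ι (.k (.simple i)) - ι (.kInv (.simple i))))
  | serre_e_alpha :
      Rel ty q (serreLeft ty q rootAlpha (rootDelta - rootAlpha)
        (ι (.e .alpha)) (ι (.e .deltaSubAlpha))) 0
  | serre_f_alpha :
      Rel ty q (serreLeft ty q (-rootAlpha) (-(rootDelta - rootAlpha))
        (ι (.f .alpha)) (ι (.f .deltaSubAlpha))) 0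
  | serre_e_delta :
      Rel ty q (serreRight ty q rootAlpha (rootDelta - rootAlpha)
        (ι (.e .alpha)) (ι (.e .deltaSubAlpha))) 0
  | serre_f_delta :
      Rel ty q (serreRight ty q (-rootAlpha) (-(rootDelta - rootAlpha))
        (ι (.f .alpha)) (ι (.f .deltaSubAlpha))) 0

end Presentation

section Algebra

variable {K : Type*} [Field K] [StarRing K]

/-- The quantum affine (super)algebra `U_q(A₁⁽¹⁾)`, respectively `U_q(C(2)⁽²⁾)`, by generators and
relations. -/
def U (ty : AffineType) (P : DeformationParameter K) : Type _ := RingQuot (Rel ty P.q)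

variable (ty : AffineType) (P : DeformationParameter K)

noncomputable instance : Ring (U ty P) := inferInstanceAs (Ring (RingQuot (Rel ty P.q)))

noncomputable instance : Algebra K (U ty P) :=
  inferInstanceAs (Algebra K (RingQuot (Rel ty P.q)))

/-- The class of a free-algebra element. -/
noncomputable def U.mk : FreeAlgebra K Generator →ₐ[K] U ty P := RingQuot.mkAlgHom K (Rel ty P.q)

/-- The class of a Chevalley generator. -/
noncomputable def U.gen (g : Generator) : U ty P := U.mk ty P (FreeAlgebra.ι K g)

theorem U.mk_rel {x y : FreeAlgebra K Generator} (h : Rel ty P.q x y) :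
    U.mk ty P x = U.mk ty P y := RingQuot.mkAlgHom_rel K h

/-- `k_γ` as a unit of the algebra; `k_γ⁻¹` is its inverse. -/
noncomputable def U.k (γ : CartanLabel) : (U ty P)ˣ where
  val := U.gen ty P (.k γ)
  inv := U.gen ty P (.kInv γ)
  val_inv := by simpa [U.gen] using U.mk_rel ty P (Rel.k_kInv γ)
  inv_val := by simpa [U.gen] using U.mk_rel ty P (Rel.kInv_k γ)

end Algebra

section BracketLemmas

variable {K : Type*} [Field K] (ty : AffineType)

theorem form_neg_neg (β β' : RootLattice) : form (-β) (-β') = form β β' := by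
  simp [form]

theorem parity_neg (β : RootLattice) : parity ty (-β) = parity ty β := by
  simp [parity]

theorem map_superBracket {A B : Type*} [Ring A] [Ring B] (φ : A →+* B) (β β' : RootLattice)
    (x y : A) : φ (superBracket ty β β' x y) = superBracket ty β β' (φ x) (φ y) := by
  simp [superBracket]

theorem map_qBracket {A B : Type*} [Ring A] [Ring B] [Algebra K A] [Algebra K B] (φ : A →ₐ[K] B)
    (q : K) (β β' : RootLattice) (x y : A) :
    φ (qBracket ty q β β' x y) = qBracket ty q β β' (φ x) (φ y) := by
  simp [qBracket]

theorem map_serreLeft {A B : Type*} [Ring A] [Ring B] [Algebra K A] [Algebra K B] (φ : A →ₐ[K] B)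
    (q : K) (β β' : RootLattice) (x y : A) :
    φ (serreLeft ty q β β' x y) = serreLeft ty q β β' (φ x) (φ y) := by
  simp [serreLeft, map_qBracket]

theorem map_serreRight {A B : Type*} [Ring A] [Ring B] [Algebra K A] [Algebra K B] (φ : A →ₐ[K] B)
    (q : K) (β β' : RootLattice) (x y : A) :
    φ (serreRight ty q β β' x y) = serreRight ty q β β' (φ x) (φ y) := by
  simp [serreRight, map_qBracket]

theorem qBracket_smul_left {A : Type*} [Ring A] [Algebra K A] (q c : K) (β β' : RootLattice)
    (x y : A) : qBracket ty q β β' (c • x) y = c • qBracket ty q β β' x y := by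
  simp [qBracket, smul_sub, smul_comm c]

theorem qBracket_smul_right {A : Type*} [Ring A] [Algebra K A] (q c : K) (β β' : RootLattice)
    (x y : A) : qBracket ty q β β' x (c • y) = c • qBracket ty q β β' x y := by
  simp [qBracket, smul_sub, smul_comm c]

end BracketLemmas

/-! ### The conjugation `*` -/

section Conjugation

/-- The opposite of a `K`-algebra, with scalars acting through the involution of `K`; a `K`-algebra
homomorphism into it is an antilinear antihomomorphism. -/
def ConjOp (A : Type*) : Type _ := Aᵐᵒᵖ

/-- The element of `A` underlying an element of `ConjOp A`. -/
def ConjOp.un {A : Type*} (x : ConjOp A) : A := MulOpposite.unop x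

/-- An element of `A`, seen in `ConjOp A`. -/
def ConjOp.of {A : Type*} (x : A) : ConjOp A := MulOpposite.op x

variable {K : Type*} [Field K] [StarRing K]

instance {A : Type*} [Ring A] : Ring (ConjOp A) := inferInstanceAs (Ring Aᵐᵒᵖ)

/-- The scalars act on `ConjOp A` through the involution. -/
instance ConjOp.instAlgebra {A : Type*} [Ring A] [Algebra K A] : Algebra K (ConjOp A) :=
  RingHom.toAlgebra' ((algebraMap K Aᵐᵒᵖ).comp (starRingEnd K))
    fun c x => Algebra.commutes (A := Aᵐᵒᵖ) (star c) x

/-- `k_γ ↦ k_γ⁻¹`, `k_γ⁻¹ ↦ k_γ`, `e_β ↦ e_{-β}`, `e_{-β} ↦ e_β`. -/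
def Generator.conj : Generator → Generator
  | .k γ => .kInv γ
  | .kInv γ => .k γ
  | .e i => .f i
  | .f i => .e i

variable (ty : AffineType) (P : DeformationParameter K)

/-- The antilinear antihomomorphism out of the free algebra that extends `Generator.conj`. -/
noncomputable def conjFree : FreeAlgebra K Generator →ₐ[K] ConjOp (U ty P) :=
  FreeAlgebra.lift K fun g => ConjOp.of (U.gen ty P g.conj)

/-- `conjFree` without the opposite. -/
noncomputable def conjFun (x : FreeAlgebra K Generator) : U ty P :=
  (conjFree ty P x).un

theorem conjFun_ι (g : Generator) : conjFun ty P (FreeAlgebra.ι K g) = U.gen ty P g.conj := by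
  unfold conjFun conjFree
  rw [FreeAlgebra.lift_ι_apply]
  rfl

theorem conjFun_mul (x y : FreeAlgebra K Generator) :
    conjFun ty P (x * y) = conjFun ty P y * conjFun ty P x := by
  unfold conjFun; rw [map_mul]; rfl

theorem conjFun_sub (x y : FreeAlgebra K Generator) :
    conjFun ty P (x - y) = conjFun ty P x - conjFun ty P y := by
  unfold conjFun; rw [map_sub]; rfl

theorem conjFun_smul (c : K) (x : FreeAlgebra K Generator) :
    conjFun ty P (c • x) = star c • conjFun ty P x := by
  unfold conjFun
  rw [map_smul, Algebra.smul_def, Algebra.smul_def, Algebra.commutes]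
  rfl

theorem conjFun_one : conjFun ty P 1 = 1 := by
  unfold conjFun; rw [map_one]; rfl

theorem conjFun_zero : conjFun ty P 0 = 0 := by
  unfold conjFun; rw [map_zero]; rfl

theorem conjFun_superBracket (β β' : RootLattice) (x y : FreeAlgebra K Generator) :
    conjFun ty P (superBracket ty β β' x y) =
      superBracket ty (-β') (-β) (conjFun ty P y) (conjFun ty P x) := by
  have h1 : ∀ n : ℕ, conjFun ty P ((-1) ^ n * (y * x)) = (-1) ^ n * conjFun ty P (y * x) := by
    intro n
    rcases neg_one_pow_eq_or (FreeAlgebra K Generator) n with h | h <;>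
    rcases Nat.even_or_odd n with h' | h' <;>
    simp only [h'.neg_one_pow, one_mul, neg_one_mul]
    all_goals
      rw [← zero_sub, conjFun_sub, conjFun_zero, zero_sub]
  rw [superBracket, conjFun_sub, h1, conjFun_mul, conjFun_mul, superBracket, parity_neg,
    parity_neg, mul_comm (parity ty β)]

theorem conjFun_qBracket (β β' : RootLattice) (x y : FreeAlgebra K Generator) :
    ∃ c : K, conjFun ty P (qBracket ty P.q β β' x y) =
      c • qBracket ty P.q (-β) (-β') (conjFun ty P x) (conjFun ty P y) := by
  refine ⟨-((-1) ^ (parity ty β * parity ty β') * (P.q ^ form β β')⁻¹), ?_⟩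
  have hq : P.q ^ form β β' ≠ 0 := zpow_ne_zero _ P.ne_zero
  have hs : ((-1 : K) ^ (parity ty β * parity ty β')) * (-1) ^ (parity ty β * parity ty β') = 1 := by
    rw [← mul_pow]; simp
  simp only [qBracket, conjFun_sub, conjFun_smul, conjFun_mul, form_neg_neg, parity_neg, star_mul',
    star_pow, star_neg, star_one, star_zpow₀, P.star_eq, smul_sub, smul_smul, inv_zpow]
  generalize (-1 : K) ^ (parity ty β * parity ty β') = s at *
  generalize P.q ^ form β β' = t at *
  rw [show -(s * t⁻¹) * (s * t) = -1 by field_simp; linear_combination -hs]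
  simp only [neg_smul, one_smul]
  abel

theorem conjFun_serreLeft (β β' : RootLattice) (x y : FreeAlgebra K Generator)
    (h : serreLeft ty P.q (-β) (-β') (conjFun ty P x) (conjFun ty P y) = 0) :
    conjFun ty P (serreLeft ty P.q β β' x y) = 0 := by
  unfold serreLeft at h ⊢
  obtain ⟨c₁, h₁⟩ := conjFun_qBracket ty P β β' x y
  obtain ⟨c₂, h₂⟩ := conjFun_qBracket ty P β (β + β') x (qBracket ty P.q β β' x y)
  obtain ⟨c₃, h₃⟩ := conjFun_qBracket ty P β (β + (β + β')) x
    (qBracket ty P.q β (β + β') x (qBracket ty P.q β β' x y))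
  rw [h₃, h₂, h₁]
  simp only [qBracket_smul_right, neg_add, h, smul_zero]

theorem conjFun_serreRight (β β' : RootLattice) (x y : FreeAlgebra K Generator)
    (h : serreRight ty P.q (-β) (-β') (conjFun ty P x) (conjFun ty P y) = 0) :
    conjFun ty P (serreRight ty P.q β β' x y) = 0 := by
  unfold serreRight at h ⊢
  obtain ⟨c₁, h₁⟩ := conjFun_qBracket ty P β β' x y
  obtain ⟨c₂, h₂⟩ := conjFun_qBracket ty P (β + β') β' (qBracket ty P.q β β' x y) y
  obtain ⟨c₃, h₃⟩ := conjFun_qBracket ty P (β + β' + β') β'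
    (qBracket ty P.q (β + β') β' (qBracket ty P.q β β' x y) y) y
  rw [h₃, h₂, h₁]
  simp only [qBracket_smul_left, neg_add, h, smul_zero]

/-- `*` is compatible with the defining relations. -/
theorem conjFun_rel {x y : FreeAlgebra K Generator} (h : Rel ty P.q x y) :
    conjFun ty P x = conjFun ty P y := by
  cases h with
  | k_kInv γ =>
    simpa [conjFun_mul, conjFun_one, conjFun_ι, U.gen, Generator.conj]
      using U.mk_rel ty P (Rel.k_kInv γ)
  | kInv_k γ =>
    simpa [conjFun_mul, conjFun_one, conjFun_ι, U.gen, Generator.conj]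
      using U.mk_rel ty P (Rel.kInv_k γ)
  | k_comm γ γ' =>
    have h := U.mk_rel ty P (Rel.k_comm γ γ')
    simp only [map_mul] at h
    simp only [conjFun_mul, conjFun_ι, Generator.conj]
    have h' : U.k ty P γ * U.k ty P γ' = U.k ty P γ' * U.k ty P γ := Units.ext h
    have h'' : (U.k ty P γ')⁻¹ * (U.k ty P γ)⁻¹ = (U.k ty P γ)⁻¹ * (U.k ty P γ')⁻¹ := by
      rw [← mul_inv_rev, ← mul_inv_rev, h']
    exact congrArg Units.val h''
  | k_e γ i =>
    simp only [conjFun_mul, conjFun_smul, conjFun_ι, Generator.conj, star_zpow₀, P.star_eq]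
    have h := U.mk_rel ty P (Rel.k_f γ i)
    simpa [U.gen, mul_assoc] using h
  | k_f γ i =>
    simp only [conjFun_mul, conjFun_smul, conjFun_ι, Generator.conj, star_zpow₀, P.star_eq]
    have h := U.mk_rel ty P (Rel.k_e γ i)
    simpa [U.gen, mul_assoc] using h
  | e_f_ne i j hij =>
    rw [conjFun_superBracket, conjFun_ι, conjFun_ι, conjFun_zero, neg_neg]
    have h := U.mk_rel ty P (Rel.e_f_ne j i hij.symm)
    rw [map_zero] at h
    rw [← h]
    exact (map_superBracket ty (U.mk ty P).toRingHom _ _ _ _).symm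
  | e_f i =>
    rw [conjFun_superBracket, conjFun_ι, conjFun_ι, conjFun_smul, conjFun_sub, conjFun_ι,
      conjFun_ι, neg_neg]
    have h := U.mk_rel ty P (Rel.e_f i)
    rw [map_smul, map_sub] at h
    refine (map_superBracket ty (U.mk ty P).toRingHom _ _ _ _).symm.trans (h.trans ?_)
    simp only [star_inv₀, star_sub, P.star_eq, inv_inv, Generator.conj, U.gen]
    rw [← neg_sub P.q, inv_neg, neg_smul, ← smul_neg, neg_sub]
  | serre_e_alpha =>
    rw [conjFun_zero]
    refine conjFun_serreLeft ty P _ _ _ _ ?_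
    rw [conjFun_ι, conjFun_ι]
    have h := U.mk_rel ty P Rel.serre_f_alpha
    rwa [map_serreLeft, map_zero] at h
  | serre_f_alpha =>
    rw [conjFun_zero]
    refine conjFun_serreLeft ty P _ _ _ _ ?_
    rw [conjFun_ι, conjFun_ι, neg_neg, neg_neg]
    have h := U.mk_rel ty P Rel.serre_e_alpha
    rwa [map_serreLeft, map_zero] at h
  | serre_e_delta =>
    rw [conjFun_zero]
    refine conjFun_serreRight ty P _ _ _ _ ?_
    rw [conjFun_ι, conjFun_ι]
    have h := U.mk_rel ty P Rel.serre_f_delta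
    rwa [map_serreRight, map_zero] at h
  | serre_f_delta =>
    rw [conjFun_zero]
    refine conjFun_serreRight ty P _ _ _ _ ?_
    rw [conjFun_ι, conjFun_ι, neg_neg, neg_neg]
    have h := U.mk_rel ty P Rel.serre_e_delta
    rwa [map_serreRight, map_zero] at h

/-- The conjugation as a homomorphism into the opposite algebra. -/
noncomputable def conjHom : U ty P →ₐ[K] ConjOp (U ty P) :=
  RingQuot.liftAlgHom K ⟨conjFree ty P, fun _ _ h =>
    MulOpposite.unop_injective (conjFun_rel ty P h)⟩

/-- The conjugation `*`: the antilinear antiautomorphism with `k_γ^* = k_γ⁻¹`, `e_β^* = e_{-β}`,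
`e_{-β}^* = e_β`. -/
noncomputable def conj (x : U ty P) : U ty P :=
  (conjHom ty P x).un

theorem conj_mk (x : FreeAlgebra K Generator) : conj ty P (U.mk ty P x) = conjFun ty P x := by
  unfold conj conjHom U.mk
  erw [RingQuot.liftAlgHom_mkAlgHom_apply]
  rfl

theorem conj_gen (g : Generator) : conj ty P (U.gen ty P g) = U.gen ty P g.conj := by
  rw [U.gen, conj_mk, conjFun_ι]

theorem conj_mul (x y : U ty P) : conj ty P (x * y) = conj ty P y * conj ty P x := by
  unfold conj; rw [map_mul]; rfl

theorem conj_add (x y : U ty P) : conj ty P (x + y) = conj ty P x + conj ty P y := by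
  unfold conj; rw [map_add]; rfl

theorem conj_smul (c : K) (x : U ty P) : conj ty P (c • x) = star c • conj ty P x := by
  unfold conj
  rw [map_smul, Algebra.smul_def, Algebra.smul_def, Algebra.commutes]
  rfl

end Conjugation

/-! ### Root vectors -/

section RootVectors

variable {K : Type*} [Field K] [StarRing K] (ty : AffineType) (P : DeformationParameter K)

/-- The weight `nδ + α`. -/
def rootPlus (n : ℤ) : RootLattice := n • rootDelta + rootAlpha

/-- The weight `nδ - α`. -/
def rootMinus (n : ℤ) : RootLattice := n • rootDelta - rootAlpha

/-- The weight `nδ`. -/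
def rootImag (n : ℤ) : RootLattice := n • rootDelta

/-- `k_δ = k_α k_{δ-α}`. -/
noncomputable def kDelta : (U ty P)ˣ :=
  U.k ty P (.simple .alpha) * U.k ty P (.simple .deltaSubAlpha)

/-- `k_β = k_α^x k_δ^y` for `β = xα + yδ`. -/
noncomputable def kRoot (β : RootLattice) : (U ty P)ˣ :=
  U.k ty P (.simple .alpha) ^ β.1 * kDelta ty P ^ β.2

/-- `a(m) = (q^{m(α,α)} - q^{-m(α,α)}) / (m (q - q⁻¹))`. -/
noncomputable def aCoeff (m : ℤ) : K :=
  (P.q ^ (m * form rootAlpha rootAlpha) - P.q ^ (-(m * form rootAlpha rootAlpha))) /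
    (m * (P.q - P.q⁻¹))

/-- `a = [(α, α)]_q`. -/
noncomputable def a : K :=
  (P.q ^ form rootAlpha rootAlpha - P.q ^ (-form rootAlpha rootAlpha)) / (P.q - P.q⁻¹)

/-- `e_δ = [e_α, e_{δ-α}]_q`. -/
noncomputable def eDelta : U ty P :=
  qBracket ty P.q rootAlpha (rootMinus 1)
    (U.gen ty P (.e .alpha)) (U.gen ty P (.e .deltaSubAlpha))

/-- `e_{-δ} = [e_{-δ+α}, e_{-α}]_{q⁻¹}`. -/
noncomputable def eNegDelta : U ty P :=
  qBracket ty P.q⁻¹ (rootPlus (-1)) (-rootAlpha)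
    (U.gen ty P (.f .deltaSubAlpha)) (U.gen ty P (.f .alpha))

/-- `posPlus n` is `e_{nδ+α}`, `n ≥ 0`. -/
noncomputable def posPlus : ℕ → U ty P
  | 0 => U.gen ty P (.e .alpha)
  | n + 1 => (a P)⁻¹ • superBracket ty (rootPlus n) rootDelta (posPlus n) (eDelta ty P)

/-- `negMinus n` is `e_{-nδ-α}`, `n ≥ 0`. -/
noncomputable def negMinus : ℕ → U ty P
  | 0 => U.gen ty P (.f .alpha)
  | n + 1 => (a P)⁻¹ • superBracket ty (-rootDelta) (rootMinus (-n)) (eNegDelta ty P) (negMinus n)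

/-- `posMinus n` is `e_{(n+1)δ-α}`, `n ≥ 0`. -/
noncomputable def posMinus : ℕ → U ty P
  | 0 => U.gen ty P (.e .deltaSubAlpha)
  | n + 1 => (a P)⁻¹ • superBracket ty rootDelta (rootMinus (n + 1)) (eDelta ty P) (posMinus n)

/-- `negPlus n` is `e_{-(n+1)δ+α}`, `n ≥ 0`. -/
noncomputable def negPlus : ℕ → U ty P
  | 0 => U.gen ty P (.f .deltaSubAlpha)
  | n + 1 => (a P)⁻¹ • superBracket ty (rootPlus (-(n + 1))) (-rootDelta) (negPlus n)
      (eNegDelta ty P)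

/-- The real root vector `e_{nδ+α}`, `n ∈ ℤ`. -/
noncomputable def ePlus : ℤ → U ty P
  | .ofNat n => posPlus ty P n
  | .negSucc n => negPlus ty P n

/-- The real root vector `e_{nδ-α}`, `n ∈ ℤ`. -/
noncomputable def eMinus : ℤ → U ty P
  | .ofNat 0 => negMinus ty P 0
  | .ofNat (n + 1) => posMinus ty P n
  | .negSucc n => negMinus ty P (n + 1)

/-- `e'_{nδ} = [e_α, e_{nδ-α}]_q` (used for `n ≥ 1`). -/
noncomputable def ePrime (n : ℕ) : U ty P :=
  qBracket ty P.q rootAlpha (rootMinus n) (U.gen ty P (.e .alpha)) (eMinus ty P n)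

/-- The exponential of a formal power series `F` without constant term. -/
noncomputable def psExp {A : Type*} [Ring A] [Algebra K A] (F : PowerSeries A) : PowerSeries A :=
  PowerSeries.mk fun n =>
    ∑ k ∈ Finset.range (n + 1), ((k.factorial : K)⁻¹) • PowerSeries.coeff n (F ^ k)

/-- The logarithm `ln (1 + F)`, for a formal power series `F` without constant term. -/
noncomputable def psLog {A : Type*} [Ring A] [Algebra K A] (F : PowerSeries A) : PowerSeries A :=
  PowerSeries.mk fun n =>
    ∑ k ∈ Finset.Icc 1 n, ((-1) ^ (k + 1) * (k : K)⁻¹) • PowerSeries.coeff n (F ^ k)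

/-- The constant `(-1)^{θ(α)} (q - q⁻¹)`. -/
noncomputable def genConst : K := (-1) ^ ty.theta * (P.q - P.q⁻¹)

/-- The series `(-1)^{θ(α)} (q - q⁻¹) ∑_{n ≥ 1} x_n u^{-n}`, in the variable `u⁻¹`. -/
noncomputable def genSeries (x : ℕ → U ty P) : PowerSeries (U ty P) :=
  PowerSeries.mk fun n => if n = 0 then 0 else genConst ty P • x n

/-- The positive imaginary root vectors `e_{nδ}`, `n ≥ 1`, given by `ℰ(u) = ln (1 + ℰ'(u))`. -/
noncomputable def posImag (n : ℕ) : U ty P :=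
  (genConst ty P)⁻¹ • PowerSeries.coeff n (psLog (K := K) (genSeries ty P (ePrime ty P)))

/-- The imaginary root vectors `e_{nδ}`, `n ≠ 0` (with `0` at `n = 0`), where
`e_{-nδ} = (e_{nδ})^*`. -/
noncomputable def eImag : ℤ → U ty P
  | .ofNat n => posImag ty P n
  | .negSucc n => conj ty P (posImag ty P (n + 1))

end RootVectors

end QuantumAffine

open QuantumAffine

namespace QuantumAffine

/-! ### Deformed commutators, Newton coefficients, and exchange relations with a current. -/

section Currents

variable {K A : Type*} [Field K] [Ring A] [Algebra K A]

/-! The real root vectors are assembled into two currents `xCurrent`, `yCurrent` indexed by all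
integers, with signs and Cartan factors absorbed. With `ρ = (-1)^θ q²`, commutation with a multiple
of `e_δ` then raises the index of both currents, and commutation with a multiple of `e_{-δ}` lowers
it, uniformly in the index and up to the central unit `k_δ`. The sign of the super case survives
only inside `ρ` and in scalar prefactors, so both algebras are treated at once. This is the content
of `loopCurrents`; everything about products of currents is proved for an abstract `LoopCurrents`
structure.

Put `ψ_n = [x_0, y_n]_ρ`, a multiple of `e'_{nδ}`. The heart is `level_all`: for `i + j = r ≥ 1` the
bracket `[x_i, y_j]_ρ` depends only on `r`, and `ψ` satisfies exchange relations with both currents.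
In generating-function form the exchange relation with `x` says that conjugating by `ψ(t)` acts as
`(1 - ρtS)/(1 - ρ⁻¹tS)`, with `S` the index shift. Hence the logarithmic derivative of `ψ`, whose
coefficients are `newton ψ m`, shifts indices by `m` with factor `∓(ρ^m - ρ^{-m})` (`newton_lie`).
The induction on the level closes because `[newton ψ n, ψ_1]` can be computed in two ways, which
forces `[ψ_n, ψ_1] = 0` when `q` is generic and the characteristic is zero (`level_comm`).

It follows that all `ψ_n` commute, so `ln` and `exp` behave as in a commutative ring. This gives the
exponential formula and identifies `m` times the `m`-th coefficient of `ℰ(u)` with `newton ψ m`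
(`nsmul_coeff_psLog`). The relations of `e_{mδ}` with real root vectors are the shift formulas with
the Cartan factors restored. Applying `*` yields the action of `e_{-mδ}`, which lowers indices; as a
derivation it multiplies `ψ(t)` by a central multiple of `t^m`, so it pairs with `ln ψ` only in
degree `m` (`newton_lie_lowering`). This gives the Heisenberg relation. -/

theorem mul_lie_eq (a b d : A) : ⁅a * b, d⁆ = ⁅a, d⁆ * b + a * ⁅b, d⁆ := by
  simp only [Ring.lie_def]; noncomm_ring

theorem lie_mul_eq (d a b : A) : ⁅d, a * b⁆ = ⁅d, a⁆ * b + a * ⁅d, b⁆ := by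
  simp only [Ring.lie_def]; noncomm_ring

theorem commutator_skew (a b : A) : ⁅a, b⁆ = -⁅b, a⁆ := by
  simp only [Ring.lie_def, neg_sub]

theorem sub_commutator (a b d : A) : ⁅a - b, d⁆ = ⁅a, d⁆ - ⁅b, d⁆ := by
  simp only [Ring.lie_def, sub_mul, mul_sub]; abel

theorem smul_commutator (c : K) (a d : A) : ⁅c • a, d⁆ = c • ⁅a, d⁆ := by
  simp only [Ring.lie_def, smul_mul_assoc, mul_smul_comm, smul_sub]

theorem commutator_smul (c : K) (a d : A) : ⁅a, c • d⁆ = c • ⁅a, d⁆ := by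
  simp only [Ring.lie_def, smul_mul_assoc, mul_smul_comm, smul_sub]

theorem commutator_jacobi (a b d : A) : ⁅⁅a, b⁆, d⁆ = ⁅⁅a, d⁆, b⁆ + ⁅a, ⁅b, d⁆⁆ := by
  simp only [Ring.lie_def]; noncomm_ring

theorem lie_eq_zero_of_commute {a b : A} (h : Commute a b) : ⁅a, b⁆ = 0 := by
  rw [Ring.lie_def, h.eq, sub_self]

theorem commute_of_lie_eq_zero {a b : A} (h : ⁅a, b⁆ = 0) : Commute a b := by
  rwa [Ring.lie_def, sub_eq_zero] at h

/-- The deformed commutator `x y - p⁻¹ y x`. -/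
def pBracket (p : K) (x y : A) : A := x * y - p⁻¹ • (y * x)

theorem pBracket_lie (p : K) (x y d : A) :
    ⁅pBracket p x y, d⁆ = pBracket p ⁅x, d⁆ y + pBracket p x ⁅y, d⁆ := by
  simp only [pBracket, Ring.lie_def, mul_sub, sub_mul, smul_mul_assoc, mul_smul_comm, mul_assoc]
  module

theorem lie_pBracket (p : K) (d x y : A) :
    ⁅d, pBracket p x y⁆ = pBracket p ⁅d, x⁆ y + pBracket p x ⁅d, y⁆ := by
  simp only [pBracket, Ring.lie_def, mul_sub, sub_mul, smul_mul_assoc, mul_smul_comm, mul_assoc]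
  module

theorem pBracket_smul_left (p c : K) (x y : A) :
    pBracket p (c • x) y = c • pBracket p x y := by
  simp only [pBracket, smul_mul_assoc, mul_smul_comm]; module

theorem pBracket_smul_right (p c : K) (x y : A) :
    pBracket p x (c • y) = c • pBracket p x y := by
  simp only [pBracket, smul_mul_assoc, mul_smul_comm]; module

theorem pBracket_mul_left (p : K) {u : A} (hu : ∀ a, Commute u a) (x y : A) :
    pBracket p (u * x) y = u * pBracket p x y := by
  simp only [pBracket, mul_sub, mul_smul_comm, mul_assoc, (hu y).symm.left_comm]

theorem pBracket_mul_right (p : K) {u : A} (hu : ∀ a, Commute u a) (x y : A) :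
    pBracket p x (u * y) = u * pBracket p x y := by
  simp only [pBracket, mul_sub, mul_smul_comm, mul_assoc, (hu x).symm.left_comm]

theorem antidiagonal_fst_le {n : ℕ} {y : ℕ × ℕ} (hy : y ∈ Finset.HasAntidiagonal.antidiagonal n) :
    y.1 ≤ n := by
  have := Finset.HasAntidiagonal.mem_antidiagonal.1 hy; omega

theorem antidiagonal_snd_le {n : ℕ} {y : ℕ × ℕ} (hy : y ∈ Finset.HasAntidiagonal.antidiagonal n) :
    y.2 ≤ n := by
  have := Finset.HasAntidiagonal.mem_antidiagonal.1 hy; omega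

/-- The coefficients of the logarithmic derivative `(Dψ) ψ⁻¹`, `D = t d/dt`, of
`ψ = 1 + ∑ ψₙ tⁿ`. -/
def newton (ψ : ℕ → A) : ℕ → A
  | n => n • ψ n - ∑ j : Fin n, newton ψ j * ψ (n - j)
decreasing_by exact j.2

theorem newton_zero (ψ : ℕ → A) : newton ψ 0 = 0 := by
  rw [newton]; simp

theorem sum_newton_mul {ψ : ℕ → A} (h0 : ψ 0 = 1) (n : ℕ) :
    ∑ x ∈ Finset.HasAntidiagonal.antidiagonal n, newton ψ x.1 * ψ x.2 = n • ψ n := by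
  rw [Finset.Nat.sum_antidiagonal_eq_sum_range_succ (fun i j => newton ψ i * ψ j),
    Finset.sum_range_succ, Finset.sum_range]
  rw [Nat.sub_self, h0, mul_one]
  conv_lhs => rw [newton]
  abel

/-- The exchange relation of `ψ_{r+1}` and `x_i`. -/
def ExchangeRel (c : K) (ψ : ℕ → A) (x : ℤ → A) (i : ℤ) (r : ℕ) : Prop :=
  ⁅ψ (r + 1), x i⁆ = c⁻¹ • (ψ r * x (i + 1)) - c • (x (i + 1) * ψ r)

/-- In generating-function form the exchange relation is `ψ (1 - c⁻¹tS) x = ((1 - ctS) x) ψ`, with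
`S` the index shift. Expanding `1/(1 - c⁻¹tS)` as a geometric series moves every `ψ` to the right of
the current. -/
theorem sum_exchange {c : K} (hc : c ≠ 0) {ψ : ℕ → A} {x : ℤ → A} (h0 : ψ 0 = 1) (k : ℕ) :
    ∀ (_ : ∀ i, ∀ r < k, ExchangeRel c ψ x i r) (i : ℤ),
    (c - c⁻¹) • ∑ y ∈ Finset.HasAntidiagonal.antidiagonal k, c⁻¹ ^ y.1 • (x (i + y.1) * ψ y.2) =
      c • (x i * ψ k) - c⁻¹ • (ψ k * x i) := by
  induction k with
  | zero => intro h i; simp [h0, sub_smul]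
  | succ k ih =>
    intro h i
    have h1 := ih (fun i r hr => h i r (by omega)) (i + 1)
    have h2 := h i k (by omega)
    rw [Finset.Nat.sum_antidiagonal_succ]
    have h3 : ∑ y ∈ Finset.HasAntidiagonal.antidiagonal k, c⁻¹ ^ (y.1 + 1) • (x (i + (y.1 + 1 : ℕ)) * ψ y.2) =
        c⁻¹ • ∑ y ∈ Finset.HasAntidiagonal.antidiagonal k, c⁻¹ ^ y.1 • (x (i + 1 + y.1) * ψ y.2) := by
      rw [Finset.smul_sum]
      refine Finset.sum_congr rfl fun y _ => ?_
      rw [smul_smul, pow_succ', show i + ((y.1 + 1 : ℕ) : ℤ) = i + 1 + y.1 by push_cast; ring]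
    rw [h3, smul_add, smul_comm _ c⁻¹, h1]
    simp only [ExchangeRel, Ring.lie_def] at h2
    simp only [pow_zero, Nat.cast_zero, add_zero, one_smul]
    have h4 : c⁻¹ • (ψ (k + 1) * x i) - c⁻¹ • (x i * ψ (k + 1)) =
        c⁻¹ • (c⁻¹ • (ψ k * x (i + 1)) - c • (x (i + 1) * ψ k)) := by rw [← h2, smul_sub]
    rw [smul_sub, smul_smul, smul_smul, inv_mul_cancel₀ hc] at h4
    rw [smul_sub, smul_smul, smul_smul, inv_mul_cancel₀ hc]
    linear_combination (norm := module) h4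

/-- Conjugation by `ψ(t)` acts on the current as `(1 - ctS)/(1 - c⁻¹tS)`, and the right side is the
`t^m` coefficient of the logarithmic derivative of this factor. The relations of `ψ_1, …, ψ_{m-1}`
are needed at every index, but that of `ψ_m` only at the index `i` itself; the level induction
depends on this economy. -/
theorem newton_lie {c : K} (hc : c ≠ 0) {ψ : ℕ → A} {x : ℤ → A} (h0 : ψ 0 = 1) (m : ℕ) :
    ∀ (_ : ∀ i, ∀ r, r + 1 < m → ExchangeRel c ψ x i r) (i : ℤ)
      (_ : ∀ r, r + 1 = m → ExchangeRel c ψ x i r),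
    ⁅newton ψ m, x i⁆ = -(c ^ m - c⁻¹ ^ m) • x (i + m) := by
  induction m using Nat.strong_induction_on with
  | _ m ih =>
  intro h i hi
  rcases m with _ | k
  · simp [newton_zero, Ring.lie_def]
  have hW : ∀ r ≤ k, ExchangeRel c ψ x i r := fun r hr => by
    rcases hr.lt_or_eq with hr | rfl
    · exact h i r (by omega)
    · exact hi r rfl
  have ih' : ∀ j ≤ k, ∀ i, ⁅newton ψ j, x i⁆ = -(c ^ j - c⁻¹ ^ j) • x (i + j) := fun j hj i =>
    ih j (by omega) (fun i r hr => h i r (by omega)) i fun r hr => h i r (by omega)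
  -- commutator of the Newton identity with `x i`
  have e1 : ∑ y ∈ Finset.HasAntidiagonal.antidiagonal (k + 1),
      (⁅newton ψ y.1, x i⁆ * ψ y.2 + newton ψ y.1 * ⁅ψ y.2, x i⁆) = (k + 1) • ⁅ψ (k + 1), x i⁆ := by
    have := congrArg (fun a => ⁅a, x i⁆) (sum_newton_mul h0 (k + 1))
    simp only [Ring.lie_def, Finset.sum_mul, Finset.mul_sum] at this ⊢
    rw [← Finset.sum_sub_distrib] at this
    rw [smul_mul_assoc, mul_smul_comm, ← smul_sub] at this
    rw [← this]
    refine Finset.sum_congr rfl fun y _ => ?_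
    noncomm_ring
  rw [Finset.sum_add_distrib] at e1
  -- Each `⁅ψ, x i⁆` is replaced by its exchange relation, and the Newton identity in degree `k`
  -- resums the result; the last sum is the cost of moving the Newton coefficients past `x (i + 1)`.
  have e2 : ∑ y ∈ Finset.HasAntidiagonal.antidiagonal (k + 1), newton ψ y.1 * ⁅ψ y.2, x i⁆ =
      c⁻¹ • ((k • ψ k) * x (i + 1)) - c • (x (i + 1) * (k • ψ k)) -
        c • ∑ y ∈ Finset.HasAntidiagonal.antidiagonal k, ⁅newton ψ y.1, x (i + 1)⁆ * ψ y.2 := by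
    rw [Finset.Nat.sum_antidiagonal_succ', h0, ← sum_newton_mul h0 k, Finset.sum_mul,
      Finset.mul_sum, Finset.smul_sum, Finset.smul_sum, Finset.smul_sum, ← Finset.sum_sub_distrib,
      ← Finset.sum_sub_distrib]
    simp only [Ring.lie_def, one_mul, mul_one, sub_self, mul_zero, zero_add]
    refine Finset.sum_congr rfl fun y hy => ?_
    have h2 := hW y.2 (antidiagonal_snd_le hy)
    simp only [ExchangeRel, Ring.lie_def] at h2
    rw [h2]
    simp only [mul_sub, sub_mul, mul_smul_comm, mul_assoc]
    module
  have e3 : ∑ y ∈ Finset.HasAntidiagonal.antidiagonal (k + 1), ⁅newton ψ y.1, x i⁆ * ψ y.2 =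
      ⁅newton ψ (k + 1), x i⁆ + (c ^ (k + 1) - c⁻¹ ^ (k + 1)) • x (i + (k + 1 : ℕ)) -
      ∑ y ∈ Finset.HasAntidiagonal.antidiagonal k,
        (c ^ (y.1 + 1) - c⁻¹ ^ (y.1 + 1)) • (x (i + 1 + y.1) * ψ y.2) := by
    -- After the predicted value is added, the induction hypothesis kills every term except the one
    -- of top degree.
    have e4 : ∑ y ∈ Finset.HasAntidiagonal.antidiagonal (k + 1), (⁅newton ψ y.1, x i⁆ * ψ y.2 +
        (c ^ y.1 - c⁻¹ ^ y.1) • (x (i + y.1) * ψ y.2)) =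
        ⁅newton ψ (k + 1), x i⁆ + (c ^ (k + 1) - c⁻¹ ^ (k + 1)) • x (i + (k + 1 : ℕ)) := by
      rw [Finset.Nat.sum_antidiagonal_succ', h0, mul_one, mul_one, Finset.sum_eq_zero, add_zero]
      intro y hy
      rw [ih' y.1 (antidiagonal_fst_le hy)]
      simp only [neg_smul, smul_mul_assoc, neg_mul, neg_add_cancel]
    rw [Finset.sum_add_distrib, Finset.Nat.sum_antidiagonal_succ (f := fun y : ℕ × ℕ =>
      (c ^ y.1 - c⁻¹ ^ y.1) • (x (i + y.1) * ψ y.2))] at e4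
    rw [← e4]
    simp only [pow_zero, sub_self, zero_smul, zero_add, Nat.cast_add, Nat.cast_one, add_assoc,
      add_comm (1 : ℤ)]
    abel
  have e5 : ∑ y ∈ Finset.HasAntidiagonal.antidiagonal k, ⁅newton ψ y.1, x (i + 1)⁆ * ψ y.2 =
      - ∑ y ∈ Finset.HasAntidiagonal.antidiagonal k, (c ^ y.1 - c⁻¹ ^ y.1) • (x (i + 1 + y.1) * ψ y.2) := by
    rw [← Finset.sum_neg_distrib]
    refine Finset.sum_congr rfl fun y hy => ?_
    rw [ih' y.1 (antidiagonal_fst_le hy), neg_smul, neg_mul, smul_mul_assoc]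
  -- The coefficients combine to `(c^{a+1} - c^{-a-1}) - c (c^a - c^{-a}) = c^{-a}(c - c⁻¹)`, which
  -- is the weight in `sum_exchange`.
  have e6 : ∑ y ∈ Finset.HasAntidiagonal.antidiagonal k,
        (c ^ (y.1 + 1) - c⁻¹ ^ (y.1 + 1)) • (x (i + 1 + y.1) * ψ y.2) -
      c • ∑ y ∈ Finset.HasAntidiagonal.antidiagonal k, (c ^ y.1 - c⁻¹ ^ y.1) • (x (i + 1 + y.1) * ψ y.2) =
      c • (x (i + 1) * ψ k) - c⁻¹ • (ψ k * x (i + 1)) := by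
    rw [← sum_exchange hc h0 k (fun i r hr => h i r (by omega)) (i + 1), Finset.smul_sum,
      Finset.smul_sum, ← Finset.sum_sub_distrib]
    refine Finset.sum_congr rfl fun y _ => ?_
    rw [smul_smul, smul_smul, ← sub_smul]
    congr 1
    rw [pow_succ, pow_succ]
    ring
  have e7 := hW k le_rfl
  rw [ExchangeRel] at e7
  rw [e2, e3, e5, e7] at e1
  simp only [smul_mul_assoc, mul_smul_comm] at e1
  push_cast at e1 ⊢
  linear_combination (norm := module) e1 + e6

end Currents
-- Abstract loop currents: brackets depend only on the level, and their consequences.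
section LoopCurrents

variable {K A : Type*} [Field K] [Ring A] [Algebra K A]

/-- Elements `x_n`, `y_n` (`n ∈ ℤ`), a central unit `z`, and elements `w`, `χ`, such that the adjoint
actions of `[x_0, y_1]_p` and of `χ` shift the indices up and down. -/
structure LoopCurrents (p : K) (x y : ℤ → A) (χ w : A) (z : Aˣ) : Prop where
  ne_zero : p ≠ 0
  pow_ne_one : ∀ n : ℕ, 0 < n → p ^ n ≠ 1
  z_central : ∀ a, Commute (z : A) a
  x_serre : x 0 * x 1 = p • (x 1 * x 0)
  y_serre : y 2 * y 1 = p • (y 1 * y 2)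
  bracket_zero : pBracket p (x 0) (y 0) = 1 - w
  bracket_neg_one : pBracket p (x (-1)) (y 1) = 1 - (z ^ (-2 : ℤ) : Aˣ) * w
  w_comm : Commute w (pBracket p (x 0) (y 1))
  x_up : ∀ n, ⁅x n, pBracket p (x 0) (y 1)⁆ = (p - p⁻¹) • x (n + 1)
  y_up : ∀ n, ⁅y n, pBracket p (x 0) (y 1)⁆ = -(p - p⁻¹) • y (n + 1)
  x_down : ∀ n, ⁅x n, χ⁆ = (p - p⁻¹) • (z * x (n - 1))
  y_down : ∀ n, ⁅y n, χ⁆ = -(p - p⁻¹) • ((z⁻¹ : Aˣ) * y (n - 1))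

/-- The coefficients of the series `ψ = 1 + ∑ [x_0, y_n]_p tⁿ`. -/
def psi (p : K) (x y : ℤ → A) (n : ℕ) : A := if n = 0 then 1 else pBracket p (x 0) (y n)

theorem psi_zero (p : K) (x y : ℤ → A) : psi p x y 0 = 1 := by simp [psi]

theorem psi_one (p : K) (x y : ℤ → A) : psi p x y 1 = pBracket p (x 0) (y 1) := by simp [psi]

namespace LoopCurrents

variable {p : K} {x y : ℤ → A} {χ w : A} {z : Aˣ}

theorem pi_ne (H : LoopCurrents p x y χ w z) : p - p⁻¹ ≠ 0 := by
  intro h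
  refine H.pow_ne_one 2 (by norm_num) ?_
  have := H.ne_zero
  field_simp at h
  linear_combination h

theorem smul_cancel (H : LoopCurrents p x y χ w z) {a b : A}
    (h : (p - p⁻¹) • a = (p - p⁻¹) • b) : a = b :=
  smul_right_injective A H.pi_ne h

theorem zpow_central (H : LoopCurrents p x y χ w z) (n : ℤ) (a : A) :
    Commute ((z ^ n : Aˣ) : A) a := by
  have : ∀ u : Aˣ, (∀ a, Commute (u : A) a) → ∀ n : ℕ, ∀ a, Commute ((u ^ n : Aˣ) : A) a := by
    intro u hu n a
    rw [Units.val_pow_eq_pow_val]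
    exact (hu a).pow_left n
  rcases n with n | n
  · simpa using this z H.z_central n a
  · rw [zpow_negSucc, ← inv_pow]
    exact this z⁻¹ (fun a => (H.z_central a).units_inv_left) _ a

theorem inv_central (H : LoopCurrents p x y χ w z) (a : A) : Commute ((z⁻¹ : Aˣ) : A) a :=
  (H.z_central a).units_inv_left

theorem bracket_up (H : LoopCurrents p x y χ w z) (i j : ℤ) :
    ⁅pBracket p (x i) (y j), psi p x y 1⁆ =
      (p - p⁻¹) • (pBracket p (x (i + 1)) (y j) - pBracket p (x i) (y (j + 1))) := by
  rw [psi_one, pBracket_lie, H.x_up, H.y_up, pBracket_smul_left, pBracket_smul_right]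
  module

theorem bracket_down (H : LoopCurrents p x y χ w z) (i j : ℤ) :
    ⁅pBracket p (x i) (y j), χ⁆ =
      (p - p⁻¹) • (z * pBracket p (x (i - 1)) (y j) - (z⁻¹ : Aˣ) * pBracket p (x i) (y (j - 1))) := by
  rw [pBracket_lie, H.x_down, H.y_down, pBracket_smul_left, pBracket_smul_right,
    pBracket_mul_left p H.z_central, pBracket_mul_right p H.inv_central]
  module

/-- Lowering `[x_0, y_1]_p` produces the two given brackets of level zero; the terms in `w` cancel
because `z · z⁻² = z⁻¹`. -/
theorem psi_one_lie (H : LoopCurrents p x y χ w z) :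
    ⁅psi p x y 1, χ⁆ = (p - p⁻¹) • ((z : A) - (z⁻¹ : Aˣ)) := by
  rw [psi_one, H.bracket_down, zero_sub, sub_self, H.bracket_neg_one, H.bracket_zero]
  congr 1
  rw [mul_sub, mul_sub, ← mul_assoc, ← Units.val_mul, ← zpow_one_add]
  norm_num

/-- Two steps between the levels `0` and `1`. A level-zero bracket of the expected form commutes
with `ψ_1`, so raising it equates two neighbouring brackets of level one. Lowering a level-one
bracket equal to `ψ_1` gives the known `⁅ψ_1, χ⁆`, which links two neighbouring brackets of level
zero. -/
theorem bracket_neg_aux (H : LoopCurrents p x y χ w z) (i : ℤ) :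
    (pBracket p (x i) (y (-i)) = 1 - (z ^ (2 * i) : Aˣ) * w →
      pBracket p (x (i + 1)) (y (-i)) = pBracket p (x i) (y (1 - i))) ∧
    (pBracket p (x i) (y (1 - i)) = psi p x y 1 →
      (z : A) * pBracket p (x (i - 1)) (y (1 - i)) - (z⁻¹ : Aˣ) * pBracket p (x i) (y (-i)) =
        z - (z⁻¹ : Aˣ)) := by
  constructor
  · intro h
    have h1 := H.bracket_up i (-i)
    have h2 : ⁅pBracket p (x i) (y (-i)), psi p x y 1⁆ = 0 := by
      rw [h]
      apply lie_eq_zero_of_commute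
      refine (Commute.one_left _).sub_left (Commute.mul_left (H.zpow_central _ _) ?_)
      rw [psi_one]; exact H.w_comm
    rw [h2, ← smul_zero (p - p⁻¹)] at h1
    have h3 := H.smul_cancel h1
    rw [neg_add_eq_sub] at h3
    exact (sub_eq_zero.1 h3.symm)
  · intro h
    have h1 := H.bracket_down i (1 - i)
    rw [h, H.psi_one_lie] at h1
    rw [H.smul_cancel h1]
    congr 5
    ring

/-- The two implications of `bracket_neg_aux` are alternated, upwards and downwards in `i`, starting
from `i = 0`. Level zero is the only one of these two where the bracket really varies with `i`,
through a power of `z`. -/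
theorem bracket_levels (H : LoopCurrents p x y χ w z) (i : ℤ) :
    pBracket p (x i) (y (-i)) = 1 - (z ^ (2 * i) : Aˣ) * w ∧
      pBracket p (x i) (y (1 - i)) = psi p x y 1 := by
  induction i using Int.induction_on with
  | zero => simp [H.bracket_zero, psi_one]
  | succ i ih =>
    have h1 : pBracket p (x (i + 1)) (y (1 - (i + 1))) = psi p x y 1 := by
      rw [← ih.2, ← (H.bracket_neg_aux i).1 ih.1]; congr 2; ring
    refine ⟨?_, h1⟩
    have h2 := (H.bracket_neg_aux (i + 1)).2 h1
    rw [add_sub_cancel_right, show (1 : ℤ) - (i + 1) = -i by ring, ih.1, mul_sub, mul_one,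
      sub_sub, sub_right_inj] at h2
    have h3 := congrArg (fun a => (z : A) * a) h2
    simp only [mul_add, Units.mul_inv, Units.mul_inv_cancel_left] at h3
    rw [← mul_assoc, ← mul_assoc, ← Units.val_mul, ← Units.val_mul,
      show z * z * z ^ (2 * (i : ℤ)) = z ^ (2 * ((i : ℤ) + 1)) by group] at h3
    rw [← h3]
    abel
  | pred i ih =>
    have h2 := (H.bracket_neg_aux (-i)).2 ih.2
    have h1 : pBracket p (x (-i - 1)) (y (-(-i - 1))) = 1 - (z ^ (2 * (-i - 1) : ℤ) : Aˣ) * w := by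
      rw [ih.1, mul_sub, mul_one, sub_sub_eq_add_sub, sub_left_inj] at h2
      have h3 := congrArg (fun a => ((z⁻¹ : Aˣ) : A) * a) h2
      simp only [mul_add, Units.inv_mul, Units.inv_mul_cancel_left] at h3
      rw [← mul_assoc, ← mul_assoc, ← Units.val_mul, ← Units.val_mul,
        show z⁻¹ * z⁻¹ * z ^ (2 * -(i : ℤ)) = z ^ (2 * (-(i : ℤ) - 1)) by group] at h3
      rw [← h3, show -((-i : ℤ) - 1) = 1 - -i by ring]
      abel
    refine ⟨h1, ?_⟩
    have h4 := (H.bracket_neg_aux (-i - 1)).1 h1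
    rw [← h4, sub_add_cancel, show -((-i : ℤ) - 1) = 1 - -i by ring, ih.2]

/-- `[x_i, y_j]_p = ψ_{i+j}` for `1 ≤ i + j ≤ n`, and the exchange relations of `ψ_1, …, ψ_{n-1}`. -/
def Level (p : K) (x y : ℤ → A) (n : ℕ) : Prop :=
  (∀ (i j : ℤ) (r : ℕ), 1 ≤ r → r ≤ n → i + j = r → pBracket p (x i) (y j) = psi p x y r) ∧
    ∀ (i : ℤ) (r : ℕ), r + 1 < n →
      ExchangeRel p (psi p x y) x i r ∧ ExchangeRel p⁻¹ (psi p x y) y i r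

theorem exchange_x_zero (H : LoopCurrents p x y χ w z) (i : ℤ) :
    ExchangeRel p (psi p x y) x i 0 := by
  rw [ExchangeRel, zero_add, commutator_skew, psi_one, H.x_up, psi_zero, one_mul, mul_one]
  module

theorem exchange_y_zero (H : LoopCurrents p x y χ w z) (i : ℤ) :
    ExchangeRel p⁻¹ (psi p x y) y i 0 := by
  rw [ExchangeRel, zero_add, commutator_skew, psi_one, H.y_up, psi_zero, one_mul, mul_one, inv_inv]
  module

/-- Write `ψ_r = [x_0, y_r]_p` and `ψ_{r+1} = [x_1, y_r]_p`. The relation at index `0` then involves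
only `x_0`, `x_1`, `y_r` and reduces to the Serre relation. The case `r = 0` is separate since `ψ_0
= 1` is not a bracket. -/
theorem exchange_x_of_level (H : LoopCurrents p x y χ w z) {n : ℕ} (hL : Level p x y n) {r : ℕ}
    (hr : r + 1 = n) : ExchangeRel p (psi p x y) x 0 r := by
  rcases Nat.eq_zero_or_pos r with rfl | h
  · exact H.exchange_x_zero 0
  have h1 := hL.1 0 r r h (by omega) (by simp)
  have h2 := hL.1 1 r (r + 1) (by omega) (by omega) (by push_cast; ring)
  have h3 := H.x_serre
  have hp := H.ne_zero
  rw [ExchangeRel, ← h1, ← h2]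
  simp only [pBracket, Ring.lie_def, zero_add]
  linear_combination (norm := skip) (p⁻¹ * p⁻¹) • (y r * h3) - h3 * y r
  simp only [mul_sub, sub_mul, smul_mul_assoc, mul_smul_comm, mul_assoc]
  match_scalars <;> field_simp <;> ring

/-- The mirror argument with `ψ_r = [x_{r-1}, y_1]_p` and `ψ_{r+1} = [x_{r-1}, y_2]_p`. The base
index is `1`, because the Serre relation for `y` concerns `y_1` and `y_2`. -/
theorem exchange_y_of_level (H : LoopCurrents p x y χ w z) {n : ℕ} (hL : Level p x y n) {r : ℕ}
    (hr : r + 1 = n) : ExchangeRel p⁻¹ (psi p x y) y 1 r := by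
  rcases Nat.eq_zero_or_pos r with rfl | h
  · exact H.exchange_y_zero 1
  have h1 := hL.1 (r - 1) 1 r h (by omega) (by simp)
  have h2 := hL.1 (r - 1) 2 (r + 1) (by omega) (by omega) (by push_cast; ring)
  have h3 := H.y_serre
  have hp := H.ne_zero
  rw [ExchangeRel, ← h1, ← h2]
  simp only [pBracket, Ring.lie_def, one_add_one_eq_two, inv_inv]
  linear_combination (norm := skip) x (r - 1) * h3 - (p⁻¹ * p⁻¹) • (h3 * x (r - 1))
  simp only [mul_sub, sub_mul, smul_mul_assoc, mul_smul_comm, mul_assoc]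
  match_scalars <;> field_simp <;> ring

/-- Raising `ψ_r = [x_0, y_r]_p` gives a difference of two brackets of level `r + 1 ≤ n`, which
agree. -/
theorem psi_comm_one_of_level (H : LoopCurrents p x y χ w z) {n : ℕ} (hL : Level p x y n) {r : ℕ}
    (hr : r < n) : Commute (psi p x y r) (psi p x y 1) := by
  rcases Nat.eq_zero_or_pos r with rfl | h
  · rw [psi_zero]; exact Commute.one_left _
  have h1 := H.bracket_up 0 r
  rw [hL.1 0 r r h hr.le (by simp), hL.1 _ r (r + 1) (by omega) (by omega) (by push_cast; ring),
    hL.1 _ (r + 1) (r + 1) (by omega) (by omega) (by push_cast; ring), sub_self, smul_zero,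
    Ring.lie_def, sub_eq_zero] at h1
  exact h1

theorem psi_down_of_level (H : LoopCurrents p x y χ w z) {n : ℕ} (hL : Level p x y n) {r : ℕ}
    (hr : r < n) : ⁅psi p x y (r + 1), χ⁆ = (p - p⁻¹) • (((z : A) - (z⁻¹ : Aˣ)) * psi p x y r) := by
  rcases Nat.eq_zero_or_pos r with rfl | h
  · rw [psi_zero, mul_one]; exact H.psi_one_lie
  have h1 := H.bracket_down 0 (r + 1)
  rw [hL.1 0 _ (r + 1) (by omega) (by omega) (by push_cast; ring),
    hL.1 _ (r + 1) r h (by omega) (by push_cast; ring),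
    hL.1 _ (r + 1 - 1) r h (by omega) (by ring), ← sub_mul] at h1
  exact h1

end LoopCurrents

theorem newton_commute {ψ : ℕ → A} {a : A} {m : ℕ} (h : ∀ r ≤ m, Commute (ψ r) a) :
    Commute (newton ψ m) a := by
  induction m using Nat.strong_induction_on with
  | _ m ih =>
  rw [newton]
  refine ((h m le_rfl).smul_left m).sub_left (Commute.sum_left _ _ _ fun j _ => ?_)
  exact (ih j j.2 fun r hr => h r (by omega)).mul_left (h _ (by omega))

/-- Commuting the relation with `d` moves only the current, because `d` commutes with both `ψ`'s
that occur. -/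
theorem ExchangeRel.up {c k : K} (hk : k ≠ 0) {ψ : ℕ → A} {x : ℤ → A} {d : A} {i : ℤ} {r : ℕ}
    (h : ExchangeRel c ψ x i r) (hx : ∀ n, ⁅x n, d⁆ = k • x (n + 1))
    (h0 : Commute (ψ r) d) (h1 : Commute (ψ (r + 1)) d) : ExchangeRel c ψ x (i + 1) r := by
  unfold ExchangeRel at h ⊢
  have e := congrArg (fun a => ⁅a, d⁆) h
  simp only [commutator_jacobi, hx, sub_commutator, smul_commutator, mul_lie_eq,
    lie_eq_zero_of_commute h0, lie_eq_zero_of_commute h1, zero_mul, zero_add, mul_zero,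
    add_zero, commutator_smul, mul_smul_comm, smul_mul_assoc] at e
  rw [Ring.lie_def 0, zero_mul, mul_zero, sub_zero, zero_add] at e
  apply smul_right_injective A hk
  dsimp only
  rw [e]
  module

/-- Here `d` also lowers the `ψ`'s. The extra terms assemble into `ζ` times the relation one degree
lower at the same `i`, so they drop out, and what remains is the relation at `i - 1`. -/
theorem ExchangeRel.down {c k : K} (hk : k ≠ 0) {ψ : ℕ → A} {x : ℤ → A} {d ζ : A} {v : Aˣ}
    {i : ℤ} {r : ℕ} (hv : ∀ a, Commute (v : A) a) (hζ : ∀ a, Commute ζ a)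
    (h : ExchangeRel c ψ x i (r + 1)) (h' : ExchangeRel c ψ x i r)
    (hx : ∀ n, ⁅x n, d⁆ = k • (v * x (n - 1)))
    (h0 : ⁅ψ (r + 1), d⁆ = ζ * ψ r) (h1 : ⁅ψ (r + 1 + 1), d⁆ = ζ * ψ (r + 1)) :
    ExchangeRel c ψ x (i - 1) (r + 1) := by
  unfold ExchangeRel at h h' ⊢
  have e := congrArg (fun a => ⁅a, d⁆) h
  have e' := congrArg (fun a => ζ * a) h'
  have e2 : ⁅⁅ψ (r + 1 + 1), x i⁆, d⁆ = ζ * ⁅ψ (r + 1), x i⁆ +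
      k • (v * ⁅ψ (r + 1 + 1), x (i - 1)⁆) := by
    rw [commutator_jacobi, hx, h1, commutator_smul, lie_mul_eq, mul_lie_eq,
      lie_eq_zero_of_commute (hζ _), lie_eq_zero_of_commute (hv _).symm, zero_mul, zero_mul,
      zero_add, zero_add]
  simp only [sub_commutator, smul_commutator, mul_lie_eq, h0, hx, e2, add_sub_cancel_right] at e
  have e3 : k • (v * ⁅ψ (r + 1 + 1), x (i - 1)⁆) =
      k • (v * (c⁻¹ • (ψ (r + 1) * x (i - 1 + 1)) - c • (x (i - 1 + 1) * ψ (r + 1)))) := by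
    simp only [mul_sub, mul_smul_comm, sub_add_cancel] at e e' ⊢
    have c1 : ψ (r + 1) * (v * x i) = v * (ψ (r + 1) * x i) := (hv _).symm.left_comm _
    have c2 : x (i + 1) * (ζ * ψ r) = ζ * (x (i + 1) * ψ r) := (hζ _).symm.left_comm _
    simp only [smul_mul_assoc, mul_assoc, c1, c2] at e
    rw [e'] at e
    linear_combination (norm := module) e
  exact (Units.mul_right_inj v).1 (smul_right_injective A hk e3)

namespace LoopCurrents

variable {p : K} {x y : ℤ → A} {χ w : A} {z : Aˣ}

theorem pow_add_ne (H : LoopCurrents p x y χ w z) {n : ℕ} (hn : 2 ≤ n) :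
    p - p⁻¹ + (p ^ n - p⁻¹ ^ n) ≠ 0 := by
  intro h
  have hp := H.ne_zero
  -- Multiplication by `p^n` factors `p - p⁻¹ + p^n - p^{-n}` as `(p^{n-1} + 1)(p^{n+1} - 1)`. A
  -- zero of either factor makes `p` a root of unity; `2 ≤ n` keeps the exponent `2(n - 1)`
  -- positive.
  have h1 : p * (p ^ (n - 1) + 1) * (p ^ (n + 1) - 1) = 0 := by
    obtain ⟨k, rfl⟩ : ∃ k, n = k + 2 := ⟨n - 2, by omega⟩
    rw [inv_pow] at h
    field_simp at h
    rw [show k + 2 - 1 = k + 1 by omega]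
    linear_combination h
  rcases mul_eq_zero.1 h1 with h1 | h1
  · rcases mul_eq_zero.1 h1 with h1 | h1
    · exact hp h1
    · refine H.pow_ne_one (2 * (n - 1)) (by omega) ?_
      rw [two_mul, pow_add, eq_neg_of_add_eq_zero_left h1]
      ring
  · exact H.pow_ne_one (n + 1) (by omega) (sub_eq_zero.1 h1)

theorem z_sub_central (H : LoopCurrents p x y χ w z) (a : A) :
    Commute ((p - p⁻¹) • ((z : A) - (z⁻¹ : Aˣ))) a :=
  ((H.z_central a).sub_left (H.inv_central a)).smul_left _

/-- One valid index spreads to all of them: upwards by commuting with `ψ_1`, downwards by commuting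
with `χ`. Stated for a general current `u` so that it serves `x` and `y` alike. -/
theorem exchange_all (H : LoopCurrents p x y χ w z) {c k : K} {u : ℤ → A} {v : Aˣ} {r : ℕ}
    (hk : k ≠ 0) (hv : ∀ a, Commute (v : A) a)
    (hup : ∀ n, ⁅u n, psi p x y 1⁆ = k • u (n + 1))
    (hdown : ∀ n, ⁅u n, χ⁆ = k • (v * u (n - 1)))
    (h0 : ∀ l ≤ r + 1, Commute (psi p x y l) (psi p x y 1))
    (h1 : ∀ l ≤ r, ⁅psi p x y (l + 1), χ⁆ = (p - p⁻¹) • (((z : A) - (z⁻¹ : Aˣ)) * psi p x y l))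
    (hbase : ∀ i, ExchangeRel c (psi p x y) u i 0)
    (hlow : ∀ l < r, ∀ i, ExchangeRel c (psi p x y) u i l) {i₀ : ℤ}
    (h : ExchangeRel c (psi p x y) u i₀ r) (i : ℤ) : ExchangeRel c (psi p x y) u i r := by
  induction i using Int.inductionOn' with
  | b => exact i₀
  | zero => exact h
  | succ i _ ih => exact ih.up hk hup (h0 _ (by omega)) (h0 _ le_rfl)
  | pred i _ ih =>
    rcases r with _ | r
    · exact hbase _
    · refine ih.down hk hv H.z_sub_central (hlow r (by omega) i) hdown ?_ ?_
      · rw [h1 r (by omega), smul_mul_assoc]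
      · rw [h1 _ le_rfl, smul_mul_assoc]

/-- Raising the constant level-`n` bracket `ψ_n` shows that consecutive brackets of level `n + 1`
differ by a fixed amount, so they form an arithmetic progression in `i`. The next level is constant
exactly when its step `⁅ψ_n, ψ_1⁆` vanishes. -/
theorem level_bracket (H : LoopCurrents p x y χ w z) {n : ℕ} (hn : 1 ≤ n) (hL : Level p x y n)
    (i : ℤ) : (p - p⁻¹) • pBracket p (x i) (y (n + 1 - i)) =
      (p - p⁻¹) • psi p x y (n + 1) + i • ⁅psi p x y n, psi p x y 1⁆ := by
  have key : ∀ i : ℤ, (p - p⁻¹) • pBracket p (x (i + 1)) (y (n + 1 - (i + 1))) =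
      (p - p⁻¹) • pBracket p (x i) (y (n + 1 - i)) + ⁅psi p x y n, psi p x y 1⁆ := by
    intro i
    have h := H.bracket_up i (n - i)
    rw [hL.1 i (n - i) n hn le_rfl (by ring)] at h
    rw [h, show (n : ℤ) + 1 - (i + 1) = n - i by ring, show (n : ℤ) - i + 1 = n + 1 - i by ring]
    module
  induction i using Int.induction_on with
  | zero => simp [psi]
  | succ i ih => rw [key, ih, add_smul]; abel
  | pred i ih =>
    have h := key (-i - 1)
    rw [sub_add_cancel, ih] at h
    rw [← sub_eq_iff_eq_add] at h
    rw [← h]; module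

/-- Let `Δ` be the commutator and `N` the `n`-th Newton coefficient. Modulo products commuting with
`ψ_1`, `N` is `n ψ_n`, so `⁅N, ψ_1⁆ = nΔ`. On the other hand `N` shifts `x_0` and `y_1` by `n`, so
`⁅N, ψ_1⁆` is `p^n - p^{-n}` times the difference of two brackets of level `n + 1`, which the
arithmetic progression evaluates as another multiple of `Δ`. For generic `p` the two values agree
only if `Δ = 0`. -/
theorem level_comm [CharZero K] (H : LoopCurrents p x y χ w z) {n : ℕ} (hn : 1 ≤ n)
    (hL : Level p x y n) : ⁅psi p x y n, psi p x y 1⁆ = 0 := by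
  rcases hn.lt_or_eq with hn2 | rfl
  swap
  · rw [Ring.lie_def, sub_self]
  obtain ⟨k, rfl⟩ : ∃ k, n = k + 1 := ⟨n - 1, by omega⟩
  set Δ := ⁅psi p x y (k + 1), psi p x y 1⁆ with hΔ
  have hx := newton_lie H.ne_zero (psi_zero p x y) (k + 1) (fun i r hr => (hL.2 i r hr).1) 0
    fun r hr => H.exchange_x_of_level hL hr
  have hy := newton_lie (inv_ne_zero H.ne_zero) (psi_zero p x y) (k + 1)
    (fun i r hr => (hL.2 i r hr).2) 1 fun r hr => H.exchange_y_of_level hL hr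
  have h1 : ⁅newton (psi p x y) (k + 1), psi p x y 1⁆ = ((k + 1 : ℕ) : K) • Δ := by
    have h := congrArg (fun a => ⁅a, psi p x y 1⁆) (newton.eq_1 (psi p x y) (k + 1))
    rw [h, sub_commutator, lie_eq_zero_of_commute (a := ∑ _, _), sub_zero, ← Nat.cast_smul_eq_nsmul K,
      smul_commutator]
    refine Commute.sum_left _ _ _ fun j _ => ?_
    -- At `j = 0` the second factor is `ψ_n` itself, not yet known to commute with `ψ_1`; the term
    -- is harmless because its Newton coefficient is zero.
    rcases Nat.eq_zero_or_pos (j : ℕ) with h | h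
    · rw [h, newton_zero, zero_mul]; exact Commute.zero_left _
    · exact (newton_commute fun r hr => H.psi_comm_one_of_level hL (by omega)).mul_left
        (H.psi_comm_one_of_level hL (by omega))
  have h2 : ⁅newton (psi p x y) (k + 1), psi p x y 1⁆ =
      (p ^ (k + 1) - p⁻¹ ^ (k + 1)) • (pBracket p (x 0) (y (1 + (k + 1 : ℕ))) -
        pBracket p (x (0 + (k + 1 : ℕ))) (y 1)) := by
    rw [psi_one, lie_pBracket, hx, hy, pBracket_smul_left, pBracket_smul_right, inv_inv]
    module
  have h3 := H.level_bracket hn hL 0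
  have h4 := H.level_bracket hn hL (k + 1 : ℕ)
  rw [sub_zero, zero_smul, add_zero] at h3
  rw [add_sub_cancel_left, ← hΔ, ← h3] at h4
  -- The two evaluations of `⁅N, ψ_1⁆`, cleared of the denominator `p - p⁻¹`.
  have h5 : (((k + 1 : ℕ) : K) * (p - p⁻¹ + (p ^ (k + 1) - p⁻¹ ^ (k + 1)))) • Δ = 0 := by
    have h6 := congrArg (fun a => (p - p⁻¹) • a) (h1.symm.trans h2)
    rw [add_comm (1 : ℤ), zero_add] at h6
    rw [← Int.cast_smul_eq_zsmul K] at h4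
    push_cast at h4 h6 ⊢
    linear_combination (norm := module) h6 - (p ^ (k + 1) - p⁻¹ ^ (k + 1)) • h4
  refine (smul_eq_zero.1 h5).resolve_left (mul_ne_zero ?_ (H.pow_add_ne hn2))
  exact_mod_cast Nat.succ_ne_zero k

/-- Once `⁅ψ_n, ψ_1⁆ = 0`, the progression of level `n + 1` is constant. The exchange relations of
`ψ_n`, until then known only at index `0` for `x` and `1` for `y`, spread to all indices. -/
theorem level_all [CharZero K] (H : LoopCurrents p x y χ w z) (n : ℕ) (hn : 1 ≤ n) :
    Level p x y n := by
  induction n, hn using Nat.le_induction with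
  | base =>
    refine ⟨fun i j r h1 h2 hij => ?_, fun i r h => by omega⟩
    obtain rfl : r = 1 := by omega
    obtain rfl : j = 1 - i := by push_cast at hij; linarith
    exact (H.bracket_levels i).2
  | succ n hn hL =>
    have hΔ := H.level_comm hn hL
    have hcomm : ∀ l ≤ n, Commute (psi p x y l) (psi p x y 1) := fun l hl => by
      rcases hl.lt_or_eq with hl | rfl
      · exact H.psi_comm_one_of_level hL hl
      · exact commute_of_lie_eq_zero hΔ
    refine ⟨fun i j r h1 h2 hij => ?_, fun i r h => ?_⟩
    · rcases h2.lt_or_eq with h2 | rfl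
      · exact hL.1 i j r h1 (by omega) hij
      · obtain rfl : j = n + 1 - i := by rw [eq_sub_iff_add_eq', hij]; push_cast; ring
        refine H.smul_cancel ?_
        rw [H.level_bracket hn hL i, hΔ, smul_zero, add_zero]
    · rcases (Nat.lt_succ_iff.1 (show r + 1 < n + 1 from h)).lt_or_eq with h | h
      · exact hL.2 i r h
      · constructor
        · refine H.exchange_all H.pi_ne H.z_central (fun n => by rw [psi_one, H.x_up]) H.x_down
            (fun l hl => hcomm l (by omega)) (fun l hl => H.psi_down_of_level hL (by omega))
            H.exchange_x_zero (fun l hl i => (hL.2 i l (by omega)).1)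
            (H.exchange_x_of_level hL h) i
        · refine H.exchange_all (neg_ne_zero.2 H.pi_ne) H.inv_central
            (fun n => by rw [psi_one, H.y_up]) H.y_down
            (fun l hl => hcomm l (by omega)) (fun l hl => H.psi_down_of_level hL (by omega))
            H.exchange_y_zero (fun l hl i => (hL.2 i l (by omega)).2)
            (H.exchange_y_of_level hL h) i

variable [CharZero K] 

theorem bracket_eq_psi (H : LoopCurrents p x y χ w z) {i j : ℤ} {r : ℕ} (hr : 1 ≤ r)
    (h : i + j = r) : pBracket p (x i) (y j) = psi p x y r :=
  (H.level_all r hr).1 i j r hr le_rfl h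

theorem newton_lie_x (H : LoopCurrents p x y χ w z) (m : ℕ) (i : ℤ) :
    ⁅newton (psi p x y) m, x i⁆ = -(p ^ m - p⁻¹ ^ m) • x (i + m) :=
  newton_lie H.ne_zero (psi_zero p x y) m
    (fun i r _ => ((H.level_all (r + 2) (by omega)).2 i r (by omega)).1) i
    fun r _ => ((H.level_all (r + 2) (by omega)).2 i r (by omega)).1

theorem newton_lie_y (H : LoopCurrents p x y χ w z) (m : ℕ) (i : ℤ) :
    ⁅newton (psi p x y) m, y i⁆ = (p ^ m - p⁻¹ ^ m) • y (i + m) := by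
  rw [newton_lie (inv_ne_zero H.ne_zero) (psi_zero p x y) m
    (fun i r _ => ((H.level_all (r + 2) (by omega)).2 i r (by omega)).2) i
    fun r _ => ((H.level_all (r + 2) (by omega)).2 i r (by omega)).2, inv_inv]
  module

/-- The Newton coefficient shifts the two factors of `[x_0, y_n]_p` with opposite coefficients, and
both resulting brackets equal `ψ_{n+m}`. -/
theorem newton_comm_psi (H : LoopCurrents p x y χ w z) (m n : ℕ) :
    Commute (newton (psi p x y) m) (psi p x y n) := by
  rcases Nat.eq_zero_or_pos n with rfl | hn
  · rw [psi_zero]; exact Commute.one_right _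
  refine commute_of_lie_eq_zero ?_
  rw [← H.bracket_eq_psi hn (zero_add (n : ℤ)), lie_pBracket, H.newton_lie_x, H.newton_lie_y,
    pBracket_smul_left, pBracket_smul_right, H.bracket_eq_psi (r := n + m) (by omega) (by push_cast; ring),
    H.bracket_eq_psi (r := n + m) (by omega) (by push_cast; ring)]
  module

/-- By the Newton identity `m ψ_m` is a sum of products of Newton coefficients with earlier `ψ`'s;
characteristic zero permits division by `m`. -/
theorem psi_comm_psi (H : LoopCurrents p x y χ w z) (m n : ℕ) :
    Commute (psi p x y m) (psi p x y n) := by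
  have h : (m : K) • psi p x y m = ∑ x_1 ∈ Finset.HasAntidiagonal.antidiagonal m, _ :=
    (Nat.cast_smul_eq_nsmul K m _).trans (sum_newton_mul (psi_zero p x y) m).symm
  induction m using Nat.strong_induction_on with
  | _ m ih =>
  rcases Nat.eq_zero_or_pos m with rfl | hm
  · rw [psi_zero]; exact Commute.one_left _
  have h1 : Commute ((m : K) • psi p x y m) (psi p x y n) := by
    rw [h]
    refine Commute.sum_left _ _ _ fun a ha => ?_
    rcases Nat.eq_zero_or_pos a.1 with h | h0
    · rw [h, newton_zero, zero_mul]; exact Commute.zero_left _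
    · have := Finset.HasAntidiagonal.mem_antidiagonal.1 ha
      exact (H.newton_comm_psi _ _).mul_left (ih _ (by omega)
        ((Nat.cast_smul_eq_nsmul K _ _).trans (sum_newton_mul (psi_zero p x y) _).symm))
  have h2 := h1.smul_left (m : K)⁻¹
  rwa [inv_smul_smul₀ (by exact_mod_cast hm.ne')] at h2

/-- An element that lowers the indices by `m` pairs with the logarithm of `ψ` in degree `m` only. -/
theorem newton_lie_lowering (H : LoopCurrents p x y χ w z) {Φ : ℤ → A}
    (hneg : ∀ i j : ℤ, i + j < 0 → pBracket p (x i) (y j) = (z ^ (i - j) : Aˣ) * Φ (i + j))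
    {m : ℕ} (hm : 0 < m) {F : A} {c : K}
    (hx : ∀ i, ⁅x i, F⁆ = c • ((z ^ (m : ℤ) : Aˣ) * x (i - m)))
    (hy : ∀ j, ⁅y j, F⁆ = -c • ((z ^ (-m : ℤ) : Aˣ) * y (j - m))) (n : ℕ) :
    ⁅newton (psi p x y) n, F⁆ =
      if n = m then (m * c) • (((z ^ (m : ℤ) : Aˣ) : A) - (z ^ (-m : ℤ) : Aˣ)) else 0 := by
  set Z : A := c • (((z ^ (m : ℤ) : Aˣ) : A) - (z ^ (-m : ℤ) : Aˣ)) with hZ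
  have hZc : ∀ a, Commute Z a := fun a =>
    ((H.zpow_central _ a).sub_left (H.zpow_central _ a)).smul_left c
  -- In generating-function form the derivation `⁅·, F⁆` sends `ψ` to `Z t^m ψ` with `Z` central.
  -- Below degree `m` the two brackets of negative level cancel thanks to the factor `z^(i - j)` in
  -- `hneg`; in degree `m` the level-zero values leave `Z`, since their `w`-terms cancel.
  have hψ : ∀ l : ℕ, ⁅psi p x y l, F⁆ = if m ≤ l then Z * psi p x y (l - m) else 0 := by
    intro l
    rcases Nat.eq_zero_or_pos l with rfl | hl
    · rw [if_neg (by omega), psi_zero, Ring.lie_def, one_mul, mul_one, sub_self]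
    have h : ⁅psi p x y l, F⁆ = c • ((z ^ (m : ℤ) : Aˣ) * pBracket p (x (0 - m)) (y l) -
        (z ^ (-m : ℤ) : Aˣ) * pBracket p (x 0) (y (l - m))) := by
      rw [← H.bracket_eq_psi hl (zero_add (l : ℤ)), pBracket_lie, hx, hy, pBracket_smul_left,
        pBracket_smul_right, pBracket_mul_left p (H.zpow_central _),
        pBracket_mul_right p (H.zpow_central _)]
      module
    rw [h]
    rcases lt_trichotomy l m with hlm | rfl | hlm
    · rw [if_neg (by omega), hneg _ _ (by omega), hneg _ _ (by omega), ← mul_assoc, ← mul_assoc,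
        ← Units.val_mul, ← Units.val_mul, ← zpow_add, ← zpow_add,
        show (m : ℤ) + (0 - m - l) = -m + (0 - (l - m)) by ring,
        show (0 : ℤ) - m + l = 0 + (l - m) by ring, sub_self, smul_zero]
    · have h1 := (H.bracket_levels (0 - l)).1
      rw [show -((0 : ℤ) - l) = l by ring] at h1
      rw [if_pos le_rfl, Nat.sub_self, psi_zero, mul_one, sub_self, H.bracket_zero, h1, hZ,
        mul_sub (_ : A), mul_sub (_ : A), ← mul_assoc, ← Units.val_mul, ← zpow_add,
        show (l : ℤ) + 2 * (0 - l) = -l by ring]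
      congr 1
      noncomm_ring
    · rw [if_pos hlm.le, H.bracket_eq_psi (r := l - m) (by omega) (by omega),
        H.bracket_eq_psi (r := l - m) (by omega) (by omega), ← sub_mul, ← smul_mul_assoc]
  -- If the derivation sends `ψ` to `Z t^m ψ`, it sends the logarithmic derivative of `ψ` to `t d/dt
  -- (Z t^m) = m Z t^m`. The coefficientwise proof shows that the discrepancy, convolved with `ψ`,
  -- vanishes.
  have hmain : ⁅newton (psi p x y) n, F⁆ - (if n = m then (m : K) • Z else 0) = 0 := by
    induction n using Nat.strong_induction_on with
    | _ n ih =>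
    have h0 := psi_zero p x y
    have e1 : ∑ a ∈ Finset.HasAntidiagonal.antidiagonal n,
        (⁅newton (psi p x y) a.1, F⁆ - (if a.1 = m then (m : K) • Z else 0)) * psi p x y a.2 =
        ⁅newton (psi p x y) n, F⁆ - (if n = m then (m : K) • Z else 0) := by
      rw [Finset.sum_eq_single (n, 0), h0, mul_one]
      · intro a ha hne
        have h1 := Finset.HasAntidiagonal.mem_antidiagonal.1 ha
        have h2 : a.1 ≠ n := fun h => hne (Prod.ext h (by dsimp only; omega))
        rw [ih a.1 (by omega), zero_mul]
      · intro h; exact absurd (by simp) h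
    have e2 : ∑ a ∈ Finset.HasAntidiagonal.antidiagonal n,
        (⁅newton (psi p x y) a.1, F⁆ * psi p x y a.2 + newton (psi p x y) a.1 * ⁅psi p x y a.2, F⁆) =
        (n : K) • ⁅psi p x y n, F⁆ := by
      rw [← smul_commutator, Nat.cast_smul_eq_nsmul, ← sum_newton_mul h0 n]
      simp only [Ring.lie_def, Finset.sum_mul, Finset.mul_sum]
      rw [← Finset.sum_sub_distrib]
      refine Finset.sum_congr rfl fun a _ => ?_
      noncomm_ring
    have e3 : ∑ a ∈ Finset.HasAntidiagonal.antidiagonal n,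
        newton (psi p x y) a.1 * ⁅psi p x y a.2, F⁆ =
        if m ≤ n then ((n : K) - m) • (Z * psi p x y (n - m)) else 0 := by
      simp only [hψ, mul_ite, mul_zero]
      rw [← Finset.sum_filter]
      split_ifs with hmn
      · rw [Finset.Nat.antidiagonal_filter_le_snd_of_le hmn, Finset.sum_map, ← Nat.cast_sub hmn,
          ← mul_smul_comm, Nat.cast_smul_eq_nsmul, ← sum_newton_mul h0, Finset.mul_sum]
        refine Finset.sum_congr rfl fun a _ => ?_
        simp [← mul_assoc, (hZc _).eq]
      · refine Finset.sum_eq_zero fun a ha => ?_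
        have h1 := Finset.mem_filter.1 ha
        have h2 := Finset.HasAntidiagonal.mem_antidiagonal.1 h1.1
        omega
    have e4 : ∑ a ∈ Finset.HasAntidiagonal.antidiagonal n,
        (if a.1 = m then (m : K) • Z else 0) * psi p x y a.2 =
        if m ≤ n then (m : K) • (Z * psi p x y (n - m)) else 0 := by
      split_ifs with hmn
      · rw [Finset.sum_eq_single (m, n - m), if_pos rfl, smul_mul_assoc]
        · intro a ha hne
          have h1 := Finset.HasAntidiagonal.mem_antidiagonal.1 ha
          rw [if_neg fun h => hne (Prod.ext h (by dsimp only; omega)), zero_mul]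
        · intro h
          exact absurd (Finset.HasAntidiagonal.mem_antidiagonal.2 (by dsimp only; omega)) h
      · refine Finset.sum_eq_zero fun a ha => ?_
        have h2 := Finset.HasAntidiagonal.mem_antidiagonal.1 ha
        rw [if_neg (by omega), zero_mul]
    rw [← e1]
    simp only [sub_mul, Finset.sum_sub_distrib]
    rw [Finset.sum_add_distrib, e3, hψ] at e2
    rw [e4, eq_sub_of_add_eq e2]
    split_ifs <;> module
  rw [sub_eq_zero.1 hmain]
  split_ifs
  · rw [hZ, smul_smul]
  · rfl

end LoopCurrents
end LoopCurrents
-- Logarithm and exponential of power series with commuting coefficients.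
section LogExp

open PowerSeries

variable {K A : Type*} [Field K] [Ring A] [Algebra K A]

/-- The derivation `t d/dt` of formal power series. -/
noncomputable def euler (F : A⟦X⟧) : A⟦X⟧ := PowerSeries.mk fun n => n • coeff n F

theorem coeff_euler (F : A⟦X⟧) (n : ℕ) : coeff n (euler F) = n • coeff n F := coeff_mk _ _

theorem euler_mul (F G : A⟦X⟧) : euler (F * G) = euler F * G + F * euler G := by
  ext n
  simp only [coeff_euler, map_add, coeff_mul, Finset.smul_sum, ← Finset.sum_add_distrib]
  refine Finset.sum_congr rfl fun a ha => ?_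
  rw [← Finset.HasAntidiagonal.mem_antidiagonal.1 ha, add_smul, smul_mul_assoc, mul_smul_comm]

theorem euler_one : euler (1 : A⟦X⟧) = 0 := by
  ext n
  rw [coeff_euler, coeff_one]
  split_ifs with h <;> simp [h]

theorem euler_pow {F : A⟦X⟧} (h : Commute F (euler F)) (k : ℕ) :
    euler (F ^ (k + 1)) = (k + 1) • (F ^ k * euler F) := by
  induction k with
  | zero => simp
  | succ k ih =>
    rw [pow_succ, euler_mul, ih, add_smul (k + 1), one_smul, smul_mul_assoc, mul_assoc,
      ← h.eq, ← mul_assoc, ← pow_succ]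

theorem commute_of_coeff {F G : A⟦X⟧} (h : ∀ i j, Commute (coeff i F) (coeff j G)) :
    Commute F G := by
  ext n
  rw [coeff_mul, coeff_mul, ← Finset.Nat.sum_antidiagonal_swap]
  exact Finset.sum_congr rfl fun a _ => h _ _

theorem coeff_pow_mul_eq_zero {F : A⟦X⟧} (h0 : coeff 0 F = 0) (k : ℕ) :
    ∀ (G : A⟦X⟧) (n : ℕ), n < k → coeff n (F ^ k * G) = 0 := by
  induction k with
  | zero => intro G n h; omega
  | succ k ih =>
    intro G n h
    rw [pow_succ', mul_assoc, coeff_mul]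
    refine Finset.sum_eq_zero fun a ha => ?_
    have h1 := Finset.HasAntidiagonal.mem_antidiagonal.1 ha
    rcases Nat.eq_zero_or_pos a.1 with h2 | h2
    · rw [h2, h0, zero_mul]
    · rw [ih G a.2 (by omega), mul_zero]

theorem coeff_mul_pow_eq_zero {F G : A⟦X⟧} (hF : coeff 0 F = 0) (hG : coeff 0 G = 0) {n k : ℕ}
    (h : n ≤ k) : coeff n (G * F ^ k) = 0 := by
  rw [coeff_mul]
  refine Finset.sum_eq_zero fun a ha => ?_
  have h2 := Finset.HasAntidiagonal.mem_antidiagonal.1 ha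
  rcases Nat.eq_zero_or_pos a.1 with h3 | h3
  · rw [h3, hG, zero_mul]
  · have := coeff_pow_mul_eq_zero hF k 1 a.2 (by omega)
    rw [mul_one] at this
    rw [this, mul_zero]

theorem coeff_zero_euler (F : A⟦X⟧) : coeff 0 (euler F) = 0 := by
  rw [coeff_euler, zero_smul]

theorem coeff_neg_one_pow_mul (k n : ℕ) (F : A⟦X⟧) :
    coeff n ((-1) ^ k * F) = (-1 : K) ^ k • coeff n F := by
  induction k with
  | zero => simp
  | succ k ih => rw [pow_succ', mul_assoc, neg_one_mul, map_neg, ih, pow_succ']; simp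

theorem sum_Icc_one_eq_sum_range {M : Type*} [AddCommMonoid M] (f : ℕ → M) (n : ℕ) :
    ∑ k ∈ Finset.Icc 1 n, f k = ∑ k ∈ Finset.range n, f (k + 1) := by
  induction n with
  | zero => simp
  | succ n ih => rw [Finset.sum_Icc_succ_top (by omega), ih, Finset.sum_range_succ]

theorem coeff_zero_psLog (F : A⟦X⟧) : coeff 0 (psLog (K := K) F) = 0 := by
  simp [psLog]

theorem coeff_zero_psExp (F : A⟦X⟧) : coeff 0 (psExp (K := K) F) = 1 := by
  simp [psExp]

theorem coeff_psExp {F : A⟦X⟧} (hF : coeff 0 F = 0) {n N : ℕ} (h : n < N) :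
    coeff n (psExp (K := K) F) =
      ∑ k ∈ Finset.range N, ((k.factorial : K)⁻¹) • coeff n (F ^ k) := by
  rw [psExp, coeff_mk]
  refine Finset.sum_subset (Finset.range_subset_range.2 h) fun k _ hk => ?_
  rw [Finset.mem_range, not_lt] at hk
  have := coeff_pow_mul_eq_zero hF k 1 n (by omega)
  rw [mul_one] at this
  rw [this, smul_zero]

variable [CharZero K]

/-- Termwise differentiation turns the logarithm into the geometric series `∑ (-1)^k F^k DF`, which
multiplication by `1 + F` telescopes. In each degree a finite truncation is enough because `F` has
no constant term. -/
theorem euler_psLog_mul {F : A⟦X⟧} (h0 : coeff 0 F = 0)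
    (hF : ∀ i j, Commute (coeff i F) (coeff j F)) :
    euler (psLog (K := K) F) * (1 + F) = euler F := by
  have hc : Commute F (euler F) := commute_of_coeff fun i j => by
    rw [coeff_euler]; exact (hF i j).smul_right _
  have h1 : ∀ n N, n ≤ N → coeff n (euler (psLog (K := K) F)) =
      coeff n (∑ k ∈ Finset.range N, (-1 : A⟦X⟧) ^ k * (F ^ k * euler F)) := by
    intro n N hn
    simp only [map_sum, coeff_neg_one_pow_mul (K := K)]
    rw [← Finset.sum_subset (Finset.range_subset_range.2 hn), coeff_euler, psLog, coeff_mk,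
      sum_Icc_one_eq_sum_range, Finset.smul_sum]
    · refine Finset.sum_congr rfl fun k hk => ?_
      have h2 := congrArg (coeff n) (euler_pow hc k)
      rw [coeff_euler, map_nsmul, ← Nat.cast_smul_eq_nsmul K, ← Nat.cast_smul_eq_nsmul K] at h2
      have hk : ((k + 1 : ℕ) : K) ≠ 0 := Nat.cast_ne_zero.2 (Nat.succ_ne_zero k)
      rw [← Nat.cast_smul_eq_nsmul K, smul_comm, h2, smul_smul, mul_assoc, inv_mul_cancel₀ hk]
      congr 1
      ring
    · intro k _ hk
      rw [Finset.mem_range, not_lt] at hk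
      rw [(hc.pow_left _).eq, coeff_mul_pow_eq_zero h0 (coeff_zero_euler F) hk, smul_zero]
  have h2 : ∀ N, (∑ k ∈ Finset.range N, (-1 : A⟦X⟧) ^ k * (F ^ k * euler F)) * (1 + F) =
      euler F - (-1 : A⟦X⟧) ^ N * (F ^ N * euler F) := by
    intro N
    induction N with
    | zero => simp
    | succ N ih =>
      rw [Finset.sum_range_succ, add_mul, ih, mul_add, mul_one, mul_assoc ((-1) ^ N),
        mul_assoc (F ^ N), ← hc.eq, ← mul_assoc (F ^ N), ← pow_succ, pow_succ (-1 : A⟦X⟧)]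
      noncomm_ring
  ext n
  have h3 := congrArg (coeff n) (h2 (n + 1))
  rw [map_sub, ← mul_assoc, ((Commute.neg_one_left F).pow_pow _ _).eq, mul_assoc,
    coeff_pow_mul_eq_zero h0 _ _ _ (Nat.lt_succ_self n), sub_zero] at h3
  rw [← h3, coeff_mul, coeff_mul]
  refine Finset.sum_congr rfl fun a ha => ?_
  rw [h1 a.1 (n + 1) (by have := antidiagonal_fst_le ha; omega)]

theorem euler_psExp {L : A⟦X⟧} (h0 : coeff 0 L = 0)
    (hL : ∀ i j, Commute (coeff i L) (coeff j L)) :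
    euler (psExp (K := K) L) = euler L * psExp (K := K) L := by
  have hc : Commute L (euler L) := commute_of_coeff fun i j => by
    rw [coeff_euler]; exact (hL i j).smul_right _
  ext n
  have h1 : coeff n (euler L * psExp (K := K) L) =
      ∑ k ∈ Finset.range (n + 1), ((k.factorial : K)⁻¹) • coeff n (euler L * L ^ k) := by
    simp only [coeff_mul n, Finset.smul_sum]
    rw [Finset.sum_comm]
    refine Finset.sum_congr rfl fun a ha => ?_
    rw [coeff_psExp h0 (Nat.lt_succ_of_le (antidiagonal_snd_le ha)), Finset.mul_sum]
    simp only [mul_smul_comm]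
  rw [h1, Finset.sum_range_succ, coeff_mul_pow_eq_zero h0 (coeff_zero_euler L) le_rfl, smul_zero,
    add_zero, coeff_euler, psExp, coeff_mk, Finset.smul_sum, Finset.sum_range_succ', pow_zero,
    smul_comm, ← coeff_euler, euler_one, map_zero, smul_zero, add_zero]
  refine Finset.sum_congr rfl fun k hk => ?_
  have hk : ((k + 1 : ℕ) : K) ≠ 0 := Nat.cast_ne_zero.2 (Nat.succ_ne_zero k)
  have h2 := congrArg (coeff n) (euler_pow hc k)
  rw [coeff_euler, map_nsmul, ← Nat.cast_smul_eq_nsmul K (k + 1), (hc.pow_left k).eq] at h2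
  rw [smul_comm, h2, smul_smul, Nat.factorial_succ, Nat.cast_mul, mul_inv_rev, mul_assoc,
    inv_mul_cancel₀ hk, mul_one]

/-- Uniqueness for the linear equation `DG = LG`: since `L` has no constant term, the degree-`n`
coefficient of `LG` uses only lower coefficients of `G`, and `n` is invertible. -/
theorem eq_of_euler_eq_mul (K : Type*) {A : Type*} [Field K] [CharZero K] [Ring A] [Algebra K A]
    {G H L : A⟦X⟧} (hL : coeff 0 L = 0) (h0 : coeff 0 G = coeff 0 H)
    (hG : euler G = L * G) (hH : euler H = L * H) : G = H := by
  ext n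
  induction n using Nat.strong_induction_on with
  | _ n ih =>
  rcases Nat.eq_zero_or_pos n with rfl | hn
  · exact h0
  have h1 : coeff n (L * G) = coeff n (L * H) := by
    rw [coeff_mul, coeff_mul]
    refine Finset.sum_congr rfl fun a ha => ?_
    have h1 := Finset.HasAntidiagonal.mem_antidiagonal.1 ha
    rcases Nat.eq_zero_or_pos a.1 with h2 | h2
    · rw [h2, hL, zero_mul, zero_mul]
    · rw [ih a.2 (by omega)]
  rw [← hG, ← hH, coeff_euler, coeff_euler, ← Nat.cast_smul_eq_nsmul K,
    ← Nat.cast_smul_eq_nsmul K] at h1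
  exact smul_right_injective A (Nat.cast_ne_zero.2 hn.ne') h1

/-- Both `1 + F` and the exponential of its logarithm solve the same first-order equation with
constant term `1`. -/
theorem one_add_eq_psExp_psLog {F : A⟦X⟧} (h0 : coeff 0 F = 0)
    (hF : ∀ i j, Commute (coeff i F) (coeff j F))
    (hL : ∀ i j, Commute (coeff i (psLog (K := K) F)) (coeff j (psLog (K := K) F))) :
    F = -1 + psExp (K := K) (psLog (K := K) F) := by
  rw [eq_neg_add_iff_add_eq]
  refine eq_of_euler_eq_mul K (coeff_zero_euler (psLog (K := K) F)) ?_ ?_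
    (euler_psExp (coeff_zero_psLog F) hL)
  · rw [coeff_zero_psExp, map_add, h0, add_zero, coeff_zero_one]
  · rw [euler_psLog_mul h0 hF]
    ext n
    rw [coeff_euler, map_add, smul_add, ← coeff_euler, euler_one, map_zero, zero_add, coeff_euler]

/-- The coefficients of `D ln ψ` are given by the Newton identities. -/
theorem nsmul_coeff_psLog {ψ : ℕ → A} (hψ : ψ 0 = 1) (hcomm : ∀ i j, Commute (ψ i) (ψ j))
    {F : A⟦X⟧} (hF : ∀ n, coeff n (1 + F) = ψ n) (n : ℕ) :
    n • coeff n (psLog (K := K) F) = newton ψ n := by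
  have hF' : ∀ n, coeff n F = if n = 0 then 0 else ψ n := fun n => by
    have h := hF n
    rw [map_add, coeff_one] at h
    split_ifs at h ⊢ with h1
    · rw [h1, hψ] at h
      rw [h1]; simpa using h
    · simpa using h
  have h0 : coeff 0 F = 0 := by rw [hF', if_pos rfl]
  have hc : ∀ i j, Commute (coeff i F) (coeff j F) := fun i j => by
    rw [hF', hF']
    split_ifs
    · exact Commute.zero_left _
    · exact Commute.zero_left _
    · exact Commute.zero_right _
    · exact hcomm i j
  induction n using Nat.strong_induction_on with
  | _ n ih =>
  have h1 := congrArg (coeff n) (euler_psLog_mul (K := K) h0 hc)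
  rw [coeff_mul, coeff_euler, hF'] at h1
  have h2 : n • (if n = 0 then 0 else ψ n) = n • ψ n := by
    split_ifs with h <;> simp [h]
  rw [h2, ← sum_newton_mul hψ n] at h1
  have hmem : ((n, 0) : ℕ × ℕ) ∈ Finset.HasAntidiagonal.antidiagonal n := by simp
  -- Both sides are convolutions with `ψ`. By induction they agree off the pair `(n, 0)`, where `ψ_0
  -- = 1` leaves exactly the two terms to be compared.
  rw [← Finset.add_sum_erase _ _ hmem, ← Finset.add_sum_erase _ _ hmem] at h1
  simp only [hF, coeff_euler, hψ, mul_one] at h1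
  rw [Finset.sum_congr rfl (g := fun a => newton ψ a.1 * ψ a.2)] at h1
  · exact add_right_cancel h1
  · intro a ha
    have h3 := Finset.HasAntidiagonal.mem_antidiagonal.1 (Finset.mem_of_mem_erase ha)
    have h4 : a.1 ≠ n := fun h => Finset.ne_of_mem_erase ha (Prod.ext h (by dsimp only; omega))
    rw [ih a.1 (by omega)]

end LogExp
-- Relations among Chevalley generators and the first root vectors.
section Chevalley

variable {K : Type*} [Field K]

/-- The sign `(-1)^{θ(α)}`. -/
def sgn (K : Type*) [Field K] (ty : AffineType) : K := (-1) ^ ty.theta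

theorem sgn_mul_self (ty : AffineType) : sgn K ty * sgn K ty = 1 := by
  cases ty <;> simp [sgn, AffineType.theta]

theorem sgn_ne_zero (ty : AffineType) : sgn K ty ≠ 0 :=
  left_ne_zero_of_mul_eq_one (sgn_mul_self ty)

theorem sgn_inv (ty : AffineType) : (sgn K ty)⁻¹ = sgn K ty :=
  inv_eq_of_mul_eq_one_left (sgn_mul_self ty)

section Brackets

variable {A : Type*} [Ring A] [Algebra K A] (ty : AffineType) {β β' : RootLattice} (x y : A)

theorem neg_one_pow_parity (hβ : β.1.natAbs = 1) (hβ' : β'.1.natAbs = 1) {R : Type*} [Ring R] :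
    (-1 : R) ^ (parity ty β * parity ty β') = (-1) ^ ty.theta := by
  cases ty <;> simp [parity, hβ, hβ', AffineType.theta]

theorem superBracket_of_odd (hβ : β.1.natAbs = 1) (hβ' : β'.1.natAbs = 1) :
    superBracket ty β β' x y = x * y - sgn K ty • (y * x) := by
  rw [superBracket, neg_one_pow_parity ty hβ hβ', sgn]
  cases ty <;> simp [AffineType.theta]

theorem qBracket_of_odd (q : K) (hβ : β.1.natAbs = 1) (hβ' : β'.1.natAbs = 1) {m : ℤ}
    (hm : 2 * β.1 * β'.1 = m) : qBracket ty q β β' x y = x * y - (sgn K ty * q ^ m) • (y * x) := by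
  rw [qBracket, neg_one_pow_parity ty hβ hβ', sgn, form, hm]

theorem superBracket_of_left_even (hβ : β.1 = 0) : superBracket ty β β' x y = ⁅x, y⁆ := by
  simp [superBracket, parity, hβ, Ring.lie_def]

theorem superBracket_of_right_even (hβ : β'.1 = 0) : superBracket ty β β' x y = ⁅x, y⁆ := by
  simp [superBracket, parity, hβ, Ring.lie_def]

theorem qBracket_of_left_even (q : K) (hβ : β.1 = 0) : qBracket ty q β β' x y = ⁅x, y⁆ := by
  simp [qBracket, parity, form, hβ, Ring.lie_def]

theorem qBracket_of_right_even (q : K) (hβ : β'.1 = 0) : qBracket ty q β β' x y = ⁅x, y⁆ := by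
  simp [qBracket, parity, form, hβ, Ring.lie_def]

/-- The sign `s` is crossed twice when `a` passes a product of two real root vectors, so the
ordinary commutator is the right derivation here. It evaluates all four commutators of a Chevalley
generator with `e_{±δ}` needed below. -/
theorem lie_qBracket_of_odd {s t : K} (hs : s * s = 1) {a u v X Y : A}
    (hu : a * u = s • (u * a) + X) (hv : a * v = s • (v * a) + Y) :
    ⁅a, u * v - (s * t) • (v * u)⁆ = X * v - t • (v * X) + s • (u * Y - t • (Y * u)) := by
  rw [Ring.lie_def]
  linear_combination (norm := skip) hu * v + s • (u * hv) - (s * t) • (hv * u) - t • (v * hu)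
  simp only [mul_sub, sub_mul, mul_add, add_mul, smul_mul_assoc, mul_smul_comm, mul_assoc, smul_sub,
    smul_add, smul_smul]
  simp only [mul_comm _ s, mul_left_comm _ s, ← mul_assoc, hs, one_mul]
  module

theorem inv_mul_eq_smul {u : Aˣ} {a : A} {r : K} (hr : r ≠ 0) (h : (u : A) * a = r • (a * u)) :
    ((u⁻¹ : Aˣ) : A) * a = r⁻¹ • (a * (u⁻¹ : Aˣ)) := by
  rw [Units.inv_mul_eq_iff_eq_mul, mul_smul_comm, ← mul_assoc, h, smul_mul_assoc, smul_smul,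
    inv_mul_cancel₀ hr, one_smul, Units.mul_inv_cancel_right]

end Brackets

variable [StarRing K] (ty : AffineType) (P : DeformationParameter K)

local notation "e₀" => U.gen ty P (Generator.e Node.alpha)
local notation "e₁" => U.gen ty P (Generator.e Node.deltaSubAlpha)
local notation "f₀" => U.gen ty P (Generator.f Node.alpha)
local notation "f₁" => U.gen ty P (Generator.f Node.deltaSubAlpha)
local notation "k₀" => U.k ty P (CartanLabel.simple Node.alpha)
local notation "k₁" => U.k ty P (CartanLabel.simple Node.deltaSubAlpha)
local notation "kδ" => kDelta ty P
local notation "q" => DeformationParameter.q P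
local notation "σ" => sgn K ty

theorem k_mul_e (γ : CartanLabel) (i : Node) : (U.k ty P γ : U ty P) * U.gen ty P (.e i) =
    P.q ^ γ.pairing i.root • (U.gen ty P (.e i) * U.k ty P γ) := by
  have h := U.mk_rel ty P (Rel.k_e γ i)
  rw [map_mul, map_mul, map_smul] at h
  have h' : (U.k ty P γ : U ty P) * U.gen ty P (.e i) * ((U.k ty P γ)⁻¹ : (U ty P)ˣ) =
    P.q ^ γ.pairing i.root • U.gen ty P (.e i) := h
  rw [Units.mul_inv_eq_iff_eq_mul, smul_mul_assoc] at h'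
  exact h'

theorem k_mul_f (γ : CartanLabel) (i : Node) : (U.k ty P γ : U ty P) * U.gen ty P (.f i) =
    P.q ^ (-γ.pairing i.root) • (U.gen ty P (.f i) * U.k ty P γ) := by
  have h := U.mk_rel ty P (Rel.k_f γ i)
  rw [map_mul, map_mul, map_smul] at h
  have h' : (U.k ty P γ : U ty P) * U.gen ty P (.f i) * ((U.k ty P γ)⁻¹ : (U ty P)ˣ) =
    P.q ^ (-γ.pairing i.root) • U.gen ty P (.f i) := h
  rw [Units.mul_inv_eq_iff_eq_mul, smul_mul_assoc] at h'
  exact h'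

theorem k_comm (γ γ' : CartanLabel) : Commute (U.k ty P γ) (U.k ty P γ') := by
  have h := U.mk_rel ty P (Rel.k_comm γ γ')
  rw [map_mul, map_mul] at h
  exact Units.ext h

theorem k₀_e₀ : (k₀ : U ty P) * e₀ = q ^ (2 : ℤ) • (e₀ * k₀) := k_mul_e ty P _ _
theorem k₀_e₁ : (k₀ : U ty P) * e₁ = q ^ (-2 : ℤ) • (e₁ * k₀) := k_mul_e ty P _ _
theorem k₁_e₀ : (k₁ : U ty P) * e₀ = q ^ (-2 : ℤ) • (e₀ * k₁) := k_mul_e ty P _ _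
theorem k₁_e₁ : (k₁ : U ty P) * e₁ = q ^ (2 : ℤ) • (e₁ * k₁) := k_mul_e ty P _ _
theorem k₀_f₀ : (k₀ : U ty P) * f₀ = q ^ (-2 : ℤ) • (f₀ * k₀) := k_mul_f ty P _ _
theorem k₀_f₁ : (k₀ : U ty P) * f₁ = q ^ (2 : ℤ) • (f₁ * k₀) := k_mul_f ty P _ _
theorem k₁_f₀ : (k₁ : U ty P) * f₀ = q ^ (2 : ℤ) • (f₀ * k₁) := k_mul_f ty P _ _
theorem k₁_f₁ : (k₁ : U ty P) * f₁ = q ^ (-2 : ℤ) • (f₁ * k₁) := k_mul_f ty P _ _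

theorem q_zpow_ne_zero (m : ℤ) : q ^ m ≠ 0 := zpow_ne_zero _ P.ne_zero

theorem kδ_comm_e (i : Node) : Commute (kδ : U ty P) (U.gen ty P (.e i)) := by
  have h : ∀ m m' : ℤ, m + m' = 0 → (k₀ : U ty P) * U.gen ty P (.e i) =
      q ^ m • (U.gen ty P (.e i) * k₀) → (k₁ : U ty P) * U.gen ty P (.e i) =
      q ^ m' • (U.gen ty P (.e i) * k₁) → Commute (kδ : U ty P) (U.gen ty P (.e i)) := by
    intro m m' h h0 h1
    rw [Commute, SemiconjBy, kDelta, Units.val_mul, mul_assoc, h1, mul_smul_comm, ← mul_assoc, h0,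
      smul_mul_assoc, smul_smul, ← zpow_add₀ P.ne_zero, add_comm, h, zpow_zero, one_smul, mul_assoc]
  cases i
  · exact h 2 (-2) (by norm_num) (k₀_e₀ ty P) (k₁_e₀ ty P)
  · exact h (-2) 2 (by norm_num) (k₀_e₁ ty P) (k₁_e₁ ty P)

theorem kδ_comm_f (i : Node) : Commute (kδ : U ty P) (U.gen ty P (.f i)) := by
  have h : ∀ m m' : ℤ, m + m' = 0 → (k₀ : U ty P) * U.gen ty P (.f i) =
      q ^ m • (U.gen ty P (.f i) * k₀) → (k₁ : U ty P) * U.gen ty P (.f i) =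
      q ^ m' • (U.gen ty P (.f i) * k₁) → Commute (kδ : U ty P) (U.gen ty P (.f i)) := by
    intro m m' h h0 h1
    rw [Commute, SemiconjBy, kDelta, Units.val_mul, mul_assoc, h1, mul_smul_comm, ← mul_assoc, h0,
      smul_mul_assoc, smul_smul, ← zpow_add₀ P.ne_zero, add_comm, h, zpow_zero, one_smul, mul_assoc]
  cases i
  · exact h (-2) 2 (by norm_num) (k₀_f₀ ty P) (k₁_f₀ ty P)
  · exact h 2 (-2) (by norm_num) (k₀_f₁ ty P) (k₁_f₁ ty P)

theorem kδ_comm_k (γ : CartanLabel) : Commute (kδ) (U.k ty P γ) :=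
  (k_comm ty P _ _).mul_left (k_comm ty P _ _)

theorem U.induction {C : U ty P → Prop} (hs : ∀ c : K, C (algebraMap K _ c))
    (hg : ∀ g, C (U.gen ty P g)) (hm : ∀ x y, C x → C y → C (x * y))
    (ha : ∀ x y, C x → C y → C (x + y)) (x : U ty P) : C x := by
  obtain ⟨x, rfl⟩ : ∃ x', U.mk ty P x' = x := RingQuot.mkAlgHom_surjective K (Rel ty P.q) x
  induction x using FreeAlgebra.induction with
  | grade0 r => rw [AlgHom.commutes]; exact hs r
  | grade1 g => exact hg g
  | mul a b iha ihb => rw [map_mul]; exact hm _ _ iha ihb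
  | add a b iha ihb => rw [map_add]; exact ha _ _ iha ihb

/-- The root `δ` is orthogonal to both simple roots, so on each generator the scalars from the two
factors of `k_δ` cancel. -/
theorem kδ_central (x : U ty P) : Commute (kδ : U ty P) x := by
  induction x using U.induction with
  | hs c => exact (Algebra.commutes c _).symm
  | hg g =>
    cases g with
    | k γ => exact congrArg Units.val (kδ_comm_k ty P γ).eq
    | kInv γ => exact congrArg Units.val (kδ_comm_k ty P γ).inv_right.eq
    | e i => exact kδ_comm_e ty P i
    | f i => exact kδ_comm_f ty P i
  | hm x y hx hy => exact hx.mul_right hy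
  | ha x y hx hy => exact hx.add_right hy

theorem e_f_ne (i j : Node) (hij : i ≠ j) : U.gen ty P (.e i) * U.gen ty P (.f j) =
    σ • (U.gen ty P (.f j) * U.gen ty P (.e i)) := by
  have h := U.mk_rel ty P (Rel.e_f_ne i j hij)
  rw [map_zero] at h
  have h' := (map_superBracket ty (U.mk ty P).toRingHom _ _ _ _).symm.trans h
  rw [superBracket_of_odd (K := K) ty _ _ (by cases i <;> rfl) (by cases j <;> rfl),
    sub_eq_zero] at h'
  exact h'

theorem e_f (i : Node) : U.gen ty P (.e i) * U.gen ty P (.f i) =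
    σ • (U.gen ty P (.f i) * U.gen ty P (.e i)) + (q - q⁻¹)⁻¹ •
      ((U.k ty P (.simple i) : U ty P) - ((U.k ty P (.simple i))⁻¹ : (U ty P)ˣ)) := by
  have h := U.mk_rel ty P (Rel.e_f i)
  have h' := (map_superBracket ty (U.mk ty P).toRingHom _ _ _ _).symm.trans h
  rw [superBracket_of_odd (K := K) ty _ _ (by cases i <;> rfl) (by cases i <;> rfl),
    sub_eq_iff_eq_add', map_smul, map_sub] at h'
  exact h'

theorem eDelta_eq : eDelta ty P = e₀ * e₁ - (σ * q ^ (-2 : ℤ)) • (e₁ * e₀) :=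
  qBracket_of_odd ty _ _ _ (by rfl) (by rfl) (by rfl)

theorem eNegDelta_eq : eNegDelta ty P = f₁ * f₀ - (σ * q ^ (2 : ℤ)) • (f₀ * f₁) := by
  rw [eNegDelta, qBracket_of_odd ty _ _ _ (by rfl) (by rfl) (m := -2) (by rfl), inv_zpow', neg_neg]

theorem q_sub_inv_ne_zero : q - q⁻¹ ≠ 0 := by
  intro h
  refine P.pow_ne_one 2 (by norm_num) ?_
  have := P.ne_zero
  field_simp at h
  linear_combination h

theorem a_eq : a P = (q ^ (2 : ℤ) - q ^ (-2 : ℤ)) / (q - q⁻¹) := rfl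

theorem a_ne_zero : a P ≠ 0 := by
  rw [a_eq]
  refine div_ne_zero (fun h => P.pow_ne_one 4 (by norm_num) ?_) (q_sub_inv_ne_zero P)
  have := P.ne_zero
  rw [zpow_neg, zpow_ofNat] at h
  field_simp at h
  linear_combination h

/-- One of the four places where a string of root vectors crosses from positive to negative indices;
the Cartan factor and sign that appear here dictate the normalization of the currents. -/
theorem e₀_lie_eNegDelta : ⁅e₀, eNegDelta ty P⁆ = -(σ * a P) • ((k₀ : U ty P) * f₁) := by
  have h1 := k₀_f₁ ty P
  have h2 := inv_mul_eq_smul (q_zpow_ne_zero P 2) h1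
  have hq := q_zpow_ne_zero P 2
  rw [eNegDelta_eq, lie_qBracket_of_odd (sgn_mul_self ty) (X := 0)
    (by rw [add_zero]; exact e_f_ne ty P _ _ (by simp)) (e_f ty P _), a_eq]
  simp only [zero_mul, mul_zero, smul_zero, sub_zero, zero_add, mul_sub, sub_mul, mul_smul_comm,
    smul_mul_assoc, h1, h2, smul_sub, smul_smul, zpow_neg]
  match_scalars <;> field_simp <;> ring

theorem e₁_lie_eNegDelta : ⁅e₁, eNegDelta ty P⁆ = a P • (f₀ * (k₁⁻¹ : (U ty P)ˣ)) := by
  have h1 := k₁_f₀ ty P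
  have h2 := inv_mul_eq_smul (q_zpow_ne_zero P 2) h1
  have hq := q_zpow_ne_zero P 2
  rw [eNegDelta_eq, lie_qBracket_of_odd (sgn_mul_self ty) (Y := 0) (e_f ty P _)
    (by rw [add_zero]; exact e_f_ne ty P _ _ (by simp)), a_eq]
  simp only [zero_mul, mul_zero, smul_zero, sub_zero, add_zero, mul_sub, sub_mul, mul_smul_comm,
    smul_mul_assoc, h1, h2, smul_sub, smul_smul, zpow_neg]
  match_scalars <;> field_simp <;> ring

theorem f_e_ne (i j : Node) (hij : i ≠ j) : U.gen ty P (.f i) * U.gen ty P (.e j) =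
    σ • (U.gen ty P (.e j) * U.gen ty P (.f i)) := by
  rw [e_f_ne ty P j i hij.symm, smul_smul, sgn_mul_self, one_smul]

theorem f_e (i : Node) : U.gen ty P (.f i) * U.gen ty P (.e i) =
    σ • (U.gen ty P (.e i) * U.gen ty P (.f i)) + -(σ * (q - q⁻¹)⁻¹) •
      ((U.k ty P (.simple i) : U ty P) - ((U.k ty P (.simple i))⁻¹ : (U ty P)ˣ)) := by
  rw [e_f ty P i, smul_add, smul_smul, sgn_mul_self, one_smul]
  module

theorem f₁_lie_eDelta : ⁅f₁, eDelta ty P⁆ = -a P • ((k₁ : U ty P) * e₀) := by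
  have h1 := k₁_e₀ ty P
  have h2 := inv_mul_eq_smul (q_zpow_ne_zero P (-2)) h1
  have hq := q_zpow_ne_zero P 2
  have hs := sgn_mul_self (K := K) ty
  rw [eDelta_eq, lie_qBracket_of_odd (sgn_mul_self ty) (X := 0)
    (by rw [add_zero]; exact f_e_ne ty P _ _ (by simp)) (f_e ty P _), a_eq]
  simp only [zero_mul, mul_zero, smul_zero, sub_zero, zero_add, mul_sub, sub_mul, mul_smul_comm,
    smul_mul_assoc, h1, h2, smul_sub, smul_smul, zpow_neg, inv_inv]
  rcases mul_self_eq_one_iff.1 hs with h | h <;> rw [h] <;> match_scalars <;> field_simp <;> ring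

theorem f₀_lie_eDelta : ⁅f₀, eDelta ty P⁆ = (σ * a P) • (e₁ * (k₀⁻¹ : (U ty P)ˣ)) := by
  have h1 := k₀_e₁ ty P
  have h2 := inv_mul_eq_smul (q_zpow_ne_zero P (-2)) h1
  have hq := q_zpow_ne_zero P 2
  rw [eDelta_eq, lie_qBracket_of_odd (sgn_mul_self ty) (Y := 0) (f_e ty P _)
    (by rw [add_zero]; exact f_e_ne ty P _ _ (by simp)), a_eq]
  simp only [zero_mul, mul_zero, smul_zero, sub_zero, add_zero, mul_sub, sub_mul, mul_smul_comm,
    smul_mul_assoc, h1, h2, smul_sub, smul_smul, zpow_neg, inv_inv]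
  match_scalars <;> field_simp <;> ring

theorem posPlus_lie (n : ℕ) : ⁅posPlus ty P n, eDelta ty P⁆ = a P • posPlus ty P (n + 1) := by
  rw [posPlus, smul_inv_smul₀ (a_ne_zero P), superBracket_of_right_even ty _ _ rfl]

theorem posMinus_lie (n : ℕ) : ⁅posMinus ty P n, eDelta ty P⁆ = -a P • posMinus ty P (n + 1) := by
  rw [posMinus, neg_smul, smul_inv_smul₀ (a_ne_zero P), superBracket_of_left_even ty _ _ rfl,
    commutator_skew]

theorem negPlus_lie (n : ℕ) : ⁅negPlus ty P n, eNegDelta ty P⁆ = a P • negPlus ty P (n + 1) := by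
  rw [negPlus, smul_inv_smul₀ (a_ne_zero P), superBracket_of_right_even ty _ _ rfl]

theorem negMinus_lie (n : ℕ) :
    ⁅negMinus ty P n, eNegDelta ty P⁆ = -a P • negMinus ty P (n + 1) := by
  rw [negMinus, neg_smul, smul_inv_smul₀ (a_ne_zero P), superBracket_of_left_even ty _ _ rfl,
    commutator_skew]

/-- The innermost bracket of the Serre relation is `e_δ` and the next is `a e_{δ+α}`, so the
relation itself says that `e_α` and `e_{δ+α}` commute up to the scalar `(-1)^θ q²`. -/
theorem posPlus_serre : posPlus ty P 0 * posPlus ty P 1 =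
    (σ * q ^ (2 : ℤ)) • (posPlus ty P 1 * posPlus ty P 0) := by
  have h := U.mk_rel ty P Rel.serre_e_alpha
  rw [map_serreLeft, map_zero, serreLeft, qBracket_of_odd (m := 2) ty _ _ _ (by rfl) (by rfl) (by rfl),
    qBracket_of_right_even ty _ _ _ (by rfl)] at h
  have h' : e₀ * ⁅posPlus ty P 0, eDelta ty P⁆ -
    (σ * q ^ (2 : ℤ)) • (⁅posPlus ty P 0, eDelta ty P⁆ * e₀) = 0 := h
  rw [posPlus_lie, smul_mul_assoc, mul_smul_comm, smul_comm, ← smul_sub] at h'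
  exact sub_eq_zero.1 ((smul_eq_zero.1 h').resolve_left (a_ne_zero P))

theorem posMinus_serre : posMinus ty P 1 * posMinus ty P 0 =
    (σ * q ^ (2 : ℤ)) • (posMinus ty P 0 * posMinus ty P 1) := by
  have h := U.mk_rel ty P Rel.serre_e_delta
  rw [map_serreRight, map_zero, serreRight,
    qBracket_of_odd (m := 2) ty _ _ _ (by rfl) (by rfl) (by rfl),
    qBracket_of_left_even ty _ _ _ (by rfl)] at h
  have h' : ⁅eDelta ty P, posMinus ty P 0⁆ * e₁ -
    (σ * q ^ (2 : ℤ)) • (e₁ * ⁅eDelta ty P, posMinus ty P 0⁆) = 0 := h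
  rw [commutator_skew, posMinus_lie, neg_smul, neg_neg, smul_mul_assoc, mul_smul_comm, smul_comm,
    ← smul_sub] at h'
  exact sub_eq_zero.1 ((smul_eq_zero.1 h').resolve_left (a_ne_zero P))

end Chevalley
-- The root vectors of the quantum algebra as loop currents.
section CurrentRealization

/-- Since `⁅D, E⁆` is central, the Jacobi identity makes the actions of `D` and `E` on a string
commute. If `D` generates the string, the effect of `E` on its first vector therefore determines its
effect on all others. -/
theorem lie_opposite_shift {K A : Type*} [Field K] [Ring A] [Algebra K A] {u : ℕ → A} {u' D E : A}
    {k l : K} {v v' : Aˣ} (hk : k ≠ 0) (hv : ∀ a, Commute (v : A) a)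
    (hv' : ∀ a, Commute (v' : A) a) (hD : ∀ n, ⁅u n, D⁆ = k • (v * u (n + 1)))
    (h0 : ⁅u 0, E⁆ = l • (v' * u')) (h1 : ⁅u', D⁆ = k • (v * u 0))
    (hDE : ∀ a, Commute ⁅D, E⁆ a) (n : ℕ) : ⁅u (n + 1), E⁆ = l • (v' * u n) := by
  have step : ∀ n a, ⁅u n, E⁆ = l • (v' * a) → ⁅a, D⁆ = k • (v * u n) →
      ⁅u (n + 1), E⁆ = l • (v' * u n) := by
    intro n a h2 h3
    have h4 := commutator_jacobi (u n) D E
    have h5 := commutator_jacobi (u n) E D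
    have h6 : ⁅u n, ⁅D, E⁆⁆ = 0 := lie_eq_zero_of_commute (hDE _).symm
    have h7 : ⁅⁅u n, D⁆, E⁆ = ⁅⁅u n, E⁆, D⁆ := by
      rw [h4, h6, add_zero]
    rw [hD, h2, smul_commutator, smul_commutator, mul_lie_eq, mul_lie_eq, h3,
      lie_eq_zero_of_commute (hv _), lie_eq_zero_of_commute (hv' _), zero_mul, zero_mul, zero_add,
      zero_add, mul_smul_comm, smul_comm l k, ← mul_assoc, ← (hv (v' : A)).eq, mul_assoc,
      ← mul_smul_comm l] at h7
    exact (Units.mul_right_inj v).1 (smul_right_injective A hk h7)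
  induction n with
  | zero => exact step 0 u' h0 h1
  | succ n ih => exact step (n + 1) (u n) ih (hD n)

variable {K : Type*} [Field K] [StarRing K] (ty : AffineType) (P : DeformationParameter K)

local notation "e₀" => U.gen ty P (Generator.e Node.alpha)
local notation "e₁" => U.gen ty P (Generator.e Node.deltaSubAlpha)
local notation "f₀" => U.gen ty P (Generator.f Node.alpha)
local notation "f₁" => U.gen ty P (Generator.f Node.deltaSubAlpha)
local notation "k₀" => U.k ty P (CartanLabel.simple Node.alpha)
local notation "k₁" => U.k ty P (CartanLabel.simple Node.deltaSubAlpha)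
local notation "kδ" => kDelta ty P
local notation "q" => DeformationParameter.q P
local notation "σ" => sgn K ty

/-- The parameter `(-1)^{θ(α)} q²`. -/
noncomputable def signedParam : K := σ * q ^ (2 : ℤ)

local notation "ρ" => signedParam ty P

theorem genConst_eq : genConst ty P = σ * (q - q⁻¹) := rfl

theorem signedParam_inv : ρ⁻¹ = σ * q ^ (-2 : ℤ) := by
  rw [signedParam, mul_inv, sgn_inv, zpow_neg]

theorem genConst_mul_a : genConst ty P * a P = ρ - ρ⁻¹ := by
  rw [genConst_eq, a_eq, signedParam_inv, signedParam, mul_assoc,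
    mul_div_cancel₀ _ (q_sub_inv_ne_zero P)]
  ring

theorem genConst_ne_zero : genConst ty P ≠ 0 :=
  mul_ne_zero (sgn_ne_zero ty) (q_sub_inv_ne_zero P)

/-- The elements `x_n = e_{nδ+α}`, `n ≥ 0`, and `x_{-n} = -(-1)^{(n+1)θ} k_{nδ-α}⁻¹ e_{-nδ+α}`,
`n > 0`. -/
noncomputable def xCurrent : ℤ → U ty P
  | .ofNat n => posPlus ty P n
  | .negSucc n => (-σ ^ n) • (((k₀ * kδ ^ (-(n + 1 : ℤ)) : (U ty P)ˣ) : U ty P) * negPlus ty P n)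

/-- The multiples by `(-1)^θ (q - q⁻¹)` of `e_{nδ-α}`, `n > 0`, and of
`-(-1)^{(n+1)θ} e_{-nδ-α} k_{nδ+α}`, `n ≥ 0`. -/
noncomputable def yCurrent : ℤ → U ty P
  | .ofNat 0 => (genConst ty P * -σ) • (f₀ * k₀)
  | .ofNat (n + 1) => genConst ty P • posMinus ty P n
  | .negSucc n => (genConst ty P * -σ ^ n) •
      (negMinus ty P (n + 1) * ((k₀ * kδ ^ (n + 1 : ℤ) : (U ty P)ˣ) : U ty P))

/-- The element `(q - q⁻¹) e_{-δ}`. -/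
noncomputable def chi : U ty P := (q - q⁻¹) • eNegDelta ty P

theorem xCurrent_neg (n : ℕ) : xCurrent ty P (-(n + 1)) =
    (-σ ^ n) • (((k₀ * kδ ^ (-(n + 1 : ℤ)) : (U ty P)ˣ) : U ty P) * negPlus ty P n) := by
  rw [show (-(n + 1) : ℤ) = Int.negSucc n by omega]
  rfl

theorem yCurrent_neg (n : ℕ) : yCurrent ty P (-n) = (genConst ty P * -σ ^ (n + 1)) •
    (negMinus ty P n * ((k₀ * kδ ^ (n : ℤ) : (U ty P)ˣ) : U ty P)) := by
  cases n with
  | zero =>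
    rw [zero_add, pow_one, Nat.cast_zero, zpow_zero, mul_one]
    rfl
  | succ n =>
    rw [show (-(n + 1 : ℕ) : ℤ) = Int.negSucc n by omega, pow_succ, pow_succ, mul_assoc,
      sgn_mul_self, mul_one]
    push_cast
    rfl

theorem k₀_comm_eDelta : Commute (k₀ : U ty P) (eDelta ty P) := by
  rw [eDelta_eq]
  have hq := q_zpow_ne_zero P 2
  refine Commute.sub_right ?_ (Commute.smul_right ?_ _)
  · rw [Commute, SemiconjBy, ← mul_assoc, k₀_e₀, smul_mul_assoc, mul_assoc, k₀_e₁, mul_smul_comm,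
      smul_smul, zpow_neg, mul_inv_cancel₀ hq, one_smul, mul_assoc]
  · rw [Commute, SemiconjBy, ← mul_assoc, k₀_e₁, smul_mul_assoc, mul_assoc, k₀_e₀, mul_smul_comm,
      smul_smul, zpow_neg, inv_mul_cancel₀ hq, one_smul, mul_assoc]

theorem k₀_comm_eNegDelta : Commute (k₀ : U ty P) (eNegDelta ty P) := by
  rw [eNegDelta_eq]
  have hq := q_zpow_ne_zero P 2
  refine Commute.sub_right ?_ (Commute.smul_right ?_ _)
  · rw [Commute, SemiconjBy, ← mul_assoc, k₀_f₁, smul_mul_assoc, mul_assoc, k₀_f₀, mul_smul_comm,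
      smul_smul, zpow_neg, mul_inv_cancel₀ hq, one_smul, mul_assoc]
  · rw [Commute, SemiconjBy, ← mul_assoc, k₀_f₀, smul_mul_assoc, mul_assoc, k₀_f₁, mul_smul_comm,
      smul_smul, zpow_neg, inv_mul_cancel₀ hq, one_smul, mul_assoc]

theorem kδ_zpow_central (m : ℤ) (x : U ty P) : Commute ((kδ ^ m : (U ty P)ˣ) : U ty P) x := by
  rcases m with m | m
  · rw [Int.ofNat_eq_natCast, zpow_natCast, Units.val_pow_eq_pow_val]
    exact (kδ_central ty P x).pow_left m
  · rw [zpow_negSucc, ← inv_pow, Units.val_pow_eq_pow_val]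
    exact ((kδ_central ty P x).units_inv_left).pow_left _

theorem kδ_zpow_mul_k (m m' : ℤ) : kδ ^ m * (k₀ * kδ ^ m') = k₀ * kδ ^ (m + m') := by
  rw [((kδ_comm_k ty P _).zpow_left m).left_comm, zpow_add]

theorem k_comm_eDelta (m : ℤ) :
    Commute ((k₀ * kδ ^ m : (U ty P)ˣ) : U ty P) (eDelta ty P) :=
  (k₀_comm_eDelta ty P).mul_left (kδ_zpow_central ty P m _)

theorem k_comm_eNegDelta (m : ℤ) :
    Commute ((k₀ * kδ ^ m : (U ty P)ˣ) : U ty P) (eNegDelta ty P) :=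
  (k₀_comm_eNegDelta ty P).mul_left (kδ_zpow_central ty P m _)

theorem pBracket_x_zero_y_one :
    pBracket ρ (xCurrent ty P 0) (yCurrent ty P 1) = genConst ty P • eDelta ty P := by
  have h : pBracket ρ (xCurrent ty P 0) (yCurrent ty P 1) =
    pBracket ρ e₀ (genConst ty P • e₁) := rfl
  rw [h, pBracket_smul_right, pBracket, signedParam_inv, eDelta_eq]

theorem x_up_nonneg (n : ℕ) :
    ⁅xCurrent ty P n, genConst ty P • eDelta ty P⁆ = (ρ - ρ⁻¹) • xCurrent ty P (n + 1) := by
  have h := posPlus_lie ty P n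
  have h' : ⁅xCurrent ty P n, eDelta ty P⁆ = a P • xCurrent ty P (n + 1) := h
  rw [commutator_smul, h', smul_smul, genConst_mul_a]

theorem y_up_pos (n : ℕ) : ⁅yCurrent ty P (n + 1), genConst ty P • eDelta ty P⁆ =
    -(ρ - ρ⁻¹) • yCurrent ty P (n + 1 + 1) := by
  have h : ⁅genConst ty P • posMinus ty P n, genConst ty P • eDelta ty P⁆ =
      -(ρ - ρ⁻¹) • genConst ty P • posMinus ty P (n + 1) := by
    rw [commutator_smul, smul_commutator, posMinus_lie, ← genConst_mul_a]
    module
  exact h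

theorem sub_inv_mul_a : (q - q⁻¹) * a P = σ * (ρ - ρ⁻¹) := by
  rw [← genConst_mul_a, genConst_eq, mul_assoc, ← mul_assoc, sgn_mul_self, one_mul]

theorem x_down_neg (n : ℕ) : ⁅xCurrent ty P (-(n + 1)), chi ty P⁆ =
    (ρ - ρ⁻¹) • (kδ * xCurrent ty P (-((n + 1 : ℕ) + 1))) := by
  rw [xCurrent_neg, xCurrent_neg, chi, smul_commutator, commutator_smul, mul_lie_eq,
    lie_eq_zero_of_commute (k_comm_eNegDelta ty P _), zero_mul, zero_add, negPlus_lie,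
    mul_smul_comm, mul_smul_comm, smul_smul, smul_smul, smul_smul, ← mul_assoc (kδ : U ty P),
    ← Units.val_mul]
  congr 1
  · linear_combination (-σ ^ n) * sub_inv_mul_a ty P
  · have h := kδ_zpow_mul_k ty P 1 (-((n + 1 : ℕ) + 1))
    rw [zpow_one] at h
    rw [h]
    congr 4

theorem y_down_nonpos (n : ℕ) : ⁅yCurrent ty P (-n), chi ty P⁆ =
    -(ρ - ρ⁻¹) • ((kδ⁻¹ : (U ty P)ˣ) * yCurrent ty P (-(n + 1 : ℕ))) := by
  have hc : Commute ((kδ⁻¹ : (U ty P)ˣ) : U ty P) (negMinus ty P (n + 1)) :=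
    (kδ_central ty P _).units_inv_left
  rw [yCurrent_neg, yCurrent_neg, chi, smul_commutator, commutator_smul, mul_lie_eq,
    lie_eq_zero_of_commute (k_comm_eNegDelta ty P _), mul_zero, add_zero, negMinus_lie,
    smul_mul_assoc, mul_smul_comm, smul_smul, smul_smul, smul_smul,
    ← mul_assoc ((kδ⁻¹ : (U ty P)ˣ) : U ty P), hc.eq, mul_assoc (negMinus ty P (n + 1)), ← Units.val_mul]
  congr 1
  · linear_combination (genConst ty P * σ ^ (n + 1)) * sub_inv_mul_a ty P
  · rw [← zpow_neg_one, kδ_zpow_mul_k]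
    congr 4
    push_cast
    ring

theorem k_mul_kδ_inv : k₀ * kδ ^ (-1 : ℤ) = k₁⁻¹ := by
  rw [zpow_neg_one, kDelta, mul_inv_rev, ← mul_assoc,
    ((k_comm ty P (.simple .alpha) (.simple .deltaSubAlpha)).inv_right).eq, mul_inv_cancel_right]

theorem k_inv_mul : (k₀ * kδ ^ (-1 : ℤ)) * k₁ = 1 := by
  rw [k_mul_kδ_inv, inv_mul_cancel]

theorem x_neg_one_up : ⁅xCurrent ty P (-1), genConst ty P • eDelta ty P⁆ =
    (ρ - ρ⁻¹) • xCurrent ty P 0 := by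
  have h := xCurrent_neg ty P 0
  rw [Nat.cast_zero, zero_add, pow_zero] at h
  have h0 := k_inv_mul ty P
  rw [h, smul_commutator, commutator_smul, mul_lie_eq,
    lie_eq_zero_of_commute (k_comm_eDelta ty P _), zero_mul, zero_add]
  have h1 : ⁅negPlus ty P 0, eDelta ty P⁆ = -a P • ((k₁ : U ty P) * e₀) := f₁_lie_eDelta ty P
  rw [h1, mul_smul_comm, ← mul_assoc, ← Units.val_mul, h0, Units.val_one, one_mul, smul_smul,
    smul_smul, ← genConst_mul_a]
  congr 1
  ring

theorem y_zero_up : ⁅yCurrent ty P 0, genConst ty P • eDelta ty P⁆ =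
    -(ρ - ρ⁻¹) • yCurrent ty P 1 := by
  have h : ⁅(genConst ty P * -σ) • (f₀ * (k₀ : U ty P)), genConst ty P • eDelta ty P⁆ =
      -(ρ - ρ⁻¹) • genConst ty P • e₁ := by
    rw [smul_commutator, commutator_smul, mul_lie_eq,
      lie_eq_zero_of_commute (k₀_comm_eDelta ty P), mul_zero, add_zero, f₀_lie_eDelta,
      smul_mul_assoc, mul_assoc, Units.inv_mul, mul_one, smul_smul, smul_smul, smul_smul,
      ← genConst_mul_a]
    congr 1
    linear_combination (-genConst ty P ^ 2 * a P) * sgn_mul_self (K := K) ty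
  exact h

theorem x_zero_down : ⁅xCurrent ty P 0, chi ty P⁆ =
    (ρ - ρ⁻¹) • (kδ * xCurrent ty P (-1)) := by
  have h := xCurrent_neg ty P 0
  rw [Nat.cast_zero, zero_add, pow_zero] at h
  have h1 : ⁅xCurrent ty P 0, eNegDelta ty P⁆ = -(σ * a P) • ((k₀ : U ty P) * negPlus ty P 0) :=
    e₀_lie_eNegDelta ty P
  rw [h, chi, commutator_smul, h1, mul_smul_comm, ← mul_assoc, ← Units.val_mul,
    show kδ * (k₀ * kδ ^ (-1 : ℤ)) = k₀ by
      simpa using kδ_zpow_mul_k ty P 1 (-1),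
    smul_smul, smul_smul]
  congr 1
  have h2 := sub_inv_mul_a ty P
  linear_combination (-σ) * h2 - (ρ - ρ⁻¹) * sgn_mul_self (K := K) ty

theorem y_one_down : ⁅yCurrent ty P 1, chi ty P⁆ =
    -(ρ - ρ⁻¹) • ((kδ⁻¹ : (U ty P)ˣ) * yCurrent ty P 0) := by
  have h : ⁅genConst ty P • e₁, chi ty P⁆ =
    -(ρ - ρ⁻¹) • ((kδ⁻¹ : (U ty P)ˣ) * ((genConst ty P * -σ) • (f₀ * (k₀ : U ty P)))) := by
    have hc : Commute ((kδ⁻¹ : (U ty P)ˣ) : U ty P) f₀ := (kδ_central ty P _).units_inv_left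
    rw [chi, smul_commutator, commutator_smul, e₁_lie_eNegDelta, mul_smul_comm, ← mul_assoc,
      hc.eq, mul_assoc, ← Units.val_mul, smul_smul, smul_smul, smul_smul]
    congr 1
    · linear_combination genConst ty P * sub_inv_mul_a ty P
    · rw [← k_mul_kδ_inv, zpow_neg_one, ((kδ_comm_k ty P _).inv_left).eq]
  exact h

/-- Moving `k_α` past `e_α` turns the `ρ`-bracket into `[e_α, e_{-α}] k_α`, a combination of `k_α²`
and `1`. This fixes `w = k_α²` in the abstract structure. -/
theorem bracket_zero_zero : pBracket ρ (xCurrent ty P 0) (yCurrent ty P 0) =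
    1 - (k₀ * k₀ : (U ty P)ˣ) := by
  have h : pBracket ρ e₀ ((genConst ty P * -σ) • (f₀ * (k₀ : U ty P))) =
      1 - (k₀ * k₀ : (U ty P)ˣ) := by
    have hq := q_zpow_ne_zero P 2
    have hc := q_sub_inv_ne_zero P
    have h1 : σ * q ^ (-2 : ℤ) * q ^ (2 : ℤ) = σ := by
      rw [zpow_neg, mul_assoc, inv_mul_cancel₀ hq, mul_one]
    rw [pBracket_smul_right, pBracket, signedParam_inv, mul_assoc f₀, k₀_e₀, mul_smul_comm,
      smul_smul, h1, ← mul_assoc, e_f, add_mul, smul_mul_assoc, mul_assoc, add_sub_cancel_left,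
      smul_mul_assoc, sub_mul, Units.inv_mul, smul_smul, genConst_eq,
      show σ * (q - q⁻¹) * -σ * (q - q⁻¹)⁻¹ = -1 by
        linear_combination (-σ * σ) * mul_inv_cancel₀ hc - sgn_mul_self (K := K) ty, Units.val_mul]
    module
  exact h

theorem bracket_neg_one_one : pBracket ρ (xCurrent ty P (-1)) (yCurrent ty P 1) =
    1 - (kδ ^ (-2 : ℤ) : (U ty P)ˣ) * (k₀ * k₀ : (U ty P)ˣ) := by
  have h := xCurrent_neg ty P 0
  rw [Nat.cast_zero, zero_add, pow_zero, k_mul_kδ_inv] at h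
  have h0 : yCurrent ty P 1 = genConst ty P • e₁ := rfl
  have h0' : negPlus ty P 0 = f₁ := rfl
  have h2 := inv_mul_eq_smul (q_zpow_ne_zero P 2) (k₁_e₁ ty P)
  have h3 : e₁ * ((k₁⁻¹ : (U ty P)ˣ) : U ty P) = q ^ (2 : ℤ) • (((k₁⁻¹ : (U ty P)ˣ) : U ty P) * e₁) := by
    rw [h2, smul_inv_smul₀ (q_zpow_ne_zero P 2)]
  have hq := q_zpow_ne_zero P 2
  have hc := q_sub_inv_ne_zero P
  have h1 : σ * q ^ (-2 : ℤ) * q ^ (2 : ℤ) = σ := by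
    rw [zpow_neg, mul_assoc, inv_mul_cancel₀ hq, mul_one]
  have hk : kδ ^ (-2 : ℤ) * (k₀ * k₀) = k₁⁻¹ * k₁⁻¹ := by
    rw [← k_mul_kδ_inv, mul_assoc k₀ _ (k₀ * _), kδ_zpow_mul_k, ← mul_assoc k₀ k₀,
      (((kδ_comm_k ty P _).mul_right (kδ_comm_k ty P _)).zpow_left _).eq]
    norm_num
  rw [h, h0, h0', pBracket_smul_right, pBracket_smul_left, pBracket, signedParam_inv, ← mul_assoc,
    h3, smul_mul_assoc, smul_smul (σ * _), h1, mul_assoc, mul_assoc, ← mul_smul_comm, ← mul_sub, f_e,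
    add_sub_cancel_left, mul_smul_comm, mul_sub, Units.inv_mul, smul_smul, smul_smul, genConst_eq,
    show σ * (q - q⁻¹) * -1 * -(σ * (q - q⁻¹)⁻¹) = 1 by
        linear_combination (σ * σ) * mul_inv_cancel₀ hc + sgn_mul_self (K := K) ty, one_smul, ← Units.val_mul,
    ← Units.val_mul, hk]

/-- The commutator of `e_δ` and `e_{-δ}` is computed from the level-zero brackets: the `k_α²` terms
cancel and a multiple of `k_δ - k_δ⁻¹` remains. This centrality is what `lie_opposite_shift`
requires. -/
theorem commutator_psi_chi (a : U ty P) : Commute ⁅genConst ty P • eDelta ty P, chi ty P⁆ a := by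
  rw [← pBracket_x_zero_y_one, pBracket_lie, x_zero_down, y_one_down, pBracket_smul_left,
    pBracket_smul_right, pBracket_mul_left _ (kδ_central ty P),
    pBracket_mul_right _ (fun b => (kδ_central ty P b).units_inv_left), bracket_zero_zero,
    bracket_neg_one_one, neg_smul, ← sub_eq_add_neg, ← smul_sub]
  refine Commute.smul_left ?_ _
  rw [mul_sub, mul_sub, ← mul_assoc, ← Units.val_mul, ← zpow_one_add]
  simp only [mul_one, Int.reduceNeg, Int.reduceAdd, zpow_neg_one]
  rw [sub_sub_sub_cancel_right]
  exact (kδ_central ty P a).sub_left (kδ_central ty P a).units_inv_left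

theorem param_sub_ne_zero : ρ - ρ⁻¹ ≠ 0 := by
  rw [← genConst_mul_a]
  exact mul_ne_zero (genConst_ne_zero ty P) (a_ne_zero P)

/-- On each half-line one shift holds by the recursive definition of the root vectors, and the
crossing at the origin is a Chevalley computation. The other shift follows from these by
`lie_opposite_shift`. -/
theorem loopCurrents : LoopCurrents ρ (xCurrent ty P) (yCurrent ty P) (chi ty P)
    ((k₀ * k₀ : (U ty P)ˣ) : U ty P) kδ where
  ne_zero := mul_ne_zero (sgn_ne_zero ty) (q_zpow_ne_zero P 2)
  pow_ne_one n hn h := by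
    -- Squaring `ρ^n = 1` removes the sign and gives `q^{4n} = 1`.
    refine P.pow_ne_one (4 * n) (by omega) ?_
    have h1 := congrArg (fun a => a * a) h
    have h2 : σ ^ n * σ ^ n = 1 := by rw [← mul_pow, sgn_mul_self, one_pow]
    rw [signedParam, zpow_ofNat] at h1
    rw [mul_pow, mul_mul_mul_comm, h2, ← pow_mul, ← pow_add, one_mul, one_mul] at h1
    rw [← h1]
    congr 1
    ring
  z_central := kδ_central ty P
  x_serre := posPlus_serre ty P
  y_serre := by
    have h : (genConst ty P • posMinus ty P 1) * (genConst ty P • posMinus ty P 0) =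
      ρ • ((genConst ty P • posMinus ty P 0) * (genConst ty P • posMinus ty P 1)) := by
      simp only [smul_mul_assoc, mul_smul_comm, posMinus_serre]
      rw [signedParam]
      module
    exact h
  bracket_zero := bracket_zero_zero ty P
  bracket_neg_one := bracket_neg_one_one ty P
  w_comm := by
    rw [pBracket_x_zero_y_one, Units.val_mul]
    exact ((k₀_comm_eDelta ty P).mul_left (k₀_comm_eDelta ty P)).smul_right _
  x_up n := by
    rw [pBracket_x_zero_y_one]
    rcases n with n | n
    · exact x_up_nonneg ty P n
    · cases n with
      | zero => exact x_neg_one_up ty P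
      | succ n =>
        have h := lie_opposite_shift (u := fun n : ℕ => xCurrent ty P (-(n + 1)))
          (u' := xCurrent ty P 0) (v := kδ) (v' := 1) (l := ρ - ρ⁻¹) (param_sub_ne_zero ty P)
          (kδ_central ty P) (fun a => by rw [Units.val_one]; exact Commute.one_left a)
          (x_down_neg ty P)
          (by simpa using x_neg_one_up ty P) (by simpa using x_zero_down ty P)
          (fun a => by rw [commutator_skew]; exact (commutator_psi_chi ty P a).neg_left) n
        rw [Units.val_one, one_mul] at h
        rw [show Int.negSucc (n + 1) = -(((n + 1 : ℕ) : ℤ) + 1) by omega,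
          show -(((n + 1 : ℕ) : ℤ) + 1) + 1 = -((n : ℤ) + 1) by omega]
        exact h
  y_up n := by
    rw [pBracket_x_zero_y_one]
    rcases n with n | n
    · cases n with
      | zero => exact y_zero_up ty P
      | succ n => exact y_up_pos ty P n
    · have h := lie_opposite_shift (u := fun n : ℕ => yCurrent ty P (-n))
          (u' := yCurrent ty P 1) (v := kδ⁻¹) (v' := 1) (l := -(ρ - ρ⁻¹))
          (neg_ne_zero.2 (param_sub_ne_zero ty P))
          (fun b => (kδ_central ty P b).units_inv_left)
          (fun a => by rw [Units.val_one]; exact Commute.one_left a)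
          (y_down_nonpos ty P)
          (by simpa using y_zero_up ty P) (by simpa using y_one_down ty P)
          (fun a => by rw [commutator_skew]; exact (commutator_psi_chi ty P a).neg_left) n
      rw [Units.val_one, one_mul] at h
      rw [show Int.negSucc n = -((n + 1 : ℕ) : ℤ) by omega,
        show -((n + 1 : ℕ) : ℤ) + 1 = -(n : ℤ) by omega]
      exact h
  x_down n := by
    rcases n with n | n
    · cases n with
      | zero => exact x_zero_down ty P
      | succ n =>
        have h := lie_opposite_shift (u := fun n : ℕ => xCurrent ty P n)
          (u' := xCurrent ty P (-1)) (v := 1) (v' := kδ) (l := ρ - ρ⁻¹) (param_sub_ne_zero ty P)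
          (fun a => by rw [Units.val_one]; exact Commute.one_left a) (kδ_central ty P)
          (fun n => by rw [Units.val_one, one_mul]; exact x_up_nonneg ty P n)
          (x_zero_down ty P) (by simpa using x_neg_one_up ty P)
          (commutator_psi_chi ty P) n
        rw [show Int.ofNat (n + 1) - 1 = (n : ℤ) by simp]
        exact h
    · rw [show Int.negSucc n = -((n : ℤ) + 1) by omega,
        show -((n : ℤ) + 1) - 1 = -(((n + 1 : ℕ) : ℤ) + 1) by omega]
      exact x_down_neg ty P n
  y_down n := by
    rcases n with n | n
    · cases n with
      | zero => simpa using y_down_nonpos ty P 0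
      | succ n =>
        cases n with
        | zero => exact y_one_down ty P
        | succ n =>
          have h := lie_opposite_shift (u := fun n : ℕ => yCurrent ty P (n + 1))
            (u' := yCurrent ty P 0) (v := 1) (v' := kδ⁻¹) (l := -(ρ - ρ⁻¹))
            (neg_ne_zero.2 (param_sub_ne_zero ty P))
            (fun a => by rw [Units.val_one]; exact Commute.one_left a)
            (fun b => (kδ_central ty P b).units_inv_left)
            (fun n => by rw [Units.val_one, one_mul]; exact y_up_pos ty P n)
            (by simpa using y_one_down ty P) (by simpa using y_zero_up ty P)
            (commutator_psi_chi ty P) n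
          rw [show Int.ofNat (n + 1 + 1) - 1 = (n : ℤ) + 1 by simp]
          exact h
    · have h := y_down_nonpos ty P (n + 1)
      rw [show Int.negSucc n = -((n + 1 : ℕ) : ℤ) by omega,
        show -((n + 1 : ℕ) : ℤ) - 1 = -((n + 1 + 1 : ℕ) : ℤ) by omega]
      exact h

end CurrentRealization
-- Positive imaginary root vectors, the exponential formula, and their action on the currents.
section ImaginaryRoots

variable {K : Type*} [Field K] [StarRing K] (ty : AffineType) (P : DeformationParameter K)

local notation "e₀" => U.gen ty P (Generator.e Node.alpha)
local notation "e₁" => U.gen ty P (Generator.e Node.deltaSubAlpha)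
local notation "f₀" => U.gen ty P (Generator.f Node.alpha)
local notation "f₁" => U.gen ty P (Generator.f Node.deltaSubAlpha)
local notation "k₀" => U.k ty P (CartanLabel.simple Node.alpha)
local notation "kδ" => kDelta ty P
local notation "q" => DeformationParameter.q P
local notation "σ" => sgn K ty
local notation "ρ" => signedParam ty P
local notation "ψ" => psi (signedParam ty P) (xCurrent ty P) (yCurrent ty P)

/-- The weight relation spreads from `e_α` along the current because both shifting elements have
imaginary weight and commute with `k_α`. -/
theorem k₀_mul_xCurrent (n : ℤ) :
    (k₀ : U ty P) * xCurrent ty P n = q ^ (2 : ℤ) • (xCurrent ty P n * k₀) := by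
  have H := loopCurrents ty P
  have key : ∀ (d : U ty P), Commute (k₀ : U ty P) d → ∀ a b : U ty P, (k₀ : U ty P) * a =
      q ^ (2 : ℤ) • (a * k₀) → ⁅a, d⁆ = (ρ - ρ⁻¹) • b →
      (k₀ : U ty P) * b = q ^ (2 : ℤ) • (b * k₀) := by
    intro d hd a b ha hb
    refine H.smul_cancel ?_
    rw [← mul_smul_comm, ← hb, smul_comm, ← smul_mul_assoc, ← hb, Ring.lie_def, mul_sub, sub_mul,
      ← mul_assoc, ha, ← mul_assoc, hd.eq, mul_assoc d, ha, mul_assoc a d, ← hd.eq, smul_sub,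
      smul_mul_assoc, mul_smul_comm, mul_assoc a, mul_assoc d]
  induction n using Int.induction_on with
  | zero => exact k₀_e₀ ty P
  | succ n ih =>
    refine key _ ?_ _ _ ih (H.x_up n)
    rw [pBracket_x_zero_y_one]
    exact (k₀_comm_eDelta ty P).smul_right _
  | pred n ih =>
    have h := key _ ((k₀_comm_eNegDelta ty P).smul_right (q - q⁻¹)) _ _ ih (H.x_down (-n))
    rw [← mul_assoc, ← (kδ_central ty P (k₀ : U ty P)).eq,
      mul_assoc, mul_assoc, ← mul_smul_comm] at h
    exact (Units.mul_right_inj kδ).1 h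

theorem k₀_mul_yCurrent (n : ℤ) :
    (k₀ : U ty P) * yCurrent ty P n = q ^ (-2 : ℤ) • (yCurrent ty P n * k₀) := by
  have H := loopCurrents ty P
  have key : ∀ (d : U ty P), Commute (k₀ : U ty P) d → ∀ a b : U ty P, (k₀ : U ty P) * a =
      q ^ (-2 : ℤ) • (a * k₀) → ⁅a, d⁆ = -(ρ - ρ⁻¹) • b →
      (k₀ : U ty P) * b = q ^ (-2 : ℤ) • (b * k₀) := by
    intro d hd a b ha hb
    refine smul_right_injective _ (neg_ne_zero.2 H.pi_ne) ?_
    dsimp only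
    rw [← mul_smul_comm, ← hb, smul_comm, ← smul_mul_assoc, ← hb, Ring.lie_def, mul_sub, sub_mul,
      ← mul_assoc, ha, ← mul_assoc, hd.eq, mul_assoc d, ha, mul_assoc a d, ← hd.eq, smul_sub,
      smul_mul_assoc, mul_smul_comm, mul_assoc a, mul_assoc d]
  induction n using Int.induction_on with
  | zero =>
    have h : (k₀ : U ty P) * ((genConst ty P * -σ) • (f₀ * (k₀ : U ty P))) =
      q ^ (-2 : ℤ) • (((genConst ty P * -σ) • (f₀ * (k₀ : U ty P))) * k₀) := by
      rw [mul_smul_comm, ← mul_assoc, k₀_f₀, smul_mul_assoc, smul_mul_assoc, smul_comm]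
    exact h
  | succ n ih =>
    refine key _ ?_ _ _ ih (H.y_up n)
    rw [pBracket_x_zero_y_one]
    exact (k₀_comm_eDelta ty P).smul_right _
  | pred n ih =>
    have h := key _ ((k₀_comm_eNegDelta ty P).smul_right (q - q⁻¹)) _ _ ih (H.y_down (-n))
    rw [← mul_assoc, ← ((kδ_central ty P (k₀ : U ty P)).units_inv_left).eq,
      mul_assoc, mul_assoc, ← mul_smul_comm] at h
    exact (Units.mul_right_inj kδ⁻¹).1 h

theorem k₀_comm_pBracket (i j : ℤ) :
    Commute (k₀ : U ty P) (pBracket ρ (xCurrent ty P i) (yCurrent ty P j)) := by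
  have hq := q_zpow_ne_zero P 2
  refine Commute.sub_right ?_ (Commute.smul_right ?_ _)
  · rw [Commute, SemiconjBy, ← mul_assoc, k₀_mul_xCurrent, smul_mul_assoc, mul_assoc,
      k₀_mul_yCurrent, mul_smul_comm, smul_smul, zpow_neg, mul_inv_cancel₀ hq, one_smul, mul_assoc]
  · rw [Commute, SemiconjBy, ← mul_assoc, k₀_mul_yCurrent, smul_mul_assoc, mul_assoc,
      k₀_mul_xCurrent, mul_smul_comm, smul_smul, zpow_neg, inv_mul_cancel₀ hq, one_smul, mul_assoc]

/-- Identifies `ψ` with `1 + ℰ'(u)`: as `(α, nδ-α) = -2`, the `q`-bracket defining `e'_{nδ}` is the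
`ρ`-bracket. -/
theorem psi_eq_ePrime {n : ℕ} (hn : n ≠ 0) : ψ n = genConst ty P • ePrime ty P n := by
  obtain ⟨m, rfl⟩ : ∃ m, n = m + 1 := ⟨n - 1, by omega⟩
  have h : yCurrent ty P (m + 1 : ℕ) = genConst ty P • eMinus ty P (m + 1 : ℕ) := rfl
  have h0 : xCurrent ty P 0 = e₀ := rfl
  have h1 : (rootMinus (m + 1 : ℕ)).1 = -1 := by simp [rootMinus, rootDelta, rootAlpha]
  rw [psi, if_neg hn, h, h0, pBracket_smul_right, pBracket, signedParam_inv, ePrime,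
    qBracket_of_odd (m := -2) ty _ _ _ (by rfl) (by rw [h1]; rfl) (by rw [h1]; rfl)]

/-- The coefficients of `ℰ(u)`. -/
noncomputable def logCoeff (n : ℕ) : U ty P :=
  PowerSeries.coeff n (psLog (K := K) (genSeries ty P (ePrime ty P)))

theorem posImag_eq (n : ℕ) : posImag ty P n = (genConst ty P)⁻¹ • logCoeff ty P n := rfl

theorem coeff_one_add_genSeries (n : ℕ) :
    PowerSeries.coeff n (1 + genSeries ty P (ePrime ty P)) = ψ n := by
  rw [map_add, PowerSeries.coeff_one, genSeries, PowerSeries.coeff_mk]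
  split_ifs with h
  · rw [h, psi_zero, add_zero]
  · rw [zero_add, psi_eq_ePrime ty P h]

theorem logCoeff_zero : logCoeff ty P 0 = 0 := coeff_zero_psLog _

theorem genSeries_eImag : genSeries ty P (fun n => eImag ty P n) =
    psLog (K := K) (genSeries ty P (ePrime ty P)) := by
  ext n
  rw [genSeries, PowerSeries.coeff_mk]
  split_ifs with h
  · rw [h, coeff_zero_psLog]
  · have h1 : eImag ty P n = (genConst ty P)⁻¹ • logCoeff ty P n := rfl
    rw [h1, smul_inv_smul₀ (genConst_ne_zero ty P)]
    rfl

variable [CharZero K]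

theorem psi_comm (i j : ℕ) : Commute (ψ i) (ψ j) := (loopCurrents ty P).psi_comm_psi i j

theorem nsmul_logCoeff (n : ℕ) : n • logCoeff ty P n = newton ψ n :=
  nsmul_coeff_psLog (psi_zero _ _ _) (psi_comm ty P) (coeff_one_add_genSeries ty P) n

theorem logCoeff_eq {n : ℕ} (hn : n ≠ 0) : logCoeff ty P n = (n : K)⁻¹ • newton ψ n := by
  rw [← nsmul_logCoeff, ← Nat.cast_smul_eq_nsmul K, inv_smul_smul₀ (Nat.cast_ne_zero.2 hn)]

theorem newton_comm_newton (i j : ℕ) : Commute (newton ψ i) (newton ψ j) :=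
  newton_commute fun r _ => Commute.symm (newton_commute fun s _ => psi_comm ty P s r)

theorem logCoeff_comm (i j : ℕ) : Commute (logCoeff ty P i) (logCoeff ty P j) := by
  rcases eq_or_ne i 0 with rfl | hi
  · rw [logCoeff_zero]; exact Commute.zero_left _
  rcases eq_or_ne j 0 with rfl | hj
  · rw [logCoeff_zero]; exact Commute.zero_right _
  rw [logCoeff_eq ty P hi, logCoeff_eq ty P hj]
  exact ((newton_comm_newton ty P i j).smul_left _).smul_right _

theorem genSeries_ePrime_eq : genSeries ty P (ePrime ty P) =
    -1 + psExp (K := K) (genSeries ty P fun n => eImag ty P n) := by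
  rw [genSeries_eImag]
  refine one_add_eq_psExp_psLog ?_ (fun i j => ?_) (logCoeff_comm ty P)
  · rw [genSeries, PowerSeries.coeff_mk, if_pos rfl]
  · rw [genSeries, PowerSeries.coeff_mk, PowerSeries.coeff_mk]
    split_ifs with h h' h'
    · exact Commute.zero_left _
    · exact Commute.zero_left _
    · exact Commute.zero_right _
    · rw [← psi_eq_ePrime ty P h, ← psi_eq_ePrime ty P h']
      exact psi_comm ty P i j

/-- The source of the sign `(-1)^{(m-1)θ}`: the `m`-th power of the sign in `ρ` times the sign in
the normalization of the generating series. -/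
theorem imag_scalar {m : ℕ} (hm : m ≠ 0) :
    (genConst ty P)⁻¹ * ((m : K)⁻¹ * (ρ ^ m - ρ⁻¹ ^ m)) = σ ^ (m + 1) * aCoeff P m := by
  have hc := q_sub_inv_ne_zero P
  have hm' : (m : K) ≠ 0 := Nat.cast_ne_zero.2 hm
  have h1 : aCoeff P m = (q ^ (2 * m) - (q ^ (2 * m))⁻¹) / (m * (q - q⁻¹)) := by
    have h2 : form rootAlpha rootAlpha = 2 := rfl
    rw [aCoeff, h2, zpow_neg, show (m : ℤ) * 2 = ((2 * m : ℕ) : ℤ) by push_cast; ring, zpow_natCast,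
      Int.cast_natCast]
  rw [h1, signedParam_inv, signedParam, mul_pow, mul_pow, genConst_eq, mul_inv, sgn_inv, zpow_neg,
    zpow_ofNat, inv_pow, ← pow_mul, pow_succ]
  field_simp

theorem x_lie_posImag (n : ℤ) {m : ℕ} (hm : m ≠ 0) : ⁅xCurrent ty P n, posImag ty P m⁆ =
    (σ ^ (m + 1) * aCoeff P m) • xCurrent ty P (n + m) := by
  rw [posImag_eq, logCoeff_eq ty P hm, commutator_smul, commutator_smul, commutator_skew,
    (loopCurrents ty P).newton_lie_x, ← imag_scalar ty P hm]
  module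

theorem y_lie_posImag (n : ℤ) {m : ℕ} (hm : m ≠ 0) : ⁅yCurrent ty P n, posImag ty P m⁆ =
    -(σ ^ (m + 1) * aCoeff P m) • yCurrent ty P (n + m) := by
  rw [posImag_eq, logCoeff_eq ty P hm, commutator_smul, commutator_smul, commutator_skew,
    (loopCurrents ty P).newton_lie_y, ← imag_scalar ty P hm]
  module

theorem k₀_comm_posImag (m : ℕ) : Commute (k₀ : U ty P) (posImag ty P m) := by
  rcases eq_or_ne m 0 with rfl | hm
  · rw [posImag_eq, logCoeff_zero, smul_zero]; exact Commute.zero_right _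
  rw [posImag_eq, logCoeff_eq ty P hm]
  refine Commute.smul_right (Commute.smul_right (Commute.symm (newton_commute fun r _ => ?_)) _) _
  rw [psi]
  split_ifs
  · exact Commute.one_left _
  · exact (k₀_comm_pBracket ty P 0 r).symm

theorem k_comm_posImag (i : ℤ) (m : ℕ) :
    Commute ((k₀ * kδ ^ i : (U ty P)ˣ) : U ty P) (posImag ty P m) :=
  (k₀_comm_posImag ty P m).mul_left (kδ_zpow_central ty P i _)

end ImaginaryRoots
-- Effect of the conjugation on the currents, and the Heisenberg relation.
section ConjugateRootVectors

section Sign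

variable {K : Type*} [Field K] (ty : AffineType)

theorem sgn_zpow_neg (i : ℤ) : sgn K ty ^ (-i) = sgn K ty ^ i := by
  rw [zpow_neg, ← inv_zpow, sgn_inv]

theorem sgn_zpow_mul_self (i : ℤ) : sgn K ty ^ i * sgn K ty ^ i = 1 := by
  rw [← mul_zpow, sgn_mul_self, one_zpow]

theorem neg_one_zpow_mul_theta (m : ℤ) : (-1 : K) ^ (m * (ty.theta : ℤ)) = sgn K ty ^ m := by
  rw [mul_comm, zpow_mul, zpow_natCast, sgn]

theorem neg_one_zpow_sub_one_mul_theta (m : ℕ) :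
    (-1 : K) ^ (((m : ℤ) - 1) * ty.theta) = sgn K ty ^ (m + 1) := by
  rw [neg_one_zpow_mul_theta, ← zpow_natCast, Nat.cast_succ, zpow_sub₀ (sgn_ne_zero ty),
    zpow_add₀ (sgn_ne_zero ty), zpow_one, div_eq_mul_inv, sgn_inv]

end Sign

/-- Removes the Cartan factors that conjugation attaches to the currents. Pulling `k` through the
reversed product yields `r²`, and `p r² = p⁻¹` restores the coefficient of the deformed bracket. -/
theorem conj_pBracket_aux {K A : Type*} [Field K] [Ring A] [Algebra K A] {d₁ d₂ X Y : A} {k : Aˣ}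
    {s s₁ s₂ p r : K} (h₁ : ∀ a, Commute d₁ a) (h₂ : ∀ a, Commute d₂ a)
    (hX : ((k⁻¹ : Aˣ) : A) * (X * k) = r • X) (hY : (k : A) * (Y * (k⁻¹ : Aˣ)) = r • Y)
    (hs : s * (s₁ * s₂) = 1) (hp : p * (r * r) = p⁻¹) :
    s • ((k : A) * (s₁ • (d₁ * ((k⁻¹ : Aˣ) * X)) * s₂ • (d₂ * (Y * (k⁻¹ : Aˣ))) -
      p • (s₂ • (d₂ * (Y * (k⁻¹ : Aˣ))) * s₁ • (d₁ * ((k⁻¹ : Aˣ) * X)))) * k) =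
      (d₁ * d₂) * pBracket p X Y := by
  have h12 : ∀ a, Commute (d₁ * d₂) a := fun a => (h₁ a).mul_left (h₂ a)
  have hk : ∀ Z, (k : A) * (d₁ * d₂ * Z) * k = d₁ * d₂ * (k * Z * k) := fun Z => by
    rw [← mul_assoc (k : A), ← (h12 _).eq, mul_assoc (d₁ * d₂), mul_assoc (d₁ * d₂)]
  have e1 : (k : A) * ((d₁ * ((k⁻¹ : Aˣ) * X)) * (d₂ * (Y * (k⁻¹ : Aˣ)))) * k =
      d₁ * d₂ * (X * Y) := by
    rw [(h₂ _).symm.mul_mul_mul_comm, hk]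
    simp only [mul_assoc, Units.mul_inv_cancel_left, Units.inv_mul, mul_one]
  have e2 : (k : A) * ((d₂ * (Y * (k⁻¹ : Aˣ))) * (d₁ * ((k⁻¹ : Aˣ) * X))) * k =
      (r * r) • (d₁ * d₂ * (Y * X)) := by
    have h3 : (k : A) * (Y * (k⁻¹ : Aˣ) * ((k⁻¹ : Aˣ) * X)) * k = (r * r) • (Y * X) := by
      rw [← smul_mul_smul_comm, ← hX, ← hY]
      simp only [mul_assoc]
    rw [(h₁ _).symm.mul_mul_mul_comm, ← (h₁ d₂).eq, hk, h3, mul_smul_comm]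
  have hs' : s * (s₂ * s₁) = 1 := by rw [mul_comm s₂, hs]
  simp only [mul_sub, sub_mul, smul_mul_assoc, mul_smul_comm, smul_smul, pBracket] at e1 e2 ⊢
  rw [e1, e2, smul_sub, smul_smul, hs', one_smul, smul_smul, smul_smul]
  congr 2
  linear_combination (p * r * r) * hs + hp

variable {K : Type*} [Field K] [StarRing K] (ty : AffineType) (P : DeformationParameter K)

local notation "e₀" => U.gen ty P (Generator.e Node.alpha)
local notation "e₁" => U.gen ty P (Generator.e Node.deltaSubAlpha)
local notation "f₀" => U.gen ty P (Generator.f Node.alpha)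
local notation "f₁" => U.gen ty P (Generator.f Node.deltaSubAlpha)
local notation "k₀" => U.k ty P (CartanLabel.simple Node.alpha)
local notation "kδ" => kDelta ty P
local notation "q" => DeformationParameter.q P
local notation "σ" => sgn K ty
local notation "ρ" => signedParam ty P
local notation "ψ" => psi (signedParam ty P) (xCurrent ty P) (yCurrent ty P)

theorem conj_sub (x y : U ty P) : conj ty P (x - y) = conj ty P x - conj ty P y := by
  unfold conj; rw [map_sub]; rfl

theorem conj_one : conj ty P 1 = 1 := by
  unfold conj; rw [map_one]; rfl

theorem conj_commutator (x y : U ty P) : conj ty P ⁅x, y⁆ = ⁅conj ty P y, conj ty P x⁆ := by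
  rw [Ring.lie_def, Ring.lie_def, conj_sub, conj_mul, conj_mul]

theorem conj_algebraMap (c : K) : conj ty P (algebraMap K _ c) = algebraMap K _ (star c) := by
  rw [Algebra.algebraMap_eq_smul_one, conj_smul, conj_one, Algebra.algebraMap_eq_smul_one]

theorem conj_conj (x : U ty P) : conj ty P (conj ty P x) = x := by
  induction x using U.induction with
  | hs c => rw [conj_algebraMap, conj_algebraMap, star_star]
  | hg g => rw [conj_gen, conj_gen]; cases g <;> rfl
  | hm x y hx hy => rw [conj_mul, conj_mul, hx, hy]
  | ha x y hx hy => rw [conj_add, conj_add, hx, hy]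

/-- The units inverted by the conjugation. -/
noncomputable def unitaryUnits : Subgroup (U ty P)ˣ where
  carrier := {u | conj ty P u = (u⁻¹ : (U ty P)ˣ)}
  one_mem' := by simpa using conj_one ty P
  mul_mem' {u v} hu hv := by
    simp only [Set.mem_ofPred_eq] at hu hv ⊢
    rw [Units.val_mul, conj_mul, hu, hv, mul_inv_rev, Units.val_mul]
  inv_mem' {u} hu := by
    simp only [Set.mem_ofPred_eq] at hu ⊢
    rw [← hu, conj_conj, inv_inv]

theorem k_mem_unitaryUnits (γ : CartanLabel) : U.k ty P γ ∈ unitaryUnits ty P :=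
  conj_gen ty P (.k γ)

theorem kδ_mem_unitaryUnits : kδ ∈ unitaryUnits ty P :=
  mul_mem (k_mem_unitaryUnits ty P _) (k_mem_unitaryUnits ty P _)

theorem conj_k (i : ℤ) : conj ty P ((k₀ * kδ ^ i : (U ty P)ˣ) : U ty P) =
    ((k₀ * kδ ^ i)⁻¹ : (U ty P)ˣ) :=
  mul_mem (k_mem_unitaryUnits ty P _) (zpow_mem (kδ_mem_unitaryUnits ty P) i)

theorem star_q_zpow (m : ℤ) : star (q ^ m) = q ^ (-m) := by
  rw [star_zpow₀, P.star_eq, inv_zpow']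

theorem star_sgn : star σ = σ := by
  rw [sgn, star_pow, star_neg, star_one]

theorem star_q_sub : star (q - q⁻¹) = -(q - q⁻¹) := by
  rw [star_sub, star_inv₀, P.star_eq, inv_inv, neg_sub]

theorem star_genConst : star (genConst ty P) = -genConst ty P := by
  rw [genConst_eq, star_mul', star_sgn, star_q_sub, mul_neg]

theorem star_signedParam_inv : star ρ⁻¹ = ρ := by
  rw [signedParam_inv, star_mul', star_sgn, star_q_zpow, neg_neg, signedParam]

theorem star_a : star (a P) = a P := by
  rw [a_eq, star_div₀, star_q_sub, star_sub, star_q_zpow, star_q_zpow, neg_neg, div_neg,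
    ← neg_div, neg_sub]

theorem star_aCoeff (m : ℤ) : star (aCoeff P m) = aCoeff P m := by
  rw [aCoeff, star_div₀, star_mul', star_q_sub, star_sub, star_q_zpow, star_q_zpow, neg_neg,
    star_intCast, mul_neg, div_neg, ← neg_div, neg_sub]

theorem conj_eDelta : conj ty P (eDelta ty P) = eNegDelta ty P := by
  rw [eDelta_eq, eNegDelta_eq, conj_sub, conj_smul, conj_mul, conj_mul, star_mul', star_sgn,
    star_q_zpow, neg_neg]
  simp only [conj_gen, Generator.conj]

theorem conj_posPlus (n : ℕ) : conj ty P (posPlus ty P n) = negMinus ty P n := by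
  induction n with
  | zero => exact conj_gen ty P _
  | succ n ih =>
    rw [posPlus, negMinus, superBracket_of_right_even ty _ _ rfl,
      superBracket_of_left_even ty _ _ rfl, conj_smul, conj_commutator, ih, conj_eDelta, star_inv₀,
      star_a]

theorem conj_posMinus (n : ℕ) : conj ty P (posMinus ty P n) = negPlus ty P n := by
  induction n with
  | zero => exact conj_gen ty P _
  | succ n ih =>
    rw [posMinus, negPlus, superBracket_of_left_even ty _ _ rfl,
      superBracket_of_right_even ty _ _ rfl, conj_smul, conj_commutator, ih, conj_eDelta, star_inv₀,
      star_a]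

theorem conj_negMinus (n : ℕ) : conj ty P (negMinus ty P n) = posPlus ty P n := by
  rw [← conj_posPlus, conj_conj]

theorem conj_negPlus (n : ℕ) : conj ty P (negPlus ty P n) = posMinus ty P n := by
  rw [← conj_posMinus, conj_conj]

theorem genConst_inv : (genConst ty P)⁻¹ = σ * (q - q⁻¹)⁻¹ := by
  rw [genConst_eq, mul_inv, sgn_inv]

/-- The conjugation exchanges the two currents and negates the index, up to a scalar and a Cartan
unit. One formula covers both half-lines only because of the sign normalization of the currents. -/
theorem conj_xCurrent (i : ℤ) : conj ty P (xCurrent ty P i) =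
    (-(σ ^ i * (q - q⁻¹)⁻¹)) • (yCurrent ty P (-i) * ((k₀ * kδ ^ i)⁻¹ : (U ty P)ˣ)) := by
  have hc := q_sub_inv_ne_zero P
  have hs := sgn_mul_self (K := K) ty
  rcases i with n | n
  · have h : conj ty P (xCurrent ty P (Int.ofNat n)) = negMinus ty P n := conj_posPlus ty P n
    have hs' := sgn_zpow_mul_self (K := K) ty n
    rw [zpow_natCast] at hs'
    rw [h, Int.ofNat_eq_natCast, yCurrent_neg, smul_mul_assoc, mul_assoc, Units.mul_inv, mul_one,
      smul_smul, zpow_natCast, genConst_eq,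
      show -(σ ^ n * (q - q⁻¹)⁻¹) * (σ * (q - q⁻¹) * -σ ^ (n + 1)) =
        (σ ^ n * σ ^ n) * (σ * σ) * ((q - q⁻¹) * (q - q⁻¹)⁻¹) by ring, hs, hs',
      mul_inv_cancel₀ hc, one_mul, one_mul, one_smul]
  · have h0 : yCurrent ty P (-Int.negSucc n) = genConst ty P • posMinus ty P n := rfl
    rw [h0, show Int.negSucc n = -(n + 1 : ℤ) by omega, xCurrent_neg, conj_smul, conj_mul, conj_k,
      conj_negPlus, smul_mul_assoc, smul_smul, sgn_zpow_neg, star_neg, star_pow, star_sgn,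
      ← Nat.cast_succ, zpow_natCast, genConst_eq]
    congr 1
    rw [show -(σ ^ (n + 1) * (q - q⁻¹)⁻¹) * (σ * (q - q⁻¹)) =
      - (σ ^ n * (σ * σ)) * ((q - q⁻¹) * (q - q⁻¹)⁻¹) by ring, hs, mul_inv_cancel₀ hc]
    ring

theorem conj_yCurrent (j : ℤ) : conj ty P (yCurrent ty P j) =
    (σ ^ j * (q - q⁻¹)) • (((k₀ * kδ ^ (-j))⁻¹ : (U ty P)ˣ) * xCurrent ty P (-j)) := by
  have hs := sgn_mul_self (K := K) ty
  obtain ⟨n, rfl | rfl⟩ : ∃ n : ℕ, j = -n ∨ j = n + 1 := by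
    rcases j with _ | n
    · rename_i n
      cases n with
      | zero => exact ⟨0, Or.inl rfl⟩
      | succ n => exact ⟨n, Or.inr rfl⟩
    · exact ⟨n + 1, Or.inl rfl⟩
  · rw [yCurrent_neg, conj_smul, conj_mul, conj_k, conj_negMinus, star_mul', star_genConst,
      star_neg, star_pow, star_sgn, neg_neg, sgn_zpow_neg, zpow_natCast, genConst_eq]
    have h0 : xCurrent ty P n = posPlus ty P n := rfl
    rw [h0]
    rw [zpow_natCast]
    congr 1
    linear_combination (q - q⁻¹) * σ ^ n * hs
  · have h0 : yCurrent ty P (n + 1) = genConst ty P • posMinus ty P n := rfl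
    rw [h0, conj_smul, conj_posMinus, star_genConst, xCurrent_neg, mul_smul_comm, ← mul_assoc,
      ← Units.val_mul, inv_mul_cancel, Units.val_one, one_mul, smul_smul, ← Nat.cast_succ,
      zpow_natCast, genConst_eq]
    congr 1
    have hs' := sgn_zpow_mul_self (K := K) ty n
    rw [zpow_natCast] at hs'
    rw [Nat.succ_eq_add_one, pow_succ]
    linear_combination (q - q⁻¹) * σ * hs'

theorem k_inv_comm_k (i j : ℤ) : (k₀ * kδ ^ i) * (k₀ * kδ ^ j)⁻¹ = kδ ^ (i - j) := by
  rw [mul_inv_rev, ← zpow_neg, mul_assoc, ← mul_assoc (kδ ^ i), ← zpow_add,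
    (((kδ_comm_k ty P (.simple .alpha)).zpow_left _).inv_right).eq, mul_inv_cancel_left,
    sub_eq_add_neg]

theorem k_inv_comm_k' (i j : ℤ) : (k₀ * kδ ^ i)⁻¹ * (k₀ * kδ ^ j) = kδ ^ (j - i) := by
  rw [mul_inv_rev, ← zpow_neg, mul_assoc, inv_mul_cancel_left, ← zpow_add, neg_add_eq_sub]

theorem k_comm_conj {u : U ty P} (i : ℤ) (h : Commute ((k₀ * kδ ^ i : (U ty P)ˣ) : U ty P) u) :
    Commute ((k₀ * kδ ^ i : (U ty P)ˣ) : U ty P) (conj ty P u) := by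
  have h1 := congrArg (conj ty P) h.eq
  rw [conj_mul, conj_mul, conj_k] at h1
  have h2 : Commute (((k₀ * kδ ^ i)⁻¹ : (U ty P)ˣ) : U ty P) (conj ty P u) := h1.symm
  simpa using h2.units_inv_left

/-- Reflects level `r` to level `-r`. For `i + j < 0` the conjugated bracket depends only on the
level, so a negative-level bracket varies along its level only through `k_δ^{i-j}`, as
`newton_lie_lowering` demands. -/
theorem pBracket_neg (i j : ℤ) : pBracket ρ (xCurrent ty P i) (yCurrent ty P j) =
    (kδ ^ (i - j) : (U ty P)ˣ) * (-(σ ^ (i + j)) • ((k₀ : U ty P) *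
      conj ty P (pBracket ρ (xCurrent ty P (-j)) (yCurrent ty P (-i))) * k₀)) := by
  have hq := q_zpow_ne_zero P 2
  have hc := q_sub_inv_ne_zero P
  have hX : ((k₀⁻¹ : (U ty P)ˣ) : U ty P) * (xCurrent ty P i * k₀) =
      q ^ (-2 : ℤ) • xCurrent ty P i := by
    rw [zpow_neg, eq_inv_smul_iff₀ hq, ← mul_smul_comm, ← k₀_mul_xCurrent,
      Units.inv_mul_cancel_left]
  have hY : (k₀ : U ty P) * (yCurrent ty P j * (k₀⁻¹ : (U ty P)ˣ)) =
      q ^ (-2 : ℤ) • yCurrent ty P j := by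
    rw [← mul_assoc, k₀_mul_yCurrent, smul_mul_assoc, Units.mul_inv_cancel_right]
  have hinv : ∀ m : ℤ, (k₀ * kδ ^ m)⁻¹ = kδ ^ (-m) * k₀⁻¹ := fun m => by
    rw [mul_inv_rev, zpow_neg]
  have hx : conj ty P (xCurrent ty P (-j)) = (-(σ ^ j * (q - q⁻¹)⁻¹)) •
      (((kδ ^ j : (U ty P)ˣ) : U ty P) * (yCurrent ty P j * (k₀⁻¹ : (U ty P)ˣ))) := by
    rw [conj_xCurrent, neg_neg, hinv, neg_neg, Units.val_mul,
      (kδ_zpow_central ty P j (yCurrent ty P j)).symm.left_comm, sgn_zpow_neg]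
  have hy : conj ty P (yCurrent ty P (-i)) = (σ ^ i * (q - q⁻¹)) •
      (((kδ ^ (-i) : (U ty P)ˣ) : U ty P) * ((k₀⁻¹ : (U ty P)ˣ) * xCurrent ty P i)) := by
    rw [conj_yCurrent, neg_neg, hinv, Units.val_mul, mul_assoc, sgn_zpow_neg]
  have h : conj ty P (pBracket ρ (xCurrent ty P (-j)) (yCurrent ty P (-i))) =
      conj ty P (yCurrent ty P (-i)) * conj ty P (xCurrent ty P (-j)) -
        ρ • (conj ty P (xCurrent ty P (-j)) * conj ty P (yCurrent ty P (-i))) := by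
    rw [pBracket, conj_sub, conj_smul, conj_mul, conj_mul, star_signedParam_inv]
  rw [h, hx, hy, conj_pBracket_aux (kδ_zpow_central ty P _) (kδ_zpow_central ty P _) hX hY, ← mul_assoc,
    ← Units.val_mul, ← Units.val_mul, ← zpow_add, ← zpow_add, show i - j + (-i + j) = 0 by ring,
    zpow_zero, Units.val_one, one_mul]
  · rw [zpow_add₀ (sgn_ne_zero ty)]
    linear_combination (σ ^ j * σ ^ j) * (q - q⁻¹) * (q - q⁻¹)⁻¹ * sgn_zpow_mul_self (K := K) ty i +
      (q - q⁻¹) * (q - q⁻¹)⁻¹ * sgn_zpow_mul_self (K := K) ty j + mul_inv_cancel₀ hc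
  · rw [signedParam_inv, signedParam, zpow_neg]
    field_simp

variable [CharZero K]

/-- The conjugate of the raising relation for `y`, after the Cartan unit, which commutes with
`e_{-mδ}`, is stripped off. The ratio of the Cartan units at the two indices is the power of `k_δ`.
-/
theorem x_lie_conj_posImag (i : ℤ) {m : ℕ} (hm : m ≠ 0) :
    ⁅xCurrent ty P i, conj ty P (posImag ty P m)⁆ =
      (σ * aCoeff P m) • (((kδ ^ (m : ℤ) : (U ty P)ˣ) : U ty P) * xCurrent ty P (i - m)) := by
  have h := congrArg (conj ty P) (y_lie_posImag ty P (-i) hm)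
  have hc := q_sub_inv_ne_zero P
  have hK := (k_comm_conj ty P i (k_comm_posImag ty P i m)).units_inv_left
  have hs' := sgn_zpow_mul_self (K := K) ty i
  have hs'' := sgn_zpow_mul_self (K := K) ty m
  rw [conj_commutator, conj_smul, conj_yCurrent, conj_yCurrent, commutator_smul, lie_mul_eq,
    neg_neg, lie_eq_zero_of_commute hK.symm, zero_mul, zero_add, star_neg, star_mul', star_pow,
    star_sgn, star_aCoeff, show -(-i + (m : ℤ)) = i - m by ring, sgn_zpow_neg] at h
  have h1 := congrArg (fun a => (σ ^ i * (q - q⁻¹)⁻¹) • (((k₀ * kδ ^ i : (U ty P)ˣ) : U ty P) * a)) h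
  simp only [mul_smul_comm, ← mul_assoc, ← Units.val_mul, smul_smul, mul_inv_cancel,
    Units.val_one, one_mul, k_inv_comm_k] at h1
  rw [show σ ^ i * (q - q⁻¹)⁻¹ * σ ^ i * (q - q⁻¹) = (σ ^ i * σ ^ i) * ((q - q⁻¹) * (q - q⁻¹)⁻¹) by
    ring, hs', mul_inv_cancel₀ hc, one_mul, one_smul, commutator_skew, sub_sub_cancel] at h1
  rw [neg_eq_iff_eq_neg.1 h1, ← neg_smul]
  congr 1
  rw [zpow_add₀ (sgn_ne_zero ty), sgn_zpow_neg, pow_succ, ← zpow_natCast]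
  linear_combination (σ * aCoeff P m) * (σ ^ (m : ℤ) * σ ^ (m : ℤ) * ((q - q⁻¹) * (q - q⁻¹)⁻¹) * hs' +
    ((q - q⁻¹) * (q - q⁻¹)⁻¹) * hs'' + mul_inv_cancel₀ hc)

theorem y_lie_conj_posImag (j : ℤ) {m : ℕ} (hm : m ≠ 0) :
    ⁅yCurrent ty P j, conj ty P (posImag ty P m)⁆ =
      -(σ * aCoeff P m) • (((kδ ^ (-m : ℤ) : (U ty P)ˣ) : U ty P) * yCurrent ty P (j - m)) := by
  have h := congrArg (conj ty P) (x_lie_posImag ty P (-j) hm)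
  have hc := q_sub_inv_ne_zero P
  have hK := (k_comm_conj ty P (-j) (k_comm_posImag ty P (-j) m)).units_inv_left
  have hs' := sgn_zpow_mul_self (K := K) ty j
  have hs'' := sgn_zpow_mul_self (K := K) ty m
  rw [conj_commutator, conj_smul, conj_xCurrent, conj_xCurrent, commutator_smul, lie_mul_eq,
    neg_neg, lie_eq_zero_of_commute hK.symm, mul_zero, add_zero, star_mul', star_pow,
    star_sgn, star_aCoeff, show -(-j + (m : ℤ)) = j - m by ring, sgn_zpow_neg] at h
  have h1 := congrArg (fun a => (-(σ ^ j * (q - q⁻¹))) •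
    (a * ((k₀ * kδ ^ (-j) : (U ty P)ˣ) : U ty P))) h
  simp only [smul_mul_assoc, mul_assoc _ _ (((k₀ * kδ ^ (-j) : (U ty P)ˣ) : U ty P)),
    ← Units.val_mul, smul_smul, inv_mul_cancel, Units.val_one, mul_one, k_inv_comm_k'] at h1
  rw [show -(σ ^ j * (q - q⁻¹)) * -(σ ^ j * (q - q⁻¹)⁻¹) =
    (σ ^ j * σ ^ j) * ((q - q⁻¹) * (q - q⁻¹)⁻¹) by
    ring, hs', mul_inv_cancel₀ hc, one_mul, one_smul, commutator_skew, sub_add_cancel_left] at h1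
  rw [neg_eq_iff_eq_neg.1 h1, ← neg_smul, ← (kδ_zpow_central ty P _ _).eq]
  congr 1
  rw [zpow_add₀ (sgn_ne_zero ty), sgn_zpow_neg, pow_succ, ← zpow_natCast]
  linear_combination -(σ * aCoeff P m) *
    (σ ^ (m : ℤ) * σ ^ (m : ℤ) * ((q - q⁻¹) * (q - q⁻¹)⁻¹) * hs' +
    ((q - q⁻¹) * (q - q⁻¹)⁻¹) * hs'' + mul_inv_cancel₀ hc)

/-- The element `e_{-mδ}` lowers both currents by `m`, so its commutator with the `n`-th Newton
coefficient vanishes unless `n = m`. The `n` from differentiating `t^n` cancels the `1/n` relating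
`e_{nδ}` to the Newton coefficient. -/
theorem posImag_lie_conj {n m : ℕ} (hn : n ≠ 0) (hm : m ≠ 0) :
    ⁅posImag ty P n, conj ty P (posImag ty P m)⁆ = if n = m then
      (aCoeff P m * (q - q⁻¹)⁻¹) • (((kδ ^ (m : ℤ) : (U ty P)ˣ) : U ty P) -
        ((kδ ^ (-m : ℤ) : (U ty P)ˣ) : U ty P)) else 0 := by
  rw [posImag_eq ty P n, logCoeff_eq ty P hn, smul_commutator, smul_commutator,
    (loopCurrents ty P).newton_lie_lowering (Φ := fun l => -(σ ^ l) • ((k₀ : U ty P) *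
      conj ty P (ψ (-l).toNat) * k₀)) (fun i j hij => ?_) (Nat.pos_of_ne_zero hm)
      (fun i => x_lie_conj_posImag ty P i hm) (fun j => y_lie_conj_posImag ty P j hm)]
  · split_ifs with h
    · subst h
      rw [smul_smul, smul_smul, genConst_inv]
      congr 1
      have hn' : (n : K) ≠ 0 := Nat.cast_ne_zero.2 hn
      have hs := sgn_mul_self (K := K) ty
      rw [show σ * (q - q⁻¹)⁻¹ * (n : K)⁻¹ * (n * (σ * aCoeff P n)) =
        (σ * σ) * (((n : K)⁻¹ * n) * (aCoeff P n * (q - q⁻¹)⁻¹)) by ring, hs, inv_mul_cancel₀ hn',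
        one_mul, one_mul]
    · rw [smul_zero, smul_zero]
  · rw [pBracket_neg, (loopCurrents ty P).bracket_eq_psi (r := (-(i + j)).toNat) (by omega) (by omega)]

end ConjugateRootVectors
-- Translation from currents back to root vectors.
section NegativeIndices

variable {K : Type*} [Field K] [StarRing K] (ty : AffineType) (P : DeformationParameter K)

local notation "k₀" => U.k ty P (CartanLabel.simple Node.alpha)
local notation "kδ" => kDelta ty P
local notation "q" => DeformationParameter.q P
local notation "σ" => sgn K ty

theorem kRoot_rootPlus (n : ℤ) : kRoot ty P (rootPlus n) = k₀ * kδ ^ n := by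
  simp [kRoot, rootPlus, rootDelta, rootAlpha]

theorem kRoot_rootMinus (n : ℤ) : kRoot ty P (rootMinus n) = (k₀ * kδ ^ (-n))⁻¹ := by
  rw [mul_inv_rev, ← zpow_neg, neg_neg,
    ((kδ_comm_k ty P (.simple .alpha)).zpow_left n).inv_right.eq]
  simp [kRoot, rootMinus, rootDelta, rootAlpha]

theorem superBracket_rootImag_right {A : Type*} [Ring A] (β : RootLattice) (m : ℤ) (x y : A) :
    superBracket ty β (rootImag m) x y = ⁅x, y⁆ :=
  superBracket_of_right_even ty _ _ (by simp [rootImag, rootDelta])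

theorem superBracket_rootImag_left {A : Type*} [Ring A] (β : RootLattice) (m : ℤ) (x y : A) :
    superBracket ty (rootImag m) β x y = ⁅x, y⁆ :=
  superBracket_of_left_even ty _ _ (by simp [rootImag, rootDelta])

theorem ePlus_of_nonneg {n : ℤ} (hn : 0 ≤ n) : ePlus ty P n = xCurrent ty P n := by
  lift n to ℕ using hn
  rfl

theorem ePlus_neg {n : ℤ} (hn : 0 < n) : ePlus ty P (-n) =
    (-σ ^ (n + 1)) • (((k₀ * kδ ^ (-n))⁻¹ : (U ty P)ˣ) * xCurrent ty P (-n)) := by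
  obtain ⟨k, rfl⟩ : ∃ k : ℕ, n = k + 1 := ⟨(n - 1).toNat, by omega⟩
  have h0 : ePlus ty P (-(k + 1)) = negPlus ty P k := by
    rw [show -(k + 1 : ℤ) = Int.negSucc k by omega]
    rfl
  have hs := sgn_zpow_mul_self (K := K) ty k
  rw [h0, xCurrent_neg, mul_smul_comm, Units.inv_mul_cancel_left, smul_smul,
    zpow_add₀ (sgn_ne_zero ty), zpow_add₀ (sgn_ne_zero ty), zpow_one, mul_assoc _ σ σ,
    sgn_mul_self, mul_one, neg_mul_neg, ← zpow_natCast, hs, one_smul]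

theorem eMinus_of_pos {n : ℤ} (hn : 0 < n) :
    eMinus ty P n = (genConst ty P)⁻¹ • yCurrent ty P n := by
  obtain ⟨k, rfl⟩ : ∃ k : ℕ, n = k + 1 := ⟨(n - 1).toNat, by omega⟩
  have h0 : yCurrent ty P (k + 1) = genConst ty P • posMinus ty P k := rfl
  rw [h0, inv_smul_smul₀ (genConst_ne_zero ty P)]
  rfl

theorem eMinus_neg {n : ℤ} (hn : 0 ≤ n) : eMinus ty P (-n) =
    (-(σ ^ n * (q - q⁻¹)⁻¹)) • (yCurrent ty P (-n) * ((k₀ * kδ ^ n)⁻¹ : (U ty P)ˣ)) := by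
  lift n to ℕ using hn
  have h0 : eMinus ty P (-n) = negMinus ty P n := by
    cases n <;> rfl
  rw [h0, ← conj_posPlus, ← conj_xCurrent]
  rfl

theorem eImag_neg {m : ℕ} (hm : m ≠ 0) : eImag ty P (-m) = conj ty P (posImag ty P m) := by
  obtain ⟨k, rfl⟩ := Nat.exists_eq_succ_of_ne_zero hm
  rfl

theorem eImag_natCast (m : ℕ) : eImag ty P m = posImag ty P m := rfl

variable [CharZero K]

theorem ePlus_lie_eImag {n m : ℤ} (hn : 0 ≤ n) (hm : 0 < m) : ⁅ePlus ty P n, eImag ty P m⁆ =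
    ((-1) ^ ((m - 1) * ty.theta) * aCoeff P m) • ePlus ty P (n + m) := by
  rw [ePlus_of_nonneg ty P hn, ePlus_of_nonneg ty P (by omega)]
  lift m to ℕ using hm.le
  rw [neg_one_zpow_sub_one_mul_theta, eImag_natCast, x_lie_posImag ty P n (by omega)]

theorem posImag_lie_y (n : ℤ) {m : ℕ} (hm : m ≠ 0) :
    ⁅posImag ty P m, yCurrent ty P n⁆ = (σ ^ (m + 1) * aCoeff P m) • yCurrent ty P (n + m) := by
  rw [commutator_skew, y_lie_posImag ty P n hm, neg_smul, neg_neg]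

theorem eImag_lie_eMinus {n m : ℤ} (hn : 0 < n) (hm : 0 < m) : ⁅eImag ty P m, eMinus ty P n⁆ =
    ((-1) ^ ((m - 1) * ty.theta) * aCoeff P m) • eMinus ty P (n + m) := by
  rw [eMinus_of_pos ty P hn, eMinus_of_pos ty P (by omega)]
  lift m to ℕ using hm.le
  rw [neg_one_zpow_sub_one_mul_theta, eImag_natCast, commutator_smul,
    posImag_lie_y ty P n (by omega), smul_comm]

/-- The common source of two cases of the theorem. The Cartan prefactor commutes with `e_{mδ}`, so
only the current is shifted; the sign of `m - n` decides how the shifted current is read as a root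
vector. -/
theorem ePlus_neg_lie_posImag {n : ℤ} {m : ℕ} (hn : 0 < n) (hm : m ≠ 0) :
    ⁅ePlus ty P (-n), posImag ty P m⁆ = (-(σ ^ (n + m) * aCoeff P m)) •
      ((((k₀ * kδ ^ (-n))⁻¹ : (U ty P)ˣ) : U ty P) * xCurrent ty P (m - n)) := by
  have hK := (k_comm_posImag ty P (-n) m).units_inv_left
  have hs := sgn_mul_self (K := K) ty
  rw [ePlus_neg ty P hn, smul_commutator, mul_lie_eq, lie_eq_zero_of_commute hK, zero_mul,
    zero_add, x_lie_posImag ty P _ hm, mul_smul_comm, smul_smul, neg_add_eq_sub]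
  congr 1
  rw [zpow_add₀ (sgn_ne_zero ty), zpow_add₀ (sgn_ne_zero ty), zpow_natCast, zpow_one]
  linear_combination -(σ ^ n * σ ^ m * aCoeff P m) * hs

theorem posImag_lie_eMinus_neg {n : ℤ} {m : ℕ} (hn : 0 ≤ n) (hm : m ≠ 0) :
    ⁅posImag ty P m, eMinus ty P (-n)⁆ = (-(σ ^ (n + m) * aCoeff P m)) •
      (((genConst ty P)⁻¹ • yCurrent ty P (m - n)) *
        (((k₀ * kδ ^ n)⁻¹ : (U ty P)ˣ) : U ty P)) := by
  have hK := (k_comm_posImag ty P n m).units_inv_left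
  rw [eMinus_neg ty P hn, commutator_smul, lie_mul_eq, lie_eq_zero_of_commute hK.symm, mul_zero,
    add_zero, posImag_lie_y ty P _ hm, smul_mul_assoc, smul_mul_assoc, smul_smul, smul_smul,
    neg_add_eq_sub]
  congr 1
  rw [zpow_add₀ (sgn_ne_zero ty), zpow_natCast, genConst_inv]
  ring

theorem ePlus_neg_lie_eImag_of_le {n m : ℤ} (hn : 0 < n) (h : n ≤ m) :
    ⁅ePlus ty P (-n), eImag ty P m⁆ = (-((-1) ^ ((n + m) * ty.theta)) * aCoeff P m) •
      (((kRoot ty P (rootMinus n) : (U ty P)ˣ) : U ty P) * ePlus ty P (m - n)) := by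
  lift m to ℕ using by omega
  rw [eImag_natCast, ePlus_neg_lie_posImag ty P hn (by omega), kRoot_rootMinus,
    ePlus_of_nonneg ty P (by omega), neg_one_zpow_mul_theta, neg_mul]

theorem ePlus_neg_lie_eImag_of_lt {n m : ℤ} (hm : 0 < m) (h : m < n) :
    ⁅ePlus ty P (-n), eImag ty P m⁆ = ((-1) ^ ty.theta * aCoeff P m) •
      (((kDelta ty P ^ m : (U ty P)ˣ) : U ty P) * ePlus ty P (-n + m)) := by
  lift m to ℕ using hm.le
  have hs := sgn_zpow_mul_self (K := K) ty (m : ℤ)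
  rw [eImag_natCast, ePlus_neg_lie_posImag ty P (by omega) (by omega),
    show -n + (m : ℤ) = -(n - m) by ring, ePlus_neg ty P (by omega), mul_smul_comm, smul_smul,
    -- Both root vectors have negative index and carry their own Cartan prefactor; the quotient of
    -- the two prefactors is `k_δ^m`.
    ← mul_assoc, ← Units.val_mul, show kδ ^ (m : ℤ) = (k₀ * kδ ^ (-n))⁻¹ * (k₀ * kδ ^ (-(n - m))) by
      rw [k_inv_comm_k']; congr 1; ring, mul_inv_cancel_right, neg_sub]
  congr 1
  rw [show n - (m : ℤ) + 1 = n + -m + 1 by ring]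
  simp only [zpow_add₀ (sgn_ne_zero (K := K) ty), sgn_zpow_neg, zpow_one]
  have hs' := sgn_mul_self (K := K) ty
  rw [← sgn]
  linear_combination (σ ^ n * σ ^ (m : ℤ) * aCoeff P m) * hs'

theorem eImag_lie_eMinus_neg_of_lt {n m : ℤ} (hn : 0 ≤ n) (h : n < m) :
    ⁅eImag ty P m, eMinus ty P (-n)⁆ = (-((-1) ^ ((n + m) * ty.theta)) * aCoeff P m) •
      (eMinus ty P (m - n) * (((kRoot ty P (rootPlus n))⁻¹ : (U ty P)ˣ) : U ty P)) := by
  lift m to ℕ using by omega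
  rw [eImag_natCast, posImag_lie_eMinus_neg ty P hn (by omega), kRoot_rootPlus,
    eMinus_of_pos ty P (by omega), neg_one_zpow_mul_theta, neg_mul]

theorem eImag_lie_eMinus_neg_of_le {n m : ℤ} (hm : 0 < m) (h : m ≤ n) :
    ⁅eImag ty P m, eMinus ty P (-n)⁆ = ((-1) ^ ty.theta * aCoeff P m) •
      (eMinus ty P (-n + m) * ((kDelta ty P ^ (-m) : (U ty P)ˣ) : U ty P)) := by
  lift m to ℕ using hm.le
  rw [eImag_natCast, posImag_lie_eMinus_neg ty P (by omega) (by omega),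
    show -n + (m : ℤ) = -(n - m) by ring, eMinus_neg ty P (by omega), smul_mul_assoc,
    smul_mul_assoc, smul_smul, smul_smul, mul_assoc (yCurrent ty P _), ← Units.val_mul,
    show (k₀ * kδ ^ n)⁻¹ = (k₀ * kδ ^ (n - m))⁻¹ * kδ ^ (-m : ℤ) by
      rw [eq_inv_mul_iff_mul_eq, k_inv_comm_k]; congr 1; ring, neg_sub]
  congr 1
  rw [genConst_inv, sub_eq_add_neg n]
  simp only [zpow_add₀ (sgn_ne_zero (K := K) ty), sgn_zpow_neg]
  rw [← sgn]
  ring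

theorem eImag_lie_eImag_neg {n m : ℤ} (hn : 0 < n) (hm : 0 < m) :
    ⁅eImag ty P n, eImag ty P (-m)⁆ = if n = m then
      (aCoeff P m * (q - q⁻¹)⁻¹) • (((kDelta ty P ^ m : (U ty P)ˣ) : U ty P) -
        ((kDelta ty P ^ (-m) : (U ty P)ˣ) : U ty P)) else 0 := by
  lift m to ℕ using hm.le
  lift n to ℕ using hn.le
  rw [eImag_natCast, eImag_neg ty P (by omega), posImag_lie_conj ty P (by omega) (by omega)]
  simp only [Nat.cast_inj]

end NegativeIndices
end QuantumAffine

theorem proposition3p2 {K : Type*} [Field K] [CharZero K] [StarRing K]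
    (ty : AffineType) (P : DeformationParameter K) :
    -- `ℰ'(u) = -1 + exp ℰ(u)`
    (genSeries ty P (ePrime ty P) =
      -1 + psExp (K := K) (genSeries ty P fun n => eImag ty P n)) ∧
    -- `[e_{nδ+α}, e_{mδ}]`
    (∀ n m : ℤ, 0 ≤ n → 0 < m →
      superBracket ty (rootPlus n) (rootImag m) (ePlus ty P n) (eImag ty P m) =
        ((-1) ^ ((m - 1) * ty.theta) * aCoeff P m) • ePlus ty P (n + m)) ∧
    -- `[e_{mδ}, e_{nδ-α}]`
    (∀ n m : ℤ, 0 < n → 0 < m →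
      superBracket ty (rootImag m) (rootMinus n) (eImag ty P m) (eMinus ty P n) =
        ((-1) ^ ((m - 1) * ty.theta) * aCoeff P m) • eMinus ty P (n + m)) ∧
    -- `[e_{-nδ+α}, e_{mδ}]`, `m ≥ n`
    (∀ n m : ℤ, 0 < n → n ≤ m →
      superBracket ty (rootPlus (-n)) (rootImag m) (ePlus ty P (-n)) (eImag ty P m) =
        (-((-1) ^ ((n + m) * ty.theta)) * aCoeff P m) •
          (((kRoot ty P (rootMinus n) : (U ty P)ˣ) : U ty P) * ePlus ty P (m - n))) ∧
    -- `[e_{-nδ+α}, e_{mδ}]`, `n > m`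
    (∀ n m : ℤ, 0 < m → m < n →
      superBracket ty (rootPlus (-n)) (rootImag m) (ePlus ty P (-n)) (eImag ty P m) =
        ((-1) ^ ty.theta * aCoeff P m) •
          (((kDelta ty P ^ m : (U ty P)ˣ) : U ty P) * ePlus ty P (-n + m))) ∧
    -- `[e_{mδ}, e_{-nδ-α}]`, `m > n`
    (∀ n m : ℤ, 0 ≤ n → n < m →
      superBracket ty (rootImag m) (rootMinus (-n)) (eImag ty P m) (eMinus ty P (-n)) =
        (-((-1) ^ ((n + m) * ty.theta)) * aCoeff P m) •
          (eMinus ty P (m - n) * (((kRoot ty P (rootPlus n))⁻¹ : (U ty P)ˣ) : U ty P))) ∧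
    -- `[e_{mδ}, e_{-nδ-α}]`, `n ≥ m`
    (∀ n m : ℤ, 0 < m → m ≤ n →
      superBracket ty (rootImag m) (rootMinus (-n)) (eImag ty P m) (eMinus ty P (-n)) =
        ((-1) ^ ty.theta * aCoeff P m) •
          (eMinus ty P (-n + m) * ((kDelta ty P ^ (-m) : (U ty P)ˣ) : U ty P))) ∧
    -- `[e_{nδ}, e_{-mδ}]`
    (∀ n m : ℤ, 0 < n → 0 < m →
      superBracket ty (rootImag n) (rootImag (-m)) (eImag ty P n) (eImag ty P (-m)) =
        if n = m then
          (aCoeff P m * (P.q - P.q⁻¹)⁻¹) •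
            (((kDelta ty P ^ m : (U ty P)ˣ) : U ty P) -
              ((kDelta ty P ^ (-m) : (U ty P)ˣ) : U ty P))
        else 0) := by
  refine ⟨genSeries_ePrime_eq ty P, fun n m hn hm => ?_, fun n m hn hm => ?_,
    fun n m hn h => ?_, fun n m hm h => ?_, fun n m hn h => ?_, fun n m hm h => ?_,
    fun n m hn hm => ?_⟩
  · rw [superBracket_rootImag_right, ePlus_lie_eImag ty P hn hm]
  · rw [superBracket_rootImag_left, eImag_lie_eMinus ty P hn hm]
  · rw [superBracket_rootImag_right, ePlus_neg_lie_eImag_of_le ty P hn h]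
  · rw [superBracket_rootImag_right, ePlus_neg_lie_eImag_of_lt ty P hm h]
  · rw [superBracket_rootImag_left, eImag_lie_eMinus_neg_of_lt ty P hn h]
  · rw [superBracket_rootImag_left, eImag_lie_eMinus_neg_of_le ty P hm h]
  · rw [superBracket_rootImag_left, eImag_lie_eImag_neg ty P hn hm]
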